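/- Let $d\ge 1$, let $\mathcal L\subset\mathbb R^d$ be the lattice generated by a basis $(a_1,\dots,a_d)$ of $\mathbb R^d$, $\mathcal D=\{\sum_i t_ia_i:\ t\in[0,1)^d\}$ its fundamental domain, and $\Lambda_n=\mathcal L\cap[-n,n]^d$. Let $\mathbb Q$ be a probability measure on $\mathbb R^d$ and let $H$ be a measurable function from the finite subsets of $\mathbb R^d$ (with the $\sigma$-algebra generated by the counts $\gamma\mapsto\#(\gamma\cap W)$, $W$ Borel) to $\mathbb R\cup\{\infty\}$. In differences of energies we use the convention $\infty-\infty=0$. For a bounded set $W$ and a locally finite set $\gamma\subset\mathbb R^d$ put $H_W(\gamma)=\lim_{n\to\infty}\big(H(\gamma\cap[-n,n]^d)-H((\gamma\cap[-n,n]^d)\setminus W)\big)$ when the limit exists. Assume: (H1) there is $A\ge0$ with $H(\gamma)\ge -A\,\#\gamma$ for all finite $\gamma$; (H2) there are $\varepsilon>0$ and $B\ge 0$ such that $H(\{i+x_i\}_{i\in\Lambda})\le B\,\#\Lambda$ for all finite $\Lambda\subset\mathcal L$ whenever $|x_i|\le\varepsilon$ for all $i\in\mathcal L$; (H3) $H(\gamma)=\infty$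 implies $H(\gamma\cup\{x\})=\infty$ for all $x\in\mathbb R^d$; (H4) $H(\gamma+v)=H(\gamma)$ for all $v\in\mathbb R^d$ and all finite $\gamma$; and one of the following two pairs of conditions: (a) (H5.1) there is $R>0$ such that for every bounded $W\subset\mathbb R^d$ and every locally finite $\gamma$ with $H((\gamma\cap[-n,n]^d)\setminus W)<\infty$ for all $n$, the limit $H_W(\gamma)$ exists and equals $H_W(\gamma\cap(W\oplus B(0,R)))$; and (Q1[1]) $\int e^{c|x|}\,\mathbb Q(dx)<\infty$ for some $c>0$; (b) (H5.2) there are $\phi:\mathbb R^+\to\mathbb R\cup\{\infty\}$, monotone on some half-line $(r_0,\infty)$, and $\epsilon>0$ with $H(\gamma)=\sum_{\{x,y\}\subset\gamma}\phi(|x-y|)$ for all finite $\gamma$ and $\int_\epsilon^\infty r^{d-1}|\phi(r)|\,dr<\infty$; and (Q2) $\mathbb Q$ has bounded support. For $\mathbf x\in(\mathbb R^d)^{\mathcal L}$ and finite $\Delta\subset\mathcal L$ let $$\tilde H_\Delta(\mathbf x)=\lim_{n\to\infty}\Big(H(\{i+x_i\}_{i\in\Lambda_n})-H(\{i+x_i\}_{i\in\Lambda_n\setminus\Delta})\Big).$$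 Let $\mathcal G_{\mathcal L}(H,\mathbb Q)$ be the set of probability measures $P$ on $(\mathbb R^d)^{\mathcal L}$ that are invariant under the translations by $\mathcal L$ and satisfy the DLR equations: for every finite $\Delta\subset\mathcal L$ and $P$-almost every $\mathbf x_{\Delta^c}$, the limit $\tilde H_\Delta(\mathbf x'_\Delta\cup\mathbf x_{\Delta^c})$ exists for $\mathbb Q^{\otimes\Delta}$-almost every $\mathbf x'_\Delta$ and $$P(d\mathbf x_\Delta'\mid\mathbf x_{\Delta^c})=\frac1{Z_\Delta(\mathbf x_{\Delta^c})}e^{-\tilde H_\Delta(\mathbf x_\Delta'\cup\mathbf x_{\Delta^c})}\,\mathbb Q^{\otimes\Delta}(d\mathbf x'_\Delta),\qquad Z_\Delta(\mathbf x_{\Delta^c})=\int e^{-\tilde H_\Delta(\mathbf x_\Delta'\cup\mathbf x_{\Delta^c})}\,\mathbb Q^{\otimes\Delta}(d\mathbf x'_\Delta)\in(0,\infty).$$ A Gibbs perturbed lattice is a random set $\mathbf\Gamma=\{i+X_i+U:\ i\in\mathcal L\}$, where the law of $\mathbf X=(X_i)_{i\in\mathcal L}$ belongs to $\mathcal G_{\mathcal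 L}(H,\mathbb Q)$, $U$ is uniformly distributed on $\mathcal D$, and $\mathbf X$ and $U$ are independent; $P_{\mathcal L}(H,\mathbb Q)$ denotes the set of (laws of) stationary Gibbs perturbed lattices. Then $\mathcal G_{\mathcal L}(H,\mathbb Q)\ne\emptyset$ and $P_{\mathcal L}(H,\mathbb Q)\neq\emptyset$. Every Gibbs perturbed lattice $\mathbf\Gamma$ is a stationary point process on $\mathbb R^d$: it is almost surely locally finite, and $\mathbf\Gamma+v$ has the law of $\mathbf\Gamma$ for every $v\in\mathbb R^d$. Moreover the laws $\mathbb P_u$ of $\{i+X_i+u:\ i\in\mathcal L\}$, $u\in\mathbb R^d$, form a regular conditional distribution of $\mathbf\Gamma$ given $U=u$, and for every $u\in\mathbb R^d$ the law $\mathbb P_u$ is invariant under all translations by vectors of $\mathcal L$. -/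

import Mathlib

open MeasureTheory ProbabilityTheory Filter Topology
open scoped Pointwise ENNReal

noncomputable section

namespace GibbsLattice

/-- Euclidean space `ℝ^d`. -/
abbrev E (d : ℕ) : Type := EuclideanSpace ℝ (Fin d)

/-- The lattice generated by the basis `b`. -/
abbrev Lat {d : ℕ} (b : Module.Basis (Fin d) ℝ (E d)) : Submodule ℤ (E d) :=
  Submodule.span ℤ (Set.range b)

/-- The configuration space `(ℝ^d)^L` of displacement fields, with the product σ-algebra. -/
abbrev Field {d : ℕ} (b : Module.Basis (Fin d) ℝ (E d)) : Type := Lat b → E d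

/-- The cube `[-n,n]^d`. -/
def cube (d n : ℕ) : Set (E d) := {x | ∀ k, |x k| ≤ n}

theorem cube_bounded (d n : ℕ) : Bornology.IsBounded (cube d n) := by
  refine isBounded_iff_forall_norm_le.2 ⟨Real.sqrt (∑ _k : Fin d, (n : ℝ) ^ 2), fun x hx => ?_⟩
  rw [EuclideanSpace.norm_eq]
  refine Real.sqrt_le_sqrt (Finset.sum_le_sum fun k _ => ?_)
  rw [Real.norm_eq_abs]
  exact pow_le_pow_left₀ (abs_nonneg _) (hx k) 2

/-- `Λ_n = [-n,n]^d ∩ L`, as a finite subset of `L`. -/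
def box {d : ℕ} (b : Module.Basis (Fin d) ℝ (E d)) (n : ℕ) : Finset (Lat b) :=
  Set.Finite.toFinset (s := {i : Lat b | (i : E d) ∈ cube d n})
    (Set.Finite.of_finite_image
      ((ZSpan.setFinite_inter b (cube_bounded d n)).subset (by
        rintro _ ⟨i, hi, rfl⟩
        exact ⟨hi, i.2⟩))
      Subtype.val_injective.injOn)

/-! ### Point configurations -/

/-- A set is locally finite if it has finitely many points in every bounded set. -/
def IsLocallyFinite {d : ℕ} (γ : Set (E d)) : Prop :=
  ∀ W : Set (E d), Bornology.IsBounded W → (γ ∩ W).Finite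

theorem IsLocallyFinite.inter {d : ℕ} {γ : Set (E d)} (h : IsLocallyFinite γ) (V : Set (E d)) :
    IsLocallyFinite (γ ∩ V) :=
  fun W hW => (h W hW).subset (Set.inter_subset_inter_left _ Set.inter_subset_left)

/-- The finite configuration `γ ∩ [-n,n]^d`. -/
def IsLocallyFinite.window {d : ℕ} {γ : Set (E d)} (h : IsLocallyFinite γ) (n : ℕ) :
    Finset (E d) :=
  (h (cube d n) (cube_bounded d n)).toFinset

open scoped Classical in
/-- `γ \ W` for a finite configuration `γ`. -/
def outside {d : ℕ} (γ : Finset (E d)) (W : Set (E d)) : Finset (E d) :=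
  γ.filter (fun x => x ∉ W)

/-- The σ-algebra on finite configurations generated by the counting functions
`γ ↦ #(γ ∩ W)`, for `W` Borel. -/
@[reducible] def finiteConfigSigma (d : ℕ) : MeasurableSpace (Finset (E d)) :=
  ⨆ (W : Set (E d)) (_ : MeasurableSet W),
    MeasurableSpace.comap (fun γ : Finset (E d) => ((γ : Set (E d)) ∩ W).encard) ⊤

/-- Countable subsets of `ℝ^d`. -/
structure CountableSubset (d : ℕ) where
  carrier : Set (E d)
  countable : carrier.Countable

/-- The σ-algebra generated by the counting functions `γ ↦ #(γ ∩ W) ∈ ℕ ∪ {∞}`, `W` Borel. -/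
instance (d : ℕ) : MeasurableSpace (CountableSubset d) :=
  ⨆ (W : Set (E d)) (_ : MeasurableSet W),
    MeasurableSpace.comap (fun γ : CountableSubset d => (γ.carrier ∩ W).encard) ⊤

/-- The translate `γ + v`. -/
def CountableSubset.translate {d : ℕ} (γ : CountableSubset d) (v : E d) : CountableSubset d where
  carrier := (fun x => x + v) '' γ.carrier
  countable := γ.countable.image _

/-- A random countable set is a point process if it is measurable and almost surely locally
finite; it is stationary if moreover its law is invariant under all translations. -/
structure IsStationaryPointProcess {d : ℕ} {S : Type*} [MeasurableSpace S] (μ : Measure S)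
    (Γ : S → CountableSubset d) : Prop where
  measurable : Measurable Γ
  locallyFinite : ∀ᵐ s ∂μ, IsLocallyFinite (Γ s).carrier
  stationary : ∀ v : E d, μ.map (fun s => (Γ s).translate v) = μ.map Γ

/-! ### Hamiltonians -/

/-- The difference `a - b` with the convention `∞ - ∞ = 0`. -/
def energyDiff (a b : EReal) : EReal :=
  open scoped Classical in if a = ⊤ ∧ b = ⊤ then 0 else a - b

/-- A Hamiltonian: a measurable function from finite configurations to `ℝ ∪ {∞}`. -/
structure IsHamiltonian {d : ℕ} (H : Finset (E d) → EReal) : Prop where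
  measurable : Measurable[finiteConfigSigma d] H
  ne_bot : ∀ γ, H γ ≠ ⊥

/-- Stability. -/
def Stable {d : ℕ} (H : Finset (E d) → EReal) : Prop :=
  ∃ A : ℝ, 0 ≤ A ∧ ∀ γ : Finset (E d), ((-(A * γ.card) : ℝ) : EReal) ≤ H γ

open scoped Classical in
/-- The finite set of points `{i + x_i : i ∈ Λ}`. -/
def points {d : ℕ} {b : Module.Basis (Fin d) ℝ (E d)} (Λ : Finset (Lat b)) (x : Field b) :
    Finset (E d) :=
  Λ.image (fun i : Lat b => (i : E d) + x i)

/-- Non-degeneracy. -/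
def NonDegenerate {d : ℕ} (b : Module.Basis (Fin d) ℝ (E d)) (H : Finset (E d) → EReal) : Prop :=
  ∃ ε : ℝ, 0 < ε ∧ ∃ B : ℝ, 0 ≤ B ∧ ∀ x : Field b, (∀ i, ‖x i‖ ≤ ε) →
    ∀ Λ : Finset (Lat b), H (points Λ x) ≤ ((B * Λ.card : ℝ) : EReal)

open scoped Classical in
/-- Heredity. -/
def Hereditary {d : ℕ} (H : Finset (E d) → EReal) : Prop :=
  ∀ γ, H γ = ⊤ → ∀ x : E d, H (insert x γ) = ⊤

open scoped Classical in
/-- Translation invariance. -/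
def TranslationInvariant {d : ℕ} (H : Finset (E d) → EReal) : Prop :=
  ∀ (v : E d) (γ : Finset (E d)), H (γ.image (fun x => x + v)) = H γ

/-- `h` is the local energy `H_W(γ) = lim_n H(γ ∩ [-n,n]^d) - H((γ ∩ [-n,n]^d) \ W)`. -/
def IsLocalEnergy {d : ℕ} (H : Finset (E d) → EReal) (W : Set (E d)) {γ : Set (E d)}
    (hγ : IsLocallyFinite γ) (h : EReal) : Prop :=
  Tendsto (fun n : ℕ => energyDiff (H (hγ.window n)) (H (outside (hγ.window n) W))) atTop (𝓝 h)

/-- Finite range: `H_W(γ) = H_W(γ ∩ (W ⊕ B(0,R)))` for bounded `W` and locally finite `γ`.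
The identity is asked for only when the configuration outside `W` has finite energy: elsewhere
the convention `∞ - ∞ = 0` would make it fail for every hard-core interaction. -/
def FiniteRange {d : ℕ} (H : Finset (E d) → EReal) : Prop :=
  ∃ R : ℝ, 0 < R ∧ ∀ W : Set (E d), Bornology.IsBounded W →
    ∀ (γ : Set (E d)) (hγ : IsLocallyFinite γ), (∀ n, H (outside (hγ.window n) W) ≠ ⊤) →
      ∃ h : EReal, IsLocalEnergy H W hγ h ∧
        IsLocalEnergy H W (hγ.inter (W + Metric.ball (0 : E d) R)) h

/-- The value `φ(|x-y|)` on the unordered pair `{x,y}`. -/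
def pairValue {d : ℕ} (φ : ℝ → EReal) : Sym2 (E d) → EReal :=
  Sym2.lift ⟨fun x y => φ (dist x y), fun x y => congrArg φ (dist_comm x y)⟩

open scoped Classical in
/-- Summable pair interaction: `H(γ) = ∑_{{x,y} ⊂ γ} φ(|x-y|)` with `φ` monotone at infinity
and `∫_{r > ε} r^{d-1} |φ(r)| dr < ∞`. -/
def SummablePairPotential {d : ℕ} (H : Finset (E d) → EReal) : Prop :=
  ∃ φ : ℝ → EReal, (∀ r, φ r ≠ ⊥) ∧
    (∃ r₀ : ℝ, MonotoneOn φ (Set.Ioi r₀) ∨ AntitoneOn φ (Set.Ioi r₀)) ∧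
    (∀ γ : Finset (E d), H γ = ∑ p ∈ γ.sym2.filter (fun p => ¬ p.IsDiag), pairValue φ p) ∧
    ∃ ε : ℝ, 0 < ε ∧ ∫⁻ r in Set.Ioi ε, ENNReal.ofReal (r ^ (d - 1)) * (φ r).abs < ∞

/-! ### Displacement distributions -/

/-- Exponential moment of order `m`: `𝔼 exp(c |X|^m) < ∞` for some `c > 0`. -/
def HasExpMoment {d : ℕ} (Q : Measure (E d)) (m : ℕ) : Prop :=
  ∃ c : ℝ, 0 < c ∧ Integrable (fun x : E d => Real.exp (c * ‖x‖ ^ m)) Q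

/-- Bounded support. -/
def HasBoundedSupport {d : ℕ} (Q : Measure (E d)) : Prop :=
  Bornology.IsBounded Q.support

/-! ### Gibbs measures on the lattice -/

section

variable {d : ℕ} {b : Module.Basis (Fin d) ℝ (E d)}

open scoped Classical in
/-- `H̃(x_{Λ_n}) - H̃(x_{Λ_n \ Δ})`. -/
def energyIncrement (H : Finset (E d) → EReal) (Δ : Finset (Lat b)) (x : Field b) (n : ℕ) :
    EReal :=
  energyDiff (H (points (box b n) x)) (H (points (box b n \ Δ) x))

/-- The local energy `H̃_Δ(x) = lim_n H̃(x_{Λ_n}) - H̃(x_{Λ_n \ Δ})`. It is written as a limit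
superior to be defined everywhere; Gibbs measures are required to make the limit exist. -/
def latticeEnergy (H : Finset (E d) → EReal) (Δ : Finset (Lat b)) (x : Field b) : EReal :=
  limsup (energyIncrement H Δ x) atTop

open scoped Classical in
/-- The field `x'_Δ ∪ x_{Δᶜ}`. -/
def glue (Δ : Finset (Lat b)) (x' : {i // i ∈ Δ} → E d) (y : {i // i ∉ Δ} → E d) : Field b :=
  fun i => if h : i ∈ Δ then x' ⟨i, h⟩ else y ⟨i, h⟩

/-- The Boltzmann weight `exp(-H̃_Δ(x'_Δ ∪ y))`. -/
def weight (H : Finset (E d) → EReal) (Δ : Finset (Lat b)) (y : {i // i ∉ Δ} → E d)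
    (x' : {i // i ∈ Δ} → E d) : ℝ≥0∞ :=
  EReal.exp (-latticeEnergy H Δ (glue Δ x' y))

/-- The partition function `Z_Δ(y) = ∫ exp(-H̃_Δ(x'_Δ ∪ y)) Q^{⊗Δ}(dx')`. -/
def partition (H : Finset (E d) → EReal) (Q : Measure (E d)) (Δ : Finset (Lat b))
    (y : {i // i ∉ Δ} → E d) : ℝ≥0∞ :=
  ∫⁻ x', weight H Δ y x' ∂(Measure.pi fun _ : {i // i ∈ Δ} => Q)

/-- The measure `Z_Δ(y)⁻¹ exp(-H̃_Δ(x'_Δ ∪ y)) Q^{⊗Δ}(dx')`. If `Z_Δ(y)` is `0` or `∞` this is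
the zero measure, so the DLR equations force `0 < Z_Δ < ∞` almost surely. -/
def specification (H : Finset (E d) → EReal) (Q : Measure (E d)) (Δ : Finset (Lat b))
    (y : {i // i ∉ Δ} → E d) : Measure ({i // i ∈ Δ} → E d) :=
  (partition H Q Δ y)⁻¹ • (Measure.pi fun _ : {i // i ∈ Δ} => Q).withDensity (weight H Δ y)

/-- The restriction `x_Δ`. -/
def restrictIn (Δ : Finset (Lat b)) (x : Field b) : {i // i ∈ Δ} → E d := fun i => x i

/-- The restriction `x_{Δᶜ}`. -/
def restrictOut (Δ : Finset (Lat b)) (x : Field b) : {i // i ∉ Δ} → E d := fun i => x i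

/-- The field translated by a lattice vector. -/
def shift (k : Lat b) (x : Field b) : Field b := fun i => x (i + k)

end

/-- Gibbs measures: lattice-translation invariant probability measures on `(ℝ^d)^L` such that, for
each finite `Δ` and almost every `y = x_{Δᶜ}`, the local energy exists as a limit and the
conditional law of `x_Δ` given `x_{Δᶜ} = y` is `Z_Δ(y)⁻¹ exp(-H̃_Δ(x'_Δ ∪ y)) Q^{⊗Δ}(dx')`. -/
structure IsGibbsMeasure {d : ℕ} (b : Module.Basis (Fin d) ℝ (E d)) (H : Finset (E d) → EReal)
    (Q : Measure (E d)) (P : ProbabilityMeasure (Field b)) : Prop where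
  invariant : ∀ k : Lat b, (P : Measure (Field b)).map (shift k) = P
  energy_exists : ∀ Δ : Finset (Lat b), ∀ᵐ y ∂((P : Measure (Field b)).map (restrictOut Δ)),
    ∀ᵐ x' ∂(Measure.pi fun _ : {i // i ∈ Δ} => Q),
      ∃ h : EReal, Tendsto (energyIncrement H Δ (glue Δ x' y)) atTop (𝓝 h)
  dlr : ∀ Δ : Finset (Lat b), ∀ᵐ y ∂((P : Measure (Field b)).map (restrictOut Δ)),
    condDistrib (restrictIn Δ) (restrictOut Δ) (P : Measure (Field b)) y = specification H Q Δ y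

/-- The set of Gibbs measures. -/
def gibbsMeasures {d : ℕ} (b : Module.Basis (Fin d) ℝ (E d)) (H : Finset (E d) → EReal)
    (Q : Measure (E d)) : Set (ProbabilityMeasure (Field b)) :=
  {P | IsGibbsMeasure b H Q P}

/-! ### Gibbs perturbed lattices -/

/-- The perturbed lattice `{i + x_i + u : i ∈ L}`. -/
def perturbedLattice {d : ℕ} {b : Module.Basis (Fin d) ℝ (E d)} (x : Field b) (u : E d) :
    CountableSubset d where
  carrier := Set.range fun i : Lat b => (i : E d) + x i + u
  countable := Set.countable_range _

/-- The uniform distribution on the fundamental domain `{∑ t_i a_i : t ∈ [0,1)^d}`. -/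
def uniformD {d : ℕ} (b : Module.Basis (Fin d) ℝ (E d)) : Measure (E d) :=
  ProbabilityTheory.cond (volume : Measure (E d)) (ZSpan.fundamentalDomain b)

/-- `X` and `U` are independent, `X` is distributed as a Gibbs measure and `U` is uniform on the
fundamental domain: `perturbedLattice X U` is a Gibbs perturbed lattice. -/
structure IsGibbsPerturbation {d : ℕ} (b : Module.Basis (Fin d) ℝ (E d))
    (H : Finset (E d) → EReal) (Q : Measure (E d)) {S : Type*} [MeasurableSpace S]
    (μ : Measure S) (X : S → Field b) (U : S → E d) : Prop where
  measurable_X : Measurable X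
  measurable_U : Measurable U
  gibbs : ∃ P ∈ gibbsMeasures b H Q, μ.map X = (P : Measure (Field b))
  uniform : μ.map U = uniformD b
  indep : IndepFun X U μ

/-- The set of (laws of) stationary Gibbs perturbed lattices. -/
def gibbsPerturbedLattices {d : ℕ} (b : Module.Basis (Fin d) ℝ (E d)) (H : Finset (E d) → EReal)
    (Q : Measure (E d)) : Set (Measure (CountableSubset d)) :=
  {law | ∃ P ∈ gibbsMeasures b H Q,
    IsStationaryPointProcess ((P : Measure (Field b)).prod (uniformD b))
      (fun p => perturbedLattice p.1 p.2) ∧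
    law = ((P : Measure (Field b)).prod (uniformD b)).map (fun p => perturbedLattice p.1 p.2)}

/-- `κ` is a regular conditional distribution of `Γ` given `U`. -/
structure IsCondLaw {d : ℕ} {S : Type*} [MeasurableSpace S] (μ : Measure S)
    (Γ : S → CountableSubset d) (U : S → E d) (κ : E d → Measure (CountableSubset d)) : Prop where
  prob : ∀ u, IsProbabilityMeasure (κ u)
  measurable : ∀ B, MeasurableSet B → Measurable fun u => κ u B
  disintegration : ∀ A B, MeasurableSet A → MeasurableSet B →
    μ {s | U s ∈ A ∧ Γ s ∈ B} = ∫⁻ u in A, κ u B ∂(μ.map U)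

/-- The law `P_u` of `{i + X_i + u : i ∈ L}`. -/
def lawGiven {d : ℕ} {b : Module.Basis (Fin d) ℝ (E d)} {S : Type*} [MeasurableSpace S]
    (μ : Measure S) (X : S → Field b) (u : E d) : Measure (CountableSubset d) :=
  μ.map fun s => perturbedLattice (X s) u

end GibbsLattice

end

open MeasureTheory ProbabilityTheory Filter Topology
open scoped Pointwise ENNReal

noncomputable section

namespace GibbsLattice

/-! ### Measurability of point configurations -/

/-! The Gibbs measure is a limit of finite-volume ones. In a large box Λ the free field (independent
displacements of law Q) is weighted by the Boltzmann factor, and the result is averaged over the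
shifts by k in Λ. Stability bounds the Boltzmann factor from above. Non-degeneracy, recentred at a
point of the support of Q by translation invariance, bounds the partition function from below. So
the density with respect to the free field is at most exp(K·#Λ) (`exists_freeGibbs_le`). Blocks of
the free field on disjoint windows are independent, and an exponential moment estimate turns this
density bound into absolute continuity of the averaged measures on each finite window, uniformly in
Λ (`averagedGibbs_uniform_absolutelyContinuous`). This gives tightness, and convergence along an
ultrafilter for every event depending on finitely many displacements (`exists_tendstoLocally`). The
limit P is shift invariant because the boundary of a box is negligible.

For the DLR equations, both interaction classes are reduced to one property, `QuasiLocal`: up to an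
error η, the energy of a window ignores indices whose points are farther than some R from the
origin. A double count (`sum_freeGibbs_far_le`) shows that a remote index rarely has its point
within R of the origin, on average over the shifts. The weight in the box may thus be replaced by
the weight in a fixed finite Λ', at the price of a factor exp(2η) and a small additive error.
Letting the box grow, then Λ', then η → 0 gives one inequality for P
(`TendstoLocally.le_windowProb`), and the same inequality for the complementary event makes it an
equality. Displacements in the window are kept below M throughout; M → ∞ comes last and also yields
the finiteness of the partition function (`HasWindowProb.ae_windowMass_ne_top`).

Finite range interactions are quasi-local with no error. For a summable pair potential and bounded
displacements, the error is the tail of a convergent lattice sum.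

Stationarity is a matter of relabelling. Translating by v moves the uniform shift u to u + v;
folding it back into the fundamental domain subtracts a lattice vector, which acts on the field as a
shift, and both operations preserve the joint law (`map_refold`). -/

theorem measurable_encard_range_inter {Ω ι : Type*} [MeasurableSpace Ω] [Countable ι] {d : ℕ}
    {p : ι → Ω → E d} (hp : ∀ i, Measurable (p i)) {W : Set (E d)} (hW : MeasurableSet W) :
    Measurable[_, ⊤] fun ω => ((Set.range fun i => p i ω) ∩ W).encard := by
  classical
  have key : ∀ n : ℕ, MeasurableSet {ω | (n : ℕ∞) ≤ ((Set.range fun i => p i ω) ∩ W).encard} := by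
    intro n
    -- The range forgets multiplicities, so n points in W means n indices with pairwise distinct
    -- points in W; there are only countably many finite sets of indices.
    have : {ω | (n : ℕ∞) ≤ ((Set.range fun i => p i ω) ∩ W).encard} =
        ⋃ s : {s : Finset ι // s.card = n}, ⋂ i ∈ s.1,
          (p i ⁻¹' W ∩ ⋂ j ∈ s.1.erase i, {ω | p i ω ≠ p j ω}) := by
      ext ω
      simp only [Set.mem_ofPred_eq, Set.mem_iUnion, Set.mem_iInter, Set.mem_inter_iff,
        Set.mem_preimage, Subtype.exists, Finset.mem_erase]
      constructor
      · intro h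
        obtain ⟨t, ht, htn⟩ := Set.exists_subset_encard_eq h
        obtain ⟨u, rfl, hinj⟩ := Set.exists_image_eq_injOn_of_subset_range fun x hx => (ht hx).1
        rw [hinj.encard_image] at htn
        have hfin : u.Finite := Set.finite_of_encard_eq_coe htn
        refine ⟨hfin.toFinset, ?_, ?_⟩
        · rw [hfin.encard_eq_coe_toFinset_card] at htn
          exact_mod_cast htn
        · intro i hi
          simp only [Set.Finite.mem_toFinset] at hi ⊢
          exact ⟨(ht ⟨i, hi, rfl⟩).2, fun j hj heq => hj.1 (hinj hj.2 hi heq.symm)⟩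
      · rintro ⟨s, hs, h⟩
        have hinj : Set.InjOn (fun i => p i ω) s := by
          intro i hi j hj hij
          by_contra hne
          exact (h i hi).2 j ⟨fun h => hne h.symm, hj⟩ hij
        calc (n : ℕ∞) = ((fun i => p i ω) '' (s : Set ι)).encard := by
              rw [hinj.encard_image, Set.encard_coe_eq_coe_finsetCard, hs]
          _ ≤ _ := by
              refine Set.encard_le_encard ?_
              rintro _ ⟨i, hi, rfl⟩
              exact ⟨⟨i, rfl⟩, (h i hi).1⟩
    rw [this]
    refine MeasurableSet.iUnion fun s => Finset.measurableSet_biInter _ fun i _ =>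
      (hp i hW).inter (Finset.measurableSet_biInter _ fun j _ => ?_)
    exact (measurableSet_eq_fun (hp i) (hp j)).compl
  have top : MeasurableSet {ω | ((Set.range fun i => p i ω) ∩ W).encard = ⊤} := by
    have : {ω | ((Set.range fun i => p i ω) ∩ W).encard = ⊤} =
        ⋂ n : ℕ, {ω | (n : ℕ∞) ≤ ((Set.range fun i => p i ω) ∩ W).encard} := by
      ext ω
      simp only [Set.mem_ofPred_eq, Set.mem_iInter]
      exact ENat.eq_top_iff_forall_ge
    rw [this]
    exact MeasurableSet.iInter key
  refine @measurable_to_countable' ℕ∞ Ω ⊤ _ _ _ fun x => ?_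
  induction x using ENat.recTopCoe with
  | top => exact top
  | coe n =>
    have : (fun ω => ((Set.range fun i => p i ω) ∩ W).encard) ⁻¹' {(n : ℕ∞)} =
        {ω | (n : ℕ∞) ≤ ((Set.range fun i => p i ω) ∩ W).encard} \
          {ω | ((n + 1 : ℕ) : ℕ∞) ≤ ((Set.range fun i => p i ω) ∩ W).encard} := by
      ext ω
      simp only [Set.mem_preimage, Set.mem_singleton_iff, Set.mem_sdiff, Set.mem_ofPred_eq, not_le]
      constructor
      · intro h
        rw [h]
        exact ⟨le_rfl, by exact_mod_cast Nat.lt_succ_self n⟩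
      · rintro ⟨h1, h2⟩
        refine le_antisymm ?_ h1
        push_cast at h2
        exact Order.le_of_lt_add_one h2
    rw [this]
    exact (key n).diff (key (n + 1))

section

variable {d : ℕ} {b : Module.Basis (Fin d) ℝ (E d)}

theorem measurable_points (Λ : Finset (Lat b)) :
    Measurable[_, finiteConfigSigma d] (points Λ : Field b → Finset (E d)) := by
  refine Measurable.of_comap_le ?_
  simp only [finiteConfigSigma, MeasurableSpace.comap_iSup, MeasurableSpace.comap_comp]
  refine iSup₂_le fun W hW => ?_
  refine Measurable.comap_le ?_
  have := measurable_encard_range_inter (Ω := Field b) (ι := Λ)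
    (p := fun i x => ((i : Lat b) : E d) + x i) (fun i => by fun_prop) hW
  convert! this using 2 with x
  simp only [Function.comp, points, Finset.coe_image]
  congr 2
  ext y
  simp

theorem IsHamiltonian.measurable_comp_points {H : Finset (E d) → EReal} (hH : IsHamiltonian H)
    (Λ : Finset (Lat b)) : Measurable fun x : Field b => H (points Λ x) :=
  @Measurable.comp _ _ _ _ (finiteConfigSigma d) _ _ _ hH.measurable (measurable_points Λ)

theorem measurable_countableSubset {S : Type*} [MeasurableSpace S] {Γ : S → CountableSubset d}
    (h : ∀ W, MeasurableSet W → Measurable[_, ⊤] fun s => ((Γ s).carrier ∩ W).encard) :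
    Measurable Γ := by
  refine Measurable.of_comap_le ?_
  simp only [instMeasurableSpaceCountableSubset, MeasurableSpace.comap_iSup,
    MeasurableSpace.comap_comp]
  exact iSup₂_le fun W hW => Measurable.comap_le (h W hW)

theorem measurable_encard_carrier {W : Set (E d)} (hW : MeasurableSet W) :
    Measurable[_, ⊤] fun γ : CountableSubset d => (γ.carrier ∩ W).encard :=
  Measurable.of_comap_le (le_iSup₂_of_le W hW le_rfl)

instance : Countable (Lat b) := by
  have e := (b.restrictScalars ℤ).equivFun.toEquiv
  exact e.countable_iff.2 inferInstance

theorem measurable_perturbedLattice :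
    Measurable fun p : Field b × E d => perturbedLattice p.1 p.2 := by
  refine measurable_countableSubset fun W hW => ?_
  exact measurable_encard_range_inter
    (p := fun (i : Lat b) (q : Field b × E d) => (i : E d) + q.1 i + q.2)
    (fun i => by fun_prop) hW

theorem measurable_translate (v : E d) :
    Measurable fun γ : CountableSubset d => γ.translate v := by
  refine measurable_countableSubset fun W hW => ?_
  have h := measurable_encard_carrier (d := d) (W := (fun x => x + v) ⁻¹' W)
    ((measurable_add_const v) hW)
  convert! h using 2 with γ
  simp only [CountableSubset.translate]
  rw [← Set.image_inter_preimage, (add_left_injective v).encard_image]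

end

/-! ### Stationarity of perturbed lattices -/

section

variable {d : ℕ} {b : Module.Basis (Fin d) ℝ (E d)}

theorem measurable_shift (k : Lat b) : Measurable (shift k) :=
  measurable_pi_lambda _ fun i => measurable_pi_apply (i + k)

theorem CountableSubset.eq_of_carrier_eq {γ γ' : CountableSubset d} (h : γ.carrier = γ'.carrier) :
    γ = γ' := by
  cases γ; cases γ'; simpa using h

theorem perturbedLattice_translate (x : Field b) (u v : E d) :
    (perturbedLattice x u).translate v = perturbedLattice x (u + v) := by
  refine CountableSubset.eq_of_carrier_eq ?_
  simp only [CountableSubset.translate, perturbedLattice, ← Set.range_comp]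
  congr 1
  ext1 i
  simp [add_assoc]

/-- The relabelling i ↦ i + k of the points trades a lattice translation of the configuration for a
shift of the field. -/
theorem perturbedLattice_add_lat (x : Field b) (u : E d) (k : Lat b) :
    perturbedLattice x (u + k) = perturbedLattice (shift (-k) x) u := by
  refine CountableSubset.eq_of_carrier_eq ?_
  simp only [perturbedLattice]
  rw [← (Equiv.addRight k).surjective.range_comp fun i : Lat b => (i : E d) + shift (-k) x i + u]
  congr 1
  ext1 i
  simp only [shift, Function.comp, Equiv.coe_addRight, Submodule.coe_add, add_neg_cancel_right]
  abel

/-- The perturbed lattice visits every bounded set only finitely often, with multiplicity. -/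
def IsSparse (x : Field b) : Prop :=
  ∀ r : ℝ, {i : Lat b | ‖(i : E d) + x i‖ ≤ r}.Finite

theorem IsSparse.isLocallyFinite {x : Field b} (hx : IsSparse x) (u : E d) :
    IsLocallyFinite (perturbedLattice x u).carrier := by
  intro W hW
  obtain ⟨r, hr⟩ := hW.exists_norm_le
  refine ((hx (r + ‖u‖)).image fun i : Lat b => (i : E d) + x i + u).subset ?_
  rintro _ ⟨⟨i, rfl⟩, hi⟩
  refine ⟨i, ?_, rfl⟩
  have := hr _ hi
  calc ‖(i : E d) + x i‖ = ‖((i : E d) + x i + u) - u‖ := by simp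
    _ ≤ _ := (norm_sub_le _ _).trans (by simpa using this)

theorem finite_lat_norm_le (r : ℝ) : {i : Lat b | ‖(i : E d)‖ ≤ r}.Finite := by
  refine Set.Finite.of_finite_image ((ZSpan.setFinite_inter b
    (Metric.isBounded_closedBall (x := (0 : E d)) (r := r))).subset ?_)
    Subtype.val_injective.injOn
  rintro _ ⟨i, hi, rfl⟩
  exact ⟨by simpa using hi, i.2⟩

/-- The number of lattice points of norm at most `r`. -/
def latCount (b : Module.Basis (Fin d) ℝ (E d)) (r : ℝ) : ℕ :=
  (finite_lat_norm_le (b := b) r).toFinset.card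

/-- Subtracting one element of the set sends the others to lattice points of norm at most 2r. What
matters is that the bound does not depend on v. -/
theorem encard_translate_norm_le (v : E d) (r : ℝ) :
    {i : Lat b | ‖(i : E d) + v‖ ≤ r}.encard ≤ latCount b (r + r) := by
  rcases Set.eq_empty_or_nonempty {i : Lat b | ‖(i : E d) + v‖ ≤ r} with h | ⟨j, hj⟩
  · simp [h]
  · rw [latCount, ← (finite_lat_norm_le (b := b) (r + r)).encard_eq_coe_toFinset_card,
      ← (sub_left_injective (b := j)).encard_image]
    refine Set.encard_le_encard ?_
    rintro _ ⟨i, hi, rfl⟩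
    have : ((i - j : Lat b) : E d) = ((i : E d) + v) - ((j : E d) + v) := by
      simp
    simp only [Set.mem_ofPred_eq, this] at *
    exact (norm_sub_le _ _).trans (add_le_add hi hj)

theorem tsum_indicator_le_latCount (v : E d) (r : ℝ) :
    ∑' i : Lat b, (Metric.closedBall (0 : E d) r).indicator (fun _ => (1 : ℝ≥0∞)) (i + v) ≤
      latCount b (r + r) := by
  have h : ∀ i : Lat b, (Metric.closedBall (0 : E d) r).indicator (fun _ => (1 : ℝ≥0∞)) (i + v) =
      {i : Lat b | ‖(i : E d) + v‖ ≤ r}.indicator (fun _ => (1 : ℝ≥0∞)) i := by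
    intro i
    by_cases hi : ‖(i : E d) + v‖ ≤ r <;> simp [Set.indicator, hi]
  simp_rw [h]
  rw [← tsum_subtype, ENNReal.tsum_const, mul_one]
  exact_mod_cast encard_translate_norm_le v r

/-- Borel–Cantelli. By invariance, the sum over i of the probabilities that i + x_i lies in a ball
equals the mean number of i with i + x_0 in that ball, which is at most a lattice count. -/
theorem ae_isSparse {P : Measure (Field b)} [IsProbabilityMeasure P]
    (hP : ∀ k : Lat b, P.map (shift k) = P) : ∀ᵐ x ∂P, IsSparse x := by
  have key : ∀ n : ℕ, ∀ᵐ x ∂P, {i : Lat b | ‖(i : E d) + x i‖ ≤ n}.Finite := by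
    intro n
    refine ae_finite_setOfPred_mem (s := fun i : Lat b => {x : Field b | ‖(i : E d) + x i‖ ≤ n}) ?_
    have hmeas : ∀ i : Lat b, Measurable fun x : Field b =>
        (Metric.closedBall (0 : E d) n).indicator (fun _ => (1 : ℝ≥0∞)) ((i : E d) + x 0) :=
      fun i => (measurable_const.indicator Metric.isClosed_closedBall.measurableSet).comp
        (by fun_prop)
    have h1 : ∀ i : Lat b, P {x : Field b | ‖(i : E d) + x i‖ ≤ n} =
        ∫⁻ x, (Metric.closedBall (0 : E d) n).indicator (fun _ => (1 : ℝ≥0∞))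
          ((i : E d) + x 0) ∂P := by
      intro i
      have hm : MeasurableSet {x : Field b | ‖(i : E d) + x 0‖ ≤ n} :=
        measurableSet_le (by fun_prop) measurable_const
      have : {x : Field b | ‖(i : E d) + x i‖ ≤ n} =
          shift i ⁻¹' {x : Field b | ‖(i : E d) + x 0‖ ≤ n} := by
        ext x; simp [shift]
      rw [this, ← Measure.map_apply (measurable_shift i) hm, hP, ← lintegral_indicator_one hm]
      refine lintegral_congr fun x => ?_
      by_cases hi : ‖(i : E d) + x 0‖ ≤ n <;> simp [Set.indicator, hi]
    simp_rw [h1]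
    have h2 := lintegral_tsum (μ := P) (f := fun (i : Lat b) (x : Field b) =>
      (Metric.closedBall (0 : E d) n).indicator (fun _ => (1 : ℝ≥0∞)) ((i : E d) + x 0))
      fun i => (hmeas i).aemeasurable
    have h3 : ∫⁻ x : Field b, ∑' i : Lat b, (Metric.closedBall (0 : E d) n).indicator
        (fun _ => (1 : ℝ≥0∞)) ((i : E d) + x 0) ∂P ≤ ∫⁻ _, latCount b (n + n) ∂P :=
      lintegral_mono fun x => tsum_indicator_le_latCount (x 0) n
    rw [← h2]
    refine ne_of_lt (h3.trans_lt ?_)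
    simp
  filter_upwards [ae_all_iff.2 key] with x hx r
  obtain ⟨n, hn⟩ := exists_nat_ge r
  exact (hx n).subset fun i hi => le_trans hi hn

instance isProbabilityMeasure_uniformD : IsProbabilityMeasure (uniformD b) :=
  cond_isProbabilityMeasure_of_finite (ZSpan.measure_fundamentalDomain_ne_zero b)
    (ZSpan.fundamentalDomain_isBounded b).measure_lt_top.ne

theorem measurable_floor : Measurable fun u : E d => ZSpan.floor b u := by
  refine measurable_to_countable' fun l => ?_
  have : (fun u : E d => ZSpan.floor b u) ⁻¹' {l} =
      (fun u => u - (l : E d)) ⁻¹' ZSpan.fundamentalDomain b := by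
    ext u
    simp only [Set.mem_preimage, Set.mem_singleton_iff]
    constructor
    · rintro rfl
      exact ZSpan.fract_mem_fundamentalDomain b u
    · intro h
      rw [← ZSpan.fract_eq_self, sub_eq_add_neg, ZSpan.fract_add_ZSpan b u (neg_mem l.2),
        ZSpan.fract_apply] at h
      exact Subtype.ext (sub_right_injective (b := u) (by simpa [sub_eq_add_neg] using h))
  rw [this]
  exact (measurable_sub_const _) (ZSpan.fundamentalDomain_measurableSet b)

theorem measurable_fract : Measurable fun u : E d => ZSpan.fract b u :=
  measurable_id.sub (measurable_subtype_coe.comp measurable_floor)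

/-- The set of u whose fractional part lies in A is invariant under the lattice, and an invariant
set has the same volume in any two fundamental domains, here the standard one and its translate by
v. -/
theorem map_fract_add_uniformD (v : E d) :
    (uniformD b).map (fun u => ZSpan.fract b (u + v)) = uniformD b := by
  have hD := ZSpan.fundamentalDomain_measurableSet b
  have hm : Measurable fun u => ZSpan.fract b (u + v) :=
    measurable_fract.comp (measurable_add_const v)
  have hfd := ZSpan.isAddFundamentalDomain b (volume : Measure (E d))
  ext A hA
  rw [Measure.map_apply hm hA, uniformD, ProbabilityTheory.cond_apply hD,
    ProbabilityTheory.cond_apply hD]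
  congr 1
  set A' : Set (E d) := ZSpan.fract b ⁻¹' A
  have hA' : MeasurableSet A' := measurable_fract hA
  have h1 : ZSpan.fundamentalDomain b ∩ (fun u => ZSpan.fract b (u + v)) ⁻¹' A =
      (fun u => u + v) ⁻¹' (((fun u => u + v) '' ZSpan.fundamentalDomain b) ∩ A') := by
    ext u; simp [A']
  have h2 : ZSpan.fundamentalDomain b ∩ A = A' ∩ ZSpan.fundamentalDomain b := by
    ext u
    simp only [Set.mem_inter_iff, A', Set.mem_preimage]
    constructor
    · rintro ⟨h, h'⟩; rw [ZSpan.fract_eq_self.2 h]; exact ⟨h', h⟩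
    · rintro ⟨h, h'⟩; rw [ZSpan.fract_eq_self.2 h'] at h; exact ⟨h', h⟩
  have hfd' : IsAddFundamentalDomain (Lat b) ((fun u => u + v) '' ZSpan.fundamentalDomain b)
      (volume : Measure (E d)) := by
    have := hfd.vadd_of_comm v
    have he : (fun u => u + v) '' ZSpan.fundamentalDomain b = v +ᵥ ZSpan.fundamentalDomain b := by
      refine Set.image_congr fun u _ => ?_
      rw [vadd_eq_add, add_comm]
    rw [he]
    exact this
  rw [h1, measure_preimage_add_right, h2, Set.inter_comm]
  have : VAddInvariantMeasure (Lat b) (E d) volume :=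
    ⟨fun c s _ => measure_preimage_add volume (c : E d) s⟩
  refine hfd'.measure_set_eq hfd hA' fun g => ?_
  ext u
  simp only [A', Set.mem_preimage]
  rw [Submodule.vadd_def, vadd_eq_add, ZSpan.fract_zSpan_add b u g.2]

/-- Moving the origin of the lattice by `v` and folding it back into the fundamental domain. -/
def refold (v : E d) (p : Field b × E d) : Field b × E d :=
  (shift (-ZSpan.floor b (p.2 + v)) p.1, ZSpan.fract b (p.2 + v))

theorem perturbedLattice_refold (v : E d) (p : Field b × E d) :
    perturbedLattice (refold v p).1 (refold v p).2 = (perturbedLattice p.1 p.2).translate v := by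
  rw [perturbedLattice_translate, refold, ← perturbedLattice_add_lat, ZSpan.fract_apply,
    sub_add_cancel]

theorem measurable_refold_fst (v : E d) :
    Measurable fun p : Field b × E d => shift (-ZSpan.floor b (p.2 + v)) p.1 := by
  have : Measurable fun q : Lat b × Field b => shift (-q.1) q.2 :=
    measurable_from_prod_countable_right fun l => measurable_shift (-l)
  exact this.comp ((measurable_floor.comp (by fun_prop)).prodMk measurable_fst)

/-- A skew product: the folded shift is again uniform, and for each fixed u the field undergoes a
lattice shift, which preserves P. -/
theorem map_refold {P : Measure (Field b)} [IsProbabilityMeasure P]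
    (hP : ∀ k : Lat b, P.map (shift k) = P) (v : E d) :
    (P.prod (uniformD b)).map (refold v) = P.prod (uniformD b) := by
  have h1 : MeasurePreserving (fun u => ZSpan.fract b (u + v)) (uniformD b) (uniformD b) :=
    ⟨measurable_fract.comp (measurable_add_const v), map_fract_add_uniformD v⟩
  have hg : Measurable (Function.uncurry
      fun (u : E d) (x : Field b) => shift (-ZSpan.floor b (u + v)) x) := by
    have h := (measurable_refold_fst (b := b) v).comp (measurable_swap (α := E d) (β := Field b))
    simp only [Function.comp_def, Prod.fst_swap, Prod.snd_swap] at h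
    simp only [Function.uncurry_def]
    exact h
  have h2 := h1.skew_product (μc := P) (μd := P) hg (Eventually.of_forall fun u => hP _)
  have h3 := (Measure.measurePreserving_swap (μ := uniformD b) (ν := P)).comp
    (h2.comp (Measure.measurePreserving_swap (μ := P) (ν := uniformD b)))
  exact h3.map_eq

end

/-! ### Stationarity and the conditional law given the shift -/

section

variable {d : ℕ} {b : Module.Basis (Fin d) ℝ (E d)} {S : Type*} [MeasurableSpace S] {μ : Measure S}
  {X : S → Field b} {U : S → E d} {P : Measure (Field b)}

theorem isStationaryPointProcess_perturbedLattice [IsProbabilityMeasure P]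
    (hP : ∀ k : Lat b, P.map (shift k) = P) (hX : Measurable X) (hU : Measurable U)
    (hXU : μ.map (fun s => (X s, U s)) = P.prod (uniformD b)) :
    IsStationaryPointProcess μ (fun s => perturbedLattice (X s) (U s)) where
  measurable := measurable_perturbedLattice.comp (hX.prodMk hU)
  locallyFinite := by
    have h := (Measure.quasiMeasurePreserving_fst (μ := P) (ν := uniformD b)).ae (ae_isSparse hP)
    rw [← hXU] at h
    filter_upwards [ae_of_ae_map (hX.prodMk hU).aemeasurable h] with s hs
    exact IsSparse.isLocallyFinite hs _
  stationary v := by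
    have hm : Measurable (refold (b := b) v) :=
      (measurable_refold_fst v).prodMk (measurable_fract.comp (by fun_prop))
    have hΓ := measurable_perturbedLattice (b := b)
    have h1 : (fun s => (perturbedLattice (X s) (U s)).translate v) =
        (fun p : Field b × E d => perturbedLattice p.1 p.2) ∘ refold v ∘ fun s => (X s, U s) := by
      ext1 s
      simp [perturbedLattice_refold]
    have h2 : (fun s => perturbedLattice (X s) (U s)) =
        (fun p : Field b × E d => perturbedLattice p.1 p.2) ∘ fun s => (X s, U s) := rfl
    rw [h1, h2, ← Measure.map_map hΓ (hm.comp (hX.prodMk hU)), ← Measure.map_map hm (hX.prodMk hU),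
      hXU, map_refold hP, ← Measure.map_map hΓ (hX.prodMk hU), hXU]

theorem measurable_perturbedLattice_left (u : E d) :
    Measurable fun x : Field b => perturbedLattice x u :=
  measurable_perturbedLattice.comp (measurable_id.prodMk measurable_const)

theorem lawGiven_eq_map (hX : Measurable X) (u : E d) :
    lawGiven μ X u = (μ.map X).map fun x => perturbedLattice x u := by
  rw [lawGiven, Measure.map_map (measurable_perturbedLattice_left u) hX]
  rfl

theorem isCondLaw_lawGiven [IsProbabilityMeasure P] (hX : Measurable X) (hU : Measurable U)
    (hmX : μ.map X = P) (hXU : μ.map (fun s => (X s, U s)) = P.prod (uniformD b)) :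
    IsCondLaw μ (fun s => perturbedLattice (X s) (U s)) U (lawGiven μ X) := by
  have hΓ := measurable_perturbedLattice (b := b)
  have hu : ∀ u : E d, Measurable fun x : Field b => perturbedLattice x u :=
    measurable_perturbedLattice_left
  have happ : ∀ B, MeasurableSet B → ∀ u, lawGiven μ X u B =
      P ((fun x => (x, u)) ⁻¹' ((fun p : Field b × E d => perturbedLattice p.1 p.2) ⁻¹' B)) := by
    intro B hB u
    rw [lawGiven_eq_map hX, hmX, Measure.map_apply (hu u) hB]
    rfl
  refine ⟨fun u => ?_, fun B hB => ?_, fun A B hA hB => ?_⟩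
  · rw [lawGiven_eq_map hX, hmX]
    exact Measure.isProbabilityMeasure_map (hu u).aemeasurable
  · simp_rw [happ B hB]
    exact measurable_measure_prodMk_right (hΓ hB)
  · have hmU : μ.map U = uniformD b := by
      have : U = Prod.snd ∘ fun s => (X s, U s) := rfl
      rw [this, ← Measure.map_map measurable_snd (hX.prodMk hU), hXU, Measure.map_snd_prod]
      simp
    have h1 : {s | U s ∈ A ∧ perturbedLattice (X s) (U s) ∈ B} = (fun s => (X s, U s)) ⁻¹'
        ((Prod.snd ⁻¹' A) ∩ ((fun p : Field b × E d => perturbedLattice p.1 p.2) ⁻¹' B)) := rfl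
    have hm := (measurable_snd hA).inter (hΓ hB)
    rw [h1, ← Measure.map_apply (hX.prodMk hU) hm, hXU, Measure.prod_apply_symm hm, hmU,
      ← lintegral_indicator hA]
    refine lintegral_congr fun u => ?_
    by_cases hu : u ∈ A
    · rw [Set.indicator_of_mem hu, happ B hB]
      congr 1
      ext x
      simp [hu]
    · rw [Set.indicator_of_notMem hu]
      convert measure_empty (μ := P)
      ext x
      simp [hu]

theorem lawGiven_map_translate (hX : Measurable X) (hmX : μ.map X = P)
    (hP : ∀ k : Lat b, P.map (shift k) = P) (u : E d) {k : E d} (hk : k ∈ Lat b) :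
    (lawGiven μ X u).map (fun γ => γ.translate k) = lawGiven μ X u := by
  have hu := measurable_perturbedLattice_left (b := b) u
  rw [lawGiven_eq_map hX, hmX, Measure.map_map (measurable_translate k) hu]
  have : (fun γ : CountableSubset d => γ.translate k) ∘ (fun x : Field b => perturbedLattice x u) =
      (fun x : Field b => perturbedLattice x u) ∘ shift (-⟨k, hk⟩) := by
    ext1 x
    simp only [Function.comp, perturbedLattice_translate]
    exact perturbedLattice_add_lat x u ⟨k, hk⟩
  rw [this, ← Measure.map_map hu (measurable_shift _), hP]

end

/-! ### Finite-volume Gibbs measures -/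

section

variable {d : ℕ} {b : Module.Basis (Fin d) ℝ (E d)}

/-- The law of independent displacements. -/
abbrev freeField (b : Module.Basis (Fin d) ℝ (E d)) (Q : Measure (E d)) : Measure (Field b) :=
  Measure.infinitePi fun _ : Lat b => Q

/-- The Boltzmann factor of the points indexed by `Λ`. -/
def boltzmann (H : Finset (E d) → EReal) (Λ : Finset (Lat b)) (x : Field b) : ℝ≥0∞ :=
  EReal.exp (-H (points Λ x))

/-- The partition function with free boundary condition. -/
def freePartition (H : Finset (E d) → EReal) (Q : Measure (E d)) (Λ : Finset (Lat b)) : ℝ≥0∞ :=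
  ∫⁻ x, boltzmann H Λ x ∂freeField b Q

/-- The Gibbs measure in `Λ` with free boundary condition; displacements off `Λ` are free. -/
def freeGibbs (H : Finset (E d) → EReal) (Q : Measure (E d)) (Λ : Finset (Lat b)) :
    Measure (Field b) :=
  (freePartition H Q Λ)⁻¹ • (freeField b Q).withDensity (boltzmann H Λ)

/-- The translate `Λ - k`. -/
def translateBox (k : Lat b) (Λ : Finset (Lat b)) : Finset (Lat b) :=
  Λ.map (Equiv.subRight k).toEmbedding

theorem mem_translateBox {k i : Lat b} {Λ : Finset (Lat b)} :
    i ∈ translateBox k Λ ↔ i + k ∈ Λ := by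
  simp only [translateBox, Finset.mem_map_equiv]
  rfl

theorem points_mono {Λ Λ' : Finset (Lat b)} (h : Λ ⊆ Λ') (x : Field b) :
    points Λ x ⊆ points Λ' x := Finset.image_subset_image h

open scoped Classical in
theorem points_translateBox (k : Lat b) (Λ : Finset (Lat b)) (x : Field b) :
    points Λ x = (points (translateBox k Λ) (shift k x)).image (fun y => y + (k : E d)) := by
  ext y
  simp only [points, Finset.mem_image, mem_translateBox, shift, exists_exists_and_eq_and]
  constructor
  · rintro ⟨i, hi, rfl⟩
    refine ⟨i - k, by simpa using hi, ?_⟩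
    simp only [sub_add_cancel, Submodule.coe_sub]
    abel
  · rintro ⟨i, hi, rfl⟩
    refine ⟨i + k, hi, ?_⟩
    simp only [Submodule.coe_add]
    abel

theorem boltzmann_translateBox {H : Finset (E d) → EReal} (h4 : TranslationInvariant H)
    (k : Lat b) (Λ : Finset (Lat b)) (x : Field b) :
    boltzmann H (translateBox k Λ) (shift k x) = boltzmann H Λ x := by
  rw [boltzmann, boltzmann, points_translateBox k Λ x, h4]

theorem measurable_ereal_exp : Measurable EReal.exp := EReal.exp_monotone.measurable

theorem measurable_boltzmann {H : Finset (E d) → EReal} (hH : IsHamiltonian H)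
    (Λ : Finset (Lat b)) : Measurable (boltzmann H Λ : Field b → ℝ≥0∞) :=
  measurable_ereal_exp.comp (hH.measurable_comp_points Λ).neg

theorem freeField_map_shift (Q : Measure (E d)) [IsProbabilityMeasure Q] (k : Lat b) :
    (freeField b Q).map (shift k) = freeField b Q :=
  Measure.map_infinitePi_infinitePi_of_inj (f := fun i : Lat b => i + k) (add_left_injective k)

theorem measurableEmbedding_shift (k : Lat b) : MeasurableEmbedding (shift k) := by
  let e : Field b ≃ᵐ Field b :=
    { toFun := shift k
      invFun := shift (-k)
      left_inv := fun x => by ext1 i; simp [shift]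
      right_inv := fun x => by ext1 i; simp [shift]
      measurable_toFun := measurable_shift k
      measurable_invFun := measurable_shift (-k) }
  exact e.measurableEmbedding

variable {H : Finset (E d) → EReal} {Q : Measure (E d)}

theorem freePartition_translateBox [IsProbabilityMeasure Q] (h4 : TranslationInvariant H)
    (k : Lat b)
    (Λ : Finset (Lat b)) : freePartition H Q (translateBox k Λ) = freePartition H Q Λ := by
  rw [freePartition, freePartition, ← freeField_map_shift Q k,
    (measurableEmbedding_shift k).lintegral_map]
  simp_rw [boltzmann_translateBox h4]
  rw [freeField_map_shift]

theorem freeGibbs_map_shift [IsProbabilityMeasure Q] (hH : IsHamiltonian H)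
    (h4 : TranslationInvariant H) (k : Lat b)
    (Λ : Finset (Lat b)) :
    (freeGibbs H Q Λ).map (shift k) = freeGibbs H Q (translateBox k Λ) := by
  rw [freeGibbs, freeGibbs, Measure.map_smul, freePartition_translateBox h4]
  congr 1
  ext A hA
  rw [Measure.map_apply (measurable_shift k) hA, withDensity_apply _ (measurable_shift k hA),
    withDensity_apply _ hA]
  conv_rhs => rw [← freeField_map_shift Q k]
  rw [setLIntegral_map hA (measurable_boltzmann hH _) (measurable_shift k)]
  simp_rw [boltzmann_translateBox h4]

/-- Stability involves the number of distinct points, which coincidences can only make smaller than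
the number of indices; A ≥ 0 turns this into a bound in terms of `Λ.card`. -/
theorem boltzmann_le {A : ℝ} (hA : 0 ≤ A)
    (h1 : ∀ γ : Finset (E d), ((-(A * γ.card) : ℝ) : EReal) ≤ H γ)
    (Λ : Finset (Lat b)) (x : Field b) :
    boltzmann H Λ x ≤ ENNReal.ofReal (Real.exp (A * Λ.card)) := by
  rw [← EReal.exp_coe, boltzmann, EReal.exp_le_exp_iff, EReal.neg_le]
  refine le_trans ?_ (h1 _)
  rw [← EReal.coe_neg, EReal.coe_le_coe_iff]
  have : (points Λ x).card ≤ Λ.card := Finset.card_image_le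
  have : ((points Λ x).card : ℝ) ≤ Λ.card := by exact_mod_cast this
  nlinarith

/-- The origin need not belong to the support of Q. All displacements are restricted to the ε-ball
about a point v of the support, which has positive mass p; translating by -v brings the
configuration within reach of non-degeneracy. -/
theorem exists_le_freePartition [IsProbabilityMeasure Q] (h2 : NonDegenerate b H)
    (h4 : TranslationInvariant H) :
    ∃ c : ℝ, 0 ≤ c ∧ ∀ Λ : Finset (Lat b),
      ENNReal.ofReal (Real.exp (-(c * Λ.card))) ≤ freePartition H Q Λ := by
  classical
  obtain ⟨ε, hε, B, hB, h2⟩ := h2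
  obtain ⟨v, hv⟩ : Q.support.Nonempty := by
    rw [Measure.nonempty_support_iff]
    exact IsProbabilityMeasure.ne_zero Q
  have hp : 0 < Q (Metric.closedBall v ε) :=
    (Measure.mem_support_iff_forall v).1 hv _ (Metric.closedBall_mem_nhds v hε)
  set p : ℝ := (Q (Metric.closedBall v ε)).toReal
  have hp0 : 0 < p := ENNReal.toReal_pos hp.ne' (measure_ne_top _ _)
  have hp1 : p ≤ 1 := by
    simpa [p] using ENNReal.toReal_mono ENNReal.one_ne_top (prob_le_one (μ := Q))
  -- Each site contributes energy at most B and probability p = exp(log p).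
  refine ⟨B - Real.log p, by linarith [Real.log_nonpos hp0.le hp1], fun Λ => ?_⟩
  set T : Set (Field b) := Set.pi Λ fun _ => Metric.closedBall v ε
  have hT : freeField b Q T = Q (Metric.closedBall v ε) ^ Λ.card := by
    rw [Measure.infinitePi_pi _ fun _ _ => Metric.isClosed_closedBall.measurableSet]
    simp
  have hle : ∀ x ∈ T, ENNReal.ofReal (Real.exp (-(B * Λ.card))) ≤ boltzmann H Λ x := by
    intro x hx
    rw [← EReal.exp_coe, boltzmann, EReal.exp_le_exp_iff, EReal.coe_neg, EReal.neg_le_neg_iff]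
    -- Non-degeneracy asks for small displacements at every site of the lattice, so the field is set
    -- to 0 off Λ, where it has no influence.
    have hpt : points Λ x =
        (points Λ fun i => if i ∈ Λ then x i - v else 0).image (fun y => y + v) := by
      ext y
      simp only [points, Finset.mem_image, exists_exists_and_eq_and]
      refine exists_congr fun i => and_congr_right fun hi => ?_
      rw [if_pos hi, add_assoc, sub_add_cancel]
    rw [hpt, h4]
    refine h2 _ (fun i => ?_) Λ
    split_ifs with hi
    · simpa [dist_eq_norm] using hx i hi
    · simpa using hε.le
  calc ENNReal.ofReal (Real.exp (-((B - Real.log p) * Λ.card)))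
      = ENNReal.ofReal (Real.exp (-(B * Λ.card))) * Q (Metric.closedBall v ε) ^ Λ.card := by
        rw [← ENNReal.ofReal_toReal (measure_ne_top Q (Metric.closedBall v ε)),
          ← ENNReal.ofReal_pow hp0.le, ← ENNReal.ofReal_mul (Real.exp_nonneg _)]
        congr 1
        rw [← Real.exp_log hp0, ← Real.exp_nat_mul, ← Real.exp_add, Real.log_exp]
        congr 1
        ring
    _ = ∫⁻ x in T, ENNReal.ofReal (Real.exp (-(B * Λ.card))) ∂freeField b Q := by
        rw [setLIntegral_const, hT]
    _ ≤ ∫⁻ x in T, boltzmann H Λ x ∂freeField b Q :=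
        setLIntegral_mono' (MeasurableSet.pi (Finset.countable_toSet _)
          fun _ _ => Metric.isClosed_closedBall.measurableSet) hle
    _ ≤ _ := setLIntegral_le_lintegral _ _

/-- The normalised finite-volume densities grow at most exponentially in the volume. -/
theorem exists_freeGibbs_le [IsProbabilityMeasure Q] (h1 : Stable H) (h2 : NonDegenerate b H)
    (h4 : TranslationInvariant H) :
    ∃ K : ℝ, 0 ≤ K ∧ ∀ Λ : Finset (Lat b), freePartition H Q Λ ≠ 0 ∧ freePartition H Q Λ ≠ ∞ ∧
      freeGibbs H Q Λ ≤ ENNReal.ofReal (Real.exp (K * Λ.card)) • freeField b Q := by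
  obtain ⟨A, hA, h1⟩ := h1
  obtain ⟨c, hc, h⟩ := exists_le_freePartition (Q := Q) h2 h4
  refine ⟨A + c, by positivity, fun Λ => ⟨?_, ?_, ?_⟩⟩
  · exact (lt_of_lt_of_le (by simp [Real.exp_pos]) (h Λ)).ne'
  · refine ne_of_lt ((lintegral_mono fun x => boltzmann_le hA h1 Λ x).trans_lt ?_)
    simp
  · have hd : (freeField b Q).withDensity (boltzmann H Λ) ≤
        ENNReal.ofReal (Real.exp (A * Λ.card)) • freeField b Q := by
      rw [← withDensity_const]
      exact withDensity_mono (Eventually.of_forall fun x => boltzmann_le hA h1 Λ x)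
    have hZ : (freePartition H Q Λ)⁻¹ ≤ ENNReal.ofReal (Real.exp (c * Λ.card)) := by
      rw [ENNReal.inv_le_iff_inv_le, ← ENNReal.ofReal_inv_of_pos (Real.exp_pos _), ← Real.exp_neg]
      exact h Λ
    intro s
    simp only [freeGibbs, Measure.smul_apply, smul_eq_mul]
    calc _ ≤ ENNReal.ofReal (Real.exp (c * Λ.card)) *
          (ENNReal.ofReal (Real.exp (A * Λ.card)) * freeField b Q s) :=
          mul_le_mul' hZ (by simpa using hd s)
      _ = _ := by
          rw [← mul_assoc, ← ENNReal.ofReal_mul (Real.exp_nonneg _), ← Real.exp_add]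
          congr 3
          ring

theorem isProbabilityMeasure_freeGibbs {Λ : Finset (Lat b)} (h0 : freePartition H Q Λ ≠ 0)
    (htop : freePartition H Q Λ ≠ ∞) : IsProbabilityMeasure (freeGibbs H Q Λ) := by
  constructor
  rw [freeGibbs, Measure.smul_apply, withDensity_apply _ MeasurableSet.univ, setLIntegral_univ]
  exact ENNReal.inv_mul_cancel h0 htop

/-! ### Uniform absolute continuity of the averaged finite-volume measures -/

/-- Sum of probabilities of independent events under a measure with bounded density. -/
theorem sum_measureReal_le_of_le_smul {Ω ι : Type*} [MeasurableSpace Ω] [Fintype ι]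
    {μ ν : Measure Ω} [IsProbabilityMeasure μ] [IsProbabilityMeasure ν] {c q t : ℝ}
    (ht : 0 < t) (hν : ν ≤ ENNReal.ofReal (Real.exp c) • μ) {A : ι → Set Ω}
    (hA : ∀ i, MeasurableSet (A i))
    (hind : iIndepFun (fun i => (A i).indicator fun _ => (1 : ℝ)) μ)
    (hq : ∀ i, μ.real (A i) ≤ q) :
    ∑ i, ν.real (A i) ≤ (c + Fintype.card ι * (q * Real.exp t)) / t := by
  set X : ι → Ω → ℝ := fun i => (A i).indicator fun _ => (1 : ℝ)
  have hXm : ∀ i, Measurable (X i) := fun i => measurable_const.indicator (hA i)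
  have hX01 : ∀ i ω, 0 ≤ X i ω ∧ X i ω ≤ 1 := by
    intro i ω
    by_cases h : ω ∈ A i <;> simp [X, h]
  set S : Ω → ℝ := fun ω => t * ∑ i, X i ω
  have hSm : Measurable S := (Finset.measurable_sum _ fun i _ => hXm i).const_mul t
  have hSb : ∀ ω, 0 ≤ S ω ∧ S ω ≤ t * Fintype.card ι := by
    intro ω
    refine ⟨mul_nonneg ht.le (Finset.sum_nonneg fun i _ => (hX01 i ω).1),
      mul_le_mul_of_nonneg_left ?_ ht.le⟩
    calc ∑ i, X i ω ≤ ∑ _i : ι, (1 : ℝ) := Finset.sum_le_sum fun i _ => (hX01 i ω).2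
      _ = _ := by simp
  have hint : ∀ (ρ : Measure Ω) [IsFiniteMeasure ρ], Integrable (fun ω => Real.exp (S ω)) ρ := by
    intro ρ _
    refine Integrable.of_bound hSm.exp.aestronglyMeasurable (Real.exp (t * Fintype.card ι))
      (Eventually.of_forall fun ω => ?_)
    rw [Real.norm_eq_abs, Real.abs_exp]
    exact Real.exp_le_exp.2 (hSb ω).2
  have hSint : Integrable S ν := by
    refine Integrable.of_bound hSm.aestronglyMeasurable (t * Fintype.card ι)
      (Eventually.of_forall fun ω => ?_)
    rw [Real.norm_eq_abs, abs_of_nonneg (hSb ω).1]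
    exact (hSb ω).2
  have hES : ∫ ω, S ω ∂ν = t * ∑ i, ν.real (A i) := by
    simp only [S]
    rw [integral_const_mul, integral_finsetSum _ fun i _ => ?_]
    · congr 1
      refine Finset.sum_congr rfl fun i _ => ?_
      simp [X, integral_indicator (hA i)]
    · exact (integrable_const (1 : ℝ)).indicator (hA i)
  -- Entropy inequality by hand: exp of the ν-mean of S is at most the ν-mean of exp S (Jensen),
  -- hence at most exp(c) times the μ-mean of exp S, which factorizes by independence. Taking
  -- logarithms and dividing by t gives the bound.
  have hjensen : Real.exp (t * ∑ i, ν.real (A i)) ≤ ∫ ω, Real.exp (S ω) ∂ν := by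
    rw [← hES]
    exact convexOn_exp.map_integral_le Real.continuous_exp.continuousOn isClosed_univ (by simp)
      hSint (hint ν)
  have hμν : ∫ ω, Real.exp (S ω) ∂ν ≤ Real.exp c * ∫ ω, Real.exp (S ω) ∂μ := by
    have h := integral_mono_measure hν (Eventually.of_forall fun ω => Real.exp_nonneg (S ω))
      ((hint μ).smul_measure ENNReal.ofReal_ne_top)
    rwa [integral_smul_measure, ENNReal.toReal_ofReal (Real.exp_nonneg _), smul_eq_mul] at h
  have hmgf : ∫ ω, Real.exp (S ω) ∂μ ≤ Real.exp (Fintype.card ι * (q * Real.exp t)) := by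
    have h := hind.mgf_sum hXm Finset.univ (t := t)
    have h' : mgf (∑ i, X i) μ t = ∫ ω, Real.exp (S ω) ∂μ := by simp [mgf, S]
    rw [← h', h]
    calc ∏ i, mgf (X i) μ t ≤ ∏ _i : ι, Real.exp (q * Real.exp t) := by
          refine Finset.prod_le_prod (fun i _ => mgf_nonneg) fun i _ => ?_
          -- On a variable with values 0 and 1 the exponential is affine, so the moment generating
          -- function is 1 + μ(A i)(exp t - 1) ≤ exp(q exp t).
          have hexp : ∀ ω, Real.exp (t * X i ω) =
              1 + (A i).indicator (fun _ => Real.exp t - 1) ω := by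
            intro ω
            by_cases h : ω ∈ A i <;> simp [X, h]
          simp only [mgf, hexp]
          rw [integral_add (integrable_const _) ((integrable_const _).indicator (hA i)),
            integral_indicator (hA i)]
          simp only [integral_const, probReal_univ, smul_eq_mul, mul_one, measureReal_restrict_apply,
            MeasurableSet.univ, Set.univ_inter]
          have h1 : μ.real (A i) * (Real.exp t - 1) ≤ q * Real.exp t := by
            have := hq i
            have h0 : 0 ≤ μ.real (A i) := measureReal_nonneg
            have h2 := Real.exp_pos t
            nlinarith
          have := Real.add_one_le_exp (q * Real.exp t)
          linarith
      _ = _ := by rw [Finset.prod_const, ← Real.exp_nat_mul, Finset.card_univ]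
  rw [le_div_iff₀ ht, mul_comm, ← Real.exp_le_exp]
  calc _ ≤ _ := hjensen
    _ ≤ _ := hμν
    _ ≤ Real.exp c * Real.exp (Fintype.card ι * (q * Real.exp t)) :=
        mul_le_mul_of_nonneg_left hmgf (Real.exp_nonneg _)
    _ = _ := (Real.exp_add _ _).symm

end

/-! ### Independence of disjoint windows and averaging over shifts -/

section

variable {d : ℕ} {b : Module.Basis (Fin d) ℝ (E d)}

/-- The integer coordinates of a lattice vector. -/
abbrev coords (b : Module.Basis (Fin d) ℝ (E d)) : Lat b ≃ₗ[ℤ] (Fin d → ℤ) :=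
  (b.restrictScalars ℤ).equivFun

/-- Lattice translates of a finite set `Δ` fall into finitely many classes of disjoint translates. -/
theorem exists_coloring (Δ : Finset (Lat b)) :
    ∃ (p : ℕ) (_ : NeZero p) (c : Lat b → (Fin d → ZMod p)), ∀ k k', c k = c k' →
      ∀ i ∈ Δ, ∀ i' ∈ Δ, i + k = i' + k' → k = k' := by
  obtain ⟨N, hN⟩ : ∃ N : ℕ, ∀ i ∈ Δ, ∀ j, (coords b i j).natAbs ≤ N := by
    refine ⟨∑ i ∈ Δ, ∑ j, (coords b i j).natAbs, fun i hi j => ?_⟩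
    refine le_trans ?_ (Finset.single_le_sum (f := fun i => ∑ j, (coords b i j).natAbs)
      (fun _ _ => Nat.zero_le _) hi)
    exact Finset.single_le_sum (f := fun j => (coords b i j).natAbs)
      (fun _ _ => Nat.zero_le _) (Finset.mem_univ j)
  -- If two translates meet, each coordinate of k' - k is a difference of two coordinates bounded by
  -- N, hence at most 2N in absolute value; being divisible by 2N + 1, it vanishes.
  refine ⟨2 * N + 1, ⟨by omega⟩, fun k j => (coords b k j : ZMod (2 * N + 1)), ?_⟩
  intro k k' hc i hi i' hi' h
  refine (coords b).injective (funext fun j => ?_)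
  have h1 : coords b i j + coords b k j = coords b i' j + coords b k' j := by
    have := congrFun (congrArg (coords b) h) j
    simpa only [map_add, Pi.add_apply] using this
  have h2 := congrFun hc j
  simp only at h2
  rw [ZMod.intCast_eq_intCast_iff_dvd_sub] at h2
  have h3 := hN i hi j
  have h4 := hN i' hi' j
  have h5 : coords b k' j - coords b k j = 0 := by
    refine Int.eq_zero_of_abs_lt_dvd h2 ?_
    push_cast
    rw [abs_lt]
    omega
  omega

variable {H : Finset (E d) → EReal} {Q : Measure (E d)}

/-- Blocks of the free field on disjoint translates of a window are independent. -/
theorem iIndepFun_blocks [IsProbabilityMeasure Q] (Δ : Finset (Lat b)) {ι : Type*} (f : ι → Lat b)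
    (hf : ∀ k k', ∀ i ∈ Δ, ∀ i' ∈ Δ, i + f k = i' + f k' → k = k') :
    iIndepFun (fun k (x : Field b) => Δ.restrict (shift (f k) x)) (freeField b Q) := by
  -- Together the blocks read the free field at distinct sites indexed by ι × Δ; currying this
  -- product measure shows that the blocks are independent.
  have hinj : Function.Injective fun p : ι × Δ => (p.2 : Lat b) + f p.1 := by
    rintro ⟨k, i⟩ ⟨k', i'⟩ h
    have hk := hf k k' i i.2 i' i'.2 h
    subst hk
    exact Prod.ext rfl (Subtype.ext (add_right_cancel h))
  have hinj' : ∀ k, Function.Injective fun i : Δ => (i : Lat b) + f k := by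
    intro k i i' h
    exact Subtype.ext (add_right_cancel h)
  have hm : ∀ k, Measurable fun x : Field b => Δ.restrict (shift (f k) x) :=
    fun k => (Finset.measurable_restrict Δ).comp (measurable_shift (f k))
  have h1 := Measure.map_infinitePi_infinitePi_of_inj (P := fun _ : Lat b => Q) hinj
  have h2 : ∀ k, (freeField b Q).map (fun x : Field b => Δ.restrict (shift (f k) x)) =
      Measure.infinitePi fun _ : Δ => Q :=
    fun k => Measure.map_infinitePi_infinitePi_of_inj (P := fun _ : Lat b => Q) (hinj' k)
  rw [iIndepFun_iff_map_fun_eq_infinitePi_map hm]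
  simp_rw [h2]
  rw [← Measure.infinitePi_map_curry (fun (_ : ι) (_ : Δ) => Q)]
  change _ = (Measure.infinitePi fun _ : ι × Δ => Q).map _
  rw [← h1, Measure.map_map (MeasurableEquiv.measurable _) (by fun_prop)]
  rfl

/-- The empirical average over the translations in `Λ` of the Gibbs measure in `Λ`. -/
def averagedGibbs (H : Finset (E d) → EReal) (Q : Measure (E d)) (Λ : Finset (Lat b)) :
    Measure (Field b) :=
  (Λ.card : ℝ≥0∞)⁻¹ • ∑ k ∈ Λ, (freeGibbs H Q Λ).map (shift k)

theorem averagedGibbs_apply {Λ : Finset (Lat b)} {A : Set (Field b)} (hA : MeasurableSet A) :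
    averagedGibbs H Q Λ A = (Λ.card : ℝ≥0∞)⁻¹ * ∑ k ∈ Λ, freeGibbs H Q Λ (shift k ⁻¹' A) := by
  simp only [averagedGibbs, Measure.smul_apply, Measure.finsetSum_apply, smul_eq_mul]
  congr 1
  exact Finset.sum_congr rfl fun k _ => Measure.map_apply (measurable_shift k) hA

theorem isProbabilityMeasure_averagedGibbs {Λ : Finset (Lat b)} (hΛ : Λ.Nonempty)
    [IsProbabilityMeasure (freeGibbs H Q Λ)] : IsProbabilityMeasure (averagedGibbs H Q Λ) := by
  constructor
  rw [averagedGibbs_apply MeasurableSet.univ]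
  simp only [Set.preimage_univ, measure_univ, Finset.sum_const, nsmul_eq_mul, mul_one]
  exact ENNReal.inv_mul_cancel (by simpa using hΛ.card_pos.ne') (by simp)

theorem averagedGibbs_absolutelyContinuous [IsProbabilityMeasure Q] {Λ : Finset (Lat b)} :
    averagedGibbs H Q Λ ≪ freeField b Q := by
  refine Measure.AbsolutelyContinuous.mk fun A hA h => ?_
  rw [averagedGibbs_apply hA, Finset.sum_eq_zero, mul_zero]
  intro k _
  have h' : freeField b Q (shift k ⁻¹' A) = 0 := by
    rw [← Measure.map_apply (measurable_shift k) hA, freeField_map_shift, h]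
  rw [freeGibbs, Measure.smul_apply, withDensity_absolutelyContinuous _ _ h', smul_zero]

/-- The shifts in Λ are sorted by colour. Within one colour the translated windows are disjoint, so
`sum_measureReal_le_of_le_smul` applies with c = K·#Λ. Summing over the r colours and dividing by #Λ
leaves (rK + q exp t)/t, where q is the free probability of A: first t is taken large, then q small.
The resulting δ is independent of Λ. -/
theorem averagedGibbs_uniform_absolutelyContinuous [IsProbabilityMeasure Q] (h1 : Stable H)
    (h2 : NonDegenerate b H) (h4 : TranslationInvariant H) (Δ : Finset (Lat b)) {ε : ℝ}
    (hε : 0 < ε) :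
    ∃ δ : ℝ, 0 < δ ∧ ∀ A : Set (Δ → E d), MeasurableSet A →
      ((freeField b Q).map Δ.restrict).real A ≤ δ → ∀ Λ : Finset (Lat b), Λ.Nonempty →
        (averagedGibbs H Q Λ).real (Δ.restrict ⁻¹' A) ≤ ε := by
  classical
  obtain ⟨K, hK, hG⟩ := exists_freeGibbs_le (Q := Q) h1 h2 h4
  obtain ⟨p, hp, c, hc⟩ := exists_coloring Δ
  set r : ℕ := Fintype.card (Fin d → ZMod p)
  -- Chosen so that rK ≤ εt/2, the summand 1 keeping t positive; δ below is then the value of q for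
  -- which q exp t = εt/2.
  set t : ℝ := 2 * (r * K) / ε + 1
  have ht : 0 < t := by positivity
  refine ⟨ε / 2 * t * Real.exp (-t), by positivity, fun A hA hAδ Λ hΛ => ?_⟩
  have := isProbabilityMeasure_freeGibbs (hG Λ).1 (hG Λ).2.1
  set q := ((freeField b Q).map Δ.restrict).real A
  have hA' : MeasurableSet (Δ.restrict ⁻¹' A : Set (Field b)) :=
    Finset.measurable_restrict Δ hA
  have hsum : ∀ e : Fin d → ZMod p, ∑ k ∈ Λ with c k = e,
      (freeGibbs H Q Λ).real (shift k ⁻¹' (Δ.restrict ⁻¹' A)) ≤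
        (K * Λ.card + (Λ.filter (c · = e)).card * (q * Real.exp t)) / t := by
    intro e
    rw [← Finset.sum_coe_sort]
    have := sum_measureReal_le_of_le_smul (ι := {k // k ∈ Λ.filter (c · = e)}) (q := q) ht
      (hG Λ).2.2 (A := fun k => shift (k : Lat b) ⁻¹' (Δ.restrict ⁻¹' A))
      (fun k => measurable_shift _ hA') ?_ ?_
    · simpa only [Fintype.card_coe] using this
    · have hb := iIndepFun_blocks (Q := Q) Δ
        (fun k : {k // k ∈ Λ.filter (c · = e)} => (k : Lat b)) (by
          rintro ⟨k, hk⟩ ⟨k', hk'⟩ i hi i' hi' h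
          rw [Finset.mem_filter] at hk hk'
          exact Subtype.ext (hc k k' (hk.2.trans hk'.2.symm) i hi i' hi' h))
      exact hb.comp (fun _ => A.indicator fun _ => (1 : ℝ)) fun _ => measurable_const.indicator hA
    · intro k
      rw [measureReal_def, ← Measure.map_apply (measurable_shift _) hA', freeField_map_shift,
        ← Measure.map_apply (Finset.measurable_restrict Δ) hA]
      rfl
  have htot : ∑ k ∈ Λ, (freeGibbs H Q Λ).real (shift k ⁻¹' (Δ.restrict ⁻¹' A)) ≤
      Λ.card * ε := by
    rw [← Finset.sum_fiberwise Λ c]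
    have hcard : ∑ e : Fin d → ZMod p, ((Λ.filter (c · = e)).card : ℝ) = Λ.card := by
      exact_mod_cast (Finset.card_eq_sum_card_fiberwise (f := c) (s := Λ) (t := Finset.univ)
        (by simp)).symm
    calc _ ≤ ∑ e : Fin d → ZMod p,
          (K * Λ.card + (Λ.filter (c · = e)).card * (q * Real.exp t)) / t :=
          Finset.sum_le_sum fun e _ => hsum e
      _ = Λ.card * ((r * K + q * Real.exp t) / t) := by
          rw [← Finset.sum_div, Finset.sum_add_distrib,
            ← Finset.sum_mul Finset.univ _ (q * Real.exp t), hcard]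
          simp only [Finset.sum_const, Finset.card_univ, nsmul_eq_mul]
          ring
      _ ≤ _ := by
          refine mul_le_mul_of_nonneg_left ?_ (by positivity)
          rw [div_le_iff₀ ht]
          have hq : q * Real.exp t ≤ ε / 2 * t := by
            calc q * Real.exp t ≤ ε / 2 * t * Real.exp (-t) * Real.exp t :=
                  mul_le_mul_of_nonneg_right hAδ (Real.exp_nonneg _)
              _ = _ := by rw [mul_assoc, ← Real.exp_add]; simp
          have hr : r * K ≤ ε / 2 * t := by
            simp only [t]
            rw [mul_add, mul_div_assoc']
            have : ε / 2 * (2 * (r * K)) / ε = r * K := by field_simp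
            rw [this]
            linarith
          linarith
  have hcard : (0 : ℝ) < Λ.card := by exact_mod_cast hΛ.card_pos
  rw [measureReal_def, averagedGibbs_apply hA', ENNReal.toReal_mul,
    ENNReal.toReal_sum fun k _ => measure_ne_top _ _]
  simp only [ENNReal.toReal_inv, ENNReal.toReal_natCast]
  rw [inv_mul_le_iff₀ hcard]
  exact htot

/-! ### Averaging boxes -/

/-- The box `{∑ t_i a_i : t ∈ {0,…,n}^d}`. -/
def coordBox (b : Module.Basis (Fin d) ℝ (E d)) (n : ℕ) : Finset (Lat b) :=
  (Fintype.piFinset fun _ : Fin d => Finset.Icc (0 : ℤ) n).map (coords b).symm.toEquiv.toEmbedding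

theorem mem_coordBox {n : ℕ} {k : Lat b} :
    k ∈ coordBox b n ↔ ∀ j, 0 ≤ coords b k j ∧ coords b k j ≤ n := by
  rw [coordBox, Finset.mem_map_equiv]
  simp only [Fintype.mem_piFinset, Finset.mem_Icc]
  rfl

theorem card_coordBox (n : ℕ) : (coordBox b n).card = (n + 1) ^ d := by
  simp [coordBox]

theorem coordBox_nonempty (n : ℕ) : (coordBox b n).Nonempty :=
  ⟨0, mem_coordBox.2 fun j => by simp⟩

open scoped Classical in
/-- The points of the box at which the window `Γ` leaves the box. -/
def badPoints (Γ : Finset (Lat b)) (n : ℕ) : Finset (Lat b) :=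
  (coordBox b n).filter fun k => ∃ i ∈ Γ, i + k ∉ coordBox b n

/-- Only the j-th coordinate is constrained: at most 2|z| values of it are bad, and the other
coordinates are free. -/
theorem card_slab_le (n : ℕ) (j : Fin d) (z : ℤ) :
    (((coordBox b n).filter fun k => ¬ (0 ≤ z + coords b k j ∧ z + coords b k j ≤ n)).card : ℝ) ≤
      2 * |(z : ℝ)| * (n + 1) ^ d / (n + 1) := by
  classical
  set T : Finset ℤ := (Finset.Icc (0 : ℤ) n).filter fun w => ¬ (0 ≤ z + w ∧ z + w ≤ n)
  have hT : (T.card : ℝ) ≤ 2 * |(z : ℝ)| := by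
    -- For a given sign of z only one end of the interval is lost; taking both ends covers the two
    -- signs at once.
    have hsub : T ⊆ Finset.Ico 0 |z| ∪ Finset.Ioc (n - |z|) n := by
      intro w hw
      simp only [T, Finset.mem_filter, Finset.mem_Icc] at hw
      simp only [Finset.mem_union, Finset.mem_Ico, Finset.mem_Ioc]
      rcases abs_cases z with h | h <;> omega
    have h := (Finset.card_le_card hsub).trans (Finset.card_union_le _ _)
    simp only [Int.card_Ico, Int.card_Ioc, sub_zero] at h
    have h' : ((T.card : ℕ) : ℤ) ≤ 2 * |z| := by
      have := abs_nonneg z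
      omega
    exact_mod_cast h'
  have hcard : ((coordBox b n).filter fun k =>
      ¬ (0 ≤ z + coords b k j ∧ z + coords b k j ≤ n)).card = T.card * (n + 1) ^ (d - 1) := by
    have : ((coordBox b n).filter fun k =>
        ¬ (0 ≤ z + coords b k j ∧ z + coords b k j ≤ n)) =
        (Fintype.piFinset (Function.update (fun _ : Fin d => Finset.Icc (0 : ℤ) n) j T)).map
          (coords b).symm.toEquiv.toEmbedding := by
      ext k
      rw [Finset.mem_map_equiv, Finset.mem_filter, mem_coordBox, Fintype.mem_piFinset]
      constructor
      · rintro ⟨hk, hz⟩ j'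
        by_cases hj : j' = j
        · subst hj
          rw [Function.update_self]
          exact Finset.mem_filter.2 ⟨Finset.mem_Icc.2 (hk j'), hz⟩
        · rw [Function.update_of_ne hj]
          exact Finset.mem_Icc.2 (hk j')
      · intro h
        have hj := h j
        rw [Function.update_self] at hj
        refine ⟨fun j' => ?_, (Finset.mem_filter.1 hj).2⟩
        by_cases hj' : j' = j
        · subst hj'
          exact Finset.mem_Icc.1 (Finset.mem_filter.1 hj).1
        · have := h j'
          rw [Function.update_of_ne hj'] at this
          exact Finset.mem_Icc.1 this
    rw [this, Finset.card_map, Fintype.card_piFinset, ← Finset.mul_prod_erase _ _ (Finset.mem_univ j),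
      Function.update_self]
    congr 1
    rw [Finset.prod_congr rfl (g := fun _ => n + 1)]
    · simp
    · intro i hi
      rw [Function.update_of_ne (Finset.ne_of_mem_erase hi)]
      simp
  have hd : 0 < d := j.pos
  rw [hcard, le_div_iff₀ (by positivity)]
  push_cast
  rw [mul_assoc, ← pow_succ, Nat.sub_add_cancel hd]
  exact mul_le_mul_of_nonneg_right hT (by positivity)

theorem tendsto_card_badPoints (Γ : Finset (Lat b)) :
    Tendsto (fun n => ((badPoints Γ n).card : ℝ) / (coordBox b n).card) atTop (𝓝 0) := by
  classical
  set C : ℝ := ∑ i ∈ Γ, ∑ j, 2 * |(coords b i j : ℝ)|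
  have hle : ∀ n : ℕ, ((badPoints Γ n).card : ℝ) / (coordBox b n).card ≤ C / (n + 1) := by
    intro n
    have hsub : badPoints Γ n ⊆ Γ.biUnion fun i => Finset.univ.biUnion fun j =>
        (coordBox b n).filter fun k =>
          ¬ (0 ≤ coords b i j + coords b k j ∧ coords b i j + coords b k j ≤ n) := by
      intro k hk
      simp only [badPoints, Finset.mem_filter] at hk
      obtain ⟨hk, i, hi, hik⟩ := hk
      rw [mem_coordBox] at hik
      obtain ⟨j, hj⟩ := not_forall.1 hik
      rw [map_add, Pi.add_apply] at hj
      exact Finset.mem_biUnion.2 ⟨i, hi, Finset.mem_biUnion.2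
        ⟨j, Finset.mem_univ j, Finset.mem_filter.2 ⟨hk, hj⟩⟩⟩
    have h1 : ((badPoints Γ n).card : ℝ) ≤
        ∑ i ∈ Γ, ∑ j, 2 * |(coords b i j : ℝ)| * (n + 1) ^ d / (n + 1) := by
      have h := (Finset.card_le_card hsub).trans (Finset.card_biUnion_le.trans
        (Finset.sum_le_sum fun i _ => Finset.card_biUnion_le))
      calc ((badPoints Γ n).card : ℝ) ≤ _ := Nat.cast_le.2 h
        _ ≤ _ := by
          push_cast
          exact Finset.sum_le_sum fun i _ => Finset.sum_le_sum fun j _ => card_slab_le n j _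
    rw [card_coordBox, div_le_iff₀ (by positivity)]
    refine h1.trans (le_of_eq ?_)
    simp only [C, Finset.sum_div, Finset.sum_mul]
    refine Finset.sum_congr rfl fun i _ => Finset.sum_congr rfl fun j _ => ?_
    push_cast
    ring
  refine squeeze_zero (fun n => by positivity) hle ?_
  exact tendsto_const_nhds.div_atTop
    (tendsto_atTop_add_const_right _ _ tendsto_natCast_atTop_atTop)

end

/-! ### Local limits -/

/-- Setwise convergence on the level sets of a bounded function gives convergence of integrals. -/
theorem tendsto_lintegral_of_tendsto_preimage {Ω ι : Type*} [MeasurableSpace Ω] {L : Filter ι}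
    {μs : ι → Measure Ω} [∀ n, IsProbabilityMeasure (μs n)] {μ : Measure Ω}
    [IsProbabilityMeasure μ] {f : Ω → ℝ≥0∞} (hf : Measurable f) (hf1 : ∀ x, f x ≤ 1)
    (h : ∀ s : Set ℝ≥0∞, MeasurableSet s → Tendsto (fun n => μs n (f ⁻¹' s)) L (𝓝 (μ (f ⁻¹' s)))) :
    Tendsto (fun n => ∫⁻ x, f x ∂μs n) L (𝓝 (∫⁻ x, f x ∂μ)) := by
  -- Here g rounds down to a multiple of 1/N. The integral of g ∘ f is a finite combination of
  -- masses of level sets of f, so it converges; the error 1/N is uniform in n. The `min` only keeps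
  -- the level inside `Fin (N + 1)` and is inactive for y ≤ 1.
  have key : ∀ N : ℕ, 0 < N → ∃ g : ℝ≥0∞ → ℝ≥0∞, (∀ y ≤ 1, g y ≤ y ∧ y ≤ g y + (N : ℝ≥0∞)⁻¹) ∧
      Tendsto (fun n => ∫⁻ x, g (f x) ∂μs n) L (𝓝 (∫⁻ x, g (f x) ∂μ)) := by
    intro N hN
    have hN' : (0 : ℝ) < N := by exact_mod_cast hN
    set φ : ℝ≥0∞ → Fin (N + 1) := fun y =>
      ⟨min N ⌊N * y.toReal⌋₊, Nat.lt_succ_of_le (min_le_left _ _)⟩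
    have hφ : Measurable φ := by
      have h1 : Measurable fun y : ℝ≥0∞ => ⌊N * y.toReal⌋₊ :=
        Nat.measurable_floor.comp (ENNReal.measurable_toReal.const_mul _)
      have h2 : Measurable fun m : ℕ => (⟨min N m, Nat.lt_succ_of_le (min_le_left _ _)⟩ :
          Fin (N + 1)) := measurable_from_nat
      exact h2.comp h1
    set c : Fin (N + 1) → ℝ≥0∞ := fun k => ENNReal.ofReal (k / N)
    refine ⟨fun y => c (φ y), fun y hy => ?_, ?_⟩
    · have hytop : y ≠ ∞ := ne_top_of_le_ne_top ENNReal.one_ne_top hy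
      have hy1 : y.toReal ≤ 1 := by simpa using ENNReal.toReal_mono ENNReal.one_ne_top hy
      have hfl : ⌊N * y.toReal⌋₊ ≤ N :=
        Nat.floor_le_of_le (by nlinarith)
      have hφy : ((φ y : ℕ) : ℝ) = ⌊N * y.toReal⌋₊ := by simp [φ, min_eq_right hfl]
      have h0 : 0 ≤ N * y.toReal := by positivity
      simp only [c, hφy]
      constructor
      · rw [ENNReal.ofReal_le_iff_le_toReal hytop, div_le_iff₀ hN', mul_comm y.toReal]
        exact Nat.floor_le h0
      · rw [← ENNReal.ofReal_toReal hytop, ENNReal.toReal_ofReal ENNReal.toReal_nonneg,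
          ← ENNReal.ofReal_natCast N, ← ENNReal.ofReal_inv_of_pos hN',
          ← ENNReal.ofReal_add (by positivity) (by positivity)]
        refine ENNReal.ofReal_le_ofReal ?_
        rw [inv_eq_one_div, ← add_div, le_div_iff₀ hN', mul_comm]
        exact (Nat.lt_floor_add_one _).le
    · have hsum : ∀ ρ : Measure Ω, ∫⁻ x, c (φ (f x)) ∂ρ =
          ∑ k, c k * ρ (f ⁻¹' (φ ⁻¹' {k})) := by
        intro ρ
        rw [← lintegral_map (f := c) (g := fun x => φ (f x)) (Measurable.of_discrete)
          (hφ.comp hf), lintegral_fintype]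
        refine Finset.sum_congr rfl fun k _ => ?_
        congr 1
        exact Measure.map_apply (hφ.comp hf) (measurableSet_singleton k)
      simp_rw [hsum]
      exact tendsto_finsetSum _ fun k _ => ENNReal.Tendsto.const_mul
        (h _ (hφ (measurableSet_singleton k))) (Or.inr ENNReal.ofReal_ne_top)
  have hinv : Tendsto (fun N : ℕ => (N : ℝ≥0∞)⁻¹) atTop (𝓝 0) := ENNReal.tendsto_inv_nat_nhds_zero
  rcases L.eq_or_neBot with rfl | hne
  · exact tendsto_bot
  refine tendsto_of_le_liminf_of_limsup_le ?_ ?_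
  · have hlim : Tendsto (fun N : ℕ => liminf (fun n => ∫⁻ x, f x ∂μs n) L + (N : ℝ≥0∞)⁻¹) atTop
        (𝓝 (liminf (fun n => ∫⁻ x, f x ∂μs n) L + 0)) := hinv.const_add _
    rw [add_zero] at hlim
    refine ge_of_tendsto hlim ?_
    filter_upwards [eventually_gt_atTop 0] with N hN
    obtain ⟨g, hg, hgl⟩ := key N hN
    calc ∫⁻ x, f x ∂μ ≤ ∫⁻ x, (g (f x) + (N : ℝ≥0∞)⁻¹) ∂μ :=
          lintegral_mono fun x => (hg _ (hf1 x)).2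
      _ = ∫⁻ x, g (f x) ∂μ + (N : ℝ≥0∞)⁻¹ := by
          rw [lintegral_add_right _ measurable_const]
          simp
      _ ≤ _ := by
          gcongr
          rw [← hgl.liminf_eq]
          exact liminf_le_liminf (Eventually.of_forall fun n =>
            lintegral_mono fun x => (hg _ (hf1 x)).1)
  · have hlim : Tendsto (fun N : ℕ => ∫⁻ x, f x ∂μ + (N : ℝ≥0∞)⁻¹) atTop
        (𝓝 (∫⁻ x, f x ∂μ + 0)) := hinv.const_add _
    rw [add_zero] at hlim
    refine ge_of_tendsto hlim ?_
    filter_upwards [eventually_gt_atTop 0] with N hN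
    obtain ⟨g, hg, hgl⟩ := key N hN
    calc limsup (fun n => ∫⁻ x, f x ∂μs n) L
        ≤ limsup (fun n => ∫⁻ x, g (f x) ∂μs n + (N : ℝ≥0∞)⁻¹) L := by
          refine limsup_le_limsup (Eventually.of_forall fun n => ?_)
          calc ∫⁻ x, f x ∂μs n ≤ ∫⁻ x, (g (f x) + (N : ℝ≥0∞)⁻¹) ∂μs n :=
                lintegral_mono fun x => (hg _ (hf1 x)).2
            _ = ∫⁻ x, g (f x) ∂μs n + (N : ℝ≥0∞)⁻¹ := by
                rw [lintegral_add_right _ measurable_const]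
                simp
      _ = ∫⁻ x, g (f x) ∂μ + (N : ℝ≥0∞)⁻¹ := (hgl.add_const _).limsup_eq
      _ ≤ _ := by
          gcongr with x
          exact (hg _ (hf1 x)).1

section

variable {d : ℕ} {b : Module.Basis (Fin d) ℝ (E d)}

/-- Convergence of the probabilities of all events depending on finitely many displacements. -/
def TendstoLocally (μs : ℕ → Measure (Field b)) (U : Ultrafilter ℕ) (P : Measure (Field b)) :
    Prop :=
  ∀ (Γ : Finset (Lat b)) (A : Set (Γ → E d)), MeasurableSet A →
    Tendsto (fun n => μs n (Γ.restrict ⁻¹' A)) U (𝓝 (P (Γ.restrict ⁻¹' A)))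

theorem eq_comp_restrict_of_dependsOn {β : Type*} {f : Field b → β} {Γ : Finset (Lat b)}
    (hf : DependsOn f Γ) :
    ∃ e : (Γ → E d) → Field b, Measurable e ∧ f = (f ∘ e) ∘ Γ.restrict := by
  classical
  refine ⟨fun y i => if h : i ∈ Γ then y ⟨i, h⟩ else 0, measurable_pi_lambda _ fun i => ?_, ?_⟩
  · by_cases h : i ∈ Γ
    · simp only [h, dif_pos]
      exact measurable_pi_apply _
    · simp only [h, dif_neg, not_false_eq_true]
      exact measurable_const
  · ext1 x
    refine hf fun i hi => ?_
    have hi' : i ∈ Γ := by simpa using hi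
    simp [hi']

theorem TendstoLocally.lintegral {μs : ℕ → Measure (Field b)} {U : Ultrafilter ℕ}
    {P : Measure (Field b)} [∀ n, IsProbabilityMeasure (μs n)] [IsProbabilityMeasure P]
    (h : TendstoLocally μs U P) {f : Field b → ℝ≥0∞} (hf : Measurable f) (hf1 : ∀ x, f x ≤ 1)
    {Γ : Finset (Lat b)} (hfΓ : DependsOn f Γ) :
    Tendsto (fun n => ∫⁻ x, f x ∂μs n) U (𝓝 (∫⁻ x, f x ∂P)) := by
  obtain ⟨e, he, hfe⟩ := eq_comp_restrict_of_dependsOn hfΓ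
  refine tendsto_lintegral_of_tendsto_preimage hf hf1 fun s hs => ?_
  rw [hfe]
  exact h Γ _ ((hf.comp he) hs)

theorem TendstoLocally.measure {μs : ℕ → Measure (Field b)} {U : Ultrafilter ℕ}
    {P : Measure (Field b)} (h : TendstoLocally μs U P) {A : Set (Field b)} (hA : MeasurableSet A)
    {Γ : Finset (Lat b)} (hAΓ : DependsOn (· ∈ A) (Γ : Set (Lat b))) :
    Tendsto (fun n => μs n A) U (𝓝 (P A)) := by
  obtain ⟨e, he, hfe⟩ := eq_comp_restrict_of_dependsOn hAΓ
  have : A = Γ.restrict ⁻¹' (e ⁻¹' A) := by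
    ext x
    exact iff_of_eq (congrFun hfe x)
  rw [this]
  exact h Γ _ (he hA)

/-- Uniform absolute continuity is used twice: it yields tightness, hence a weak limit along the
ultrafilter, and it upgrades weak convergence to convergence on arbitrary measurable cylinder
events. -/
theorem exists_tendstoLocally {μs : ℕ → Measure (Field b)} [∀ n, IsProbabilityMeasure (μs n)]
    {ρ : Measure (Field b)} [IsProbabilityMeasure ρ]
    (h : ∀ (Δ : Finset (Lat b)) (ε : ℝ), 0 < ε → ∃ δ : ℝ, 0 < δ ∧ ∀ A : Set (Δ → E d),
      MeasurableSet A → (ρ.map Δ.restrict).real A ≤ δ → ∀ n, (μs n).real (Δ.restrict ⁻¹' A) ≤ ε)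
    (U : Ultrafilter ℕ) :
    ∃ P : Measure (Field b), IsProbabilityMeasure P ∧ TendstoLocally μs U P := by
  set νs : ℕ → ProbabilityMeasure (Field b) := fun n => ⟨μs n, inferInstance⟩
  have hprob : ∀ Δ : Finset (Lat b), IsProbabilityMeasure (ρ.map Δ.restrict) :=
    fun Δ => Measure.isProbabilityMeasure_map (Finset.measurable_restrict Δ).aemeasurable
  -- One-site tails are small under ρ, hence small uniformly in n; a product of balls with summable
  -- exceptional masses is then compact by Tychonoff.
  have hball : ∀ (i : Lat b) (ε : ℝ), 0 < ε → ∃ r : ℝ, ∀ n,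
      (μs n).real {x | x i ∉ Metric.closedBall (0 : E d) r} ≤ ε := by
    intro i ε hε
    obtain ⟨δ, hδ, hA⟩ := h {i} ε hε
    set A : ℕ → Set (({i} : Finset (Lat b)) → E d) :=
      fun m => {y | y ⟨i, by simp⟩ ∉ Metric.closedBall (0 : E d) m}
    have hAm : ∀ m, MeasurableSet (A m) := fun m =>
      (measurable_pi_apply _ Metric.isClosed_closedBall.measurableSet).compl
    have hlim : Tendsto (fun m => (ρ.map (Finset.restrict {i})).real (A m)) atTop (𝓝 0) := by
      have hanti : Antitone A := fun m m' hmm y hy hy' =>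
        hy (Metric.closedBall_subset_closedBall (by exact_mod_cast hmm) hy')
      have hempty : ⋂ m, A m = ∅ := by
        ext y
        simp only [Set.mem_iInter, Set.mem_empty_iff_false, iff_false, not_forall]
        obtain ⟨m, hm⟩ := exists_nat_ge ‖y ⟨i, by simp⟩‖
        exact ⟨m, by simpa [A] using hm⟩
      have := tendsto_measure_iInter_atTop (μ := ρ.map (Finset.restrict {i}))
        (fun m => (hAm m).nullMeasurableSet) hanti ⟨0, measure_ne_top _ _⟩
      rw [hempty, measure_empty] at this
      simpa [measureReal_def, Function.comp_def] using (ENNReal.tendsto_toReal ENNReal.zero_ne_top).comp this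
    obtain ⟨m, hm⟩ := (hlim.eventually (ge_mem_nhds hδ)).exists
    exact ⟨m, fun n => hA (A m) (hAm m) hm n⟩
  have htight : IsTightMeasureSet
      {((μ : ProbabilityMeasure (Field b)) : Measure (Field b)) | μ ∈ Set.range νs} := by
    rw [isTightMeasureSet_iff_exists_isCompact_measure_compl_le]
    intro ε hε
    obtain ⟨ε', hε', hsum⟩ := ENNReal.exists_pos_sum_of_countable hε.ne' (Lat b)
    choose r hr using fun i => hball i (ε' i) (by exact_mod_cast hε' i)
    refine ⟨Set.univ.pi fun i => Metric.closedBall 0 (r i),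
      isCompact_univ_pi fun i => isCompact_closedBall _ _, ?_⟩
    rintro _ ⟨_, ⟨n, rfl⟩, rfl⟩
    have hcompl : (Set.univ.pi fun i : Lat b => Metric.closedBall (0 : E d) (r i))ᶜ ⊆
        ⋃ i, {x | x i ∉ Metric.closedBall (0 : E d) (r i)} := by
      intro x hx
      simpa [Set.mem_pi] using hx
    calc _ ≤ μs n (⋃ i, {x | x i ∉ Metric.closedBall (0 : E d) (r i)}) := measure_mono hcompl
      _ ≤ ∑' i, μs n {x | x i ∉ Metric.closedBall (0 : E d) (r i)} := measure_iUnion_le _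
      _ ≤ ∑' i, (ε' i : ℝ≥0∞) := by
          refine ENNReal.tsum_le_tsum fun i => ?_
          rw [← ENNReal.ofReal_toReal (measure_ne_top (μs n) _), ← ENNReal.ofReal_coe_nnreal]
          exact ENNReal.ofReal_le_ofReal (hr i n)
      _ ≤ ε := hsum.le
  obtain ⟨P, -, hP⟩ := (isCompact_closure_of_isTightMeasureSet htight).ultrafilter_le_nhds
    (U.map νs) (by
      refine le_principal_iff.2 (Ultrafilter.mem_coe.2 (Ultrafilter.mem_map.2 ?_))
      exact Filter.univ_mem' fun n => subset_closure ⟨n, rfl⟩)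
  have hP' : Tendsto νs U (𝓝 P) := hP
  refine ⟨P, inferInstance, ?_⟩
  -- A is approximated from inside by a closed F up to a set of small ρ-mass, which is small for
  -- every μs n; the portmanteau theorem handles F. The lower bound comes from the complement of A.
  have upper : ∀ (Γ : Finset (Lat b)) (A : Set (Γ → E d)), MeasurableSet A →
      limsup (fun n => μs n (Γ.restrict ⁻¹' A)) U ≤ (P : Measure (Field b)) (Γ.restrict ⁻¹' A) := by
    intro Γ A hA
    refine ENNReal.le_of_forall_pos_le_add fun ε hε _ => ?_
    obtain ⟨δ, hδ, hac⟩ := h Γ ε (by exact_mod_cast hε)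
    obtain ⟨F, hFA, hF, hdiff⟩ := hA.exists_isClosed_sdiff_lt (μ := ρ.map Γ.restrict)
      (measure_ne_top _ _) (ε := ENNReal.ofReal δ) (by simpa using hδ)
    have hsmall : ∀ n, μs n (Γ.restrict ⁻¹' (A \ F)) ≤ ε := by
      intro n
      have := hac (A \ F) (hA.diff hF.measurableSet)
        (ENNReal.toReal_le_of_le_ofReal hδ.le hdiff.le) n
      rw [← ENNReal.ofReal_toReal (measure_ne_top (μs n) _), ← ENNReal.ofReal_coe_nnreal]
      exact ENNReal.ofReal_le_ofReal this
    have hFcl : IsClosed (Γ.restrict ⁻¹' F : Set (Field b)) :=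
      hF.preimage (by fun_prop)
    calc limsup (fun n => μs n (Γ.restrict ⁻¹' A)) U
        ≤ limsup (fun n => (νs n : Measure (Field b)) (Γ.restrict ⁻¹' F) + ε) U := by
          refine limsup_le_limsup (Eventually.of_forall fun n => ?_)
          calc μs n (Γ.restrict ⁻¹' A)
              ≤ μs n (Γ.restrict ⁻¹' F ∪ Γ.restrict ⁻¹' (A \ F)) := by
                refine measure_mono fun x hx => ?_
                by_cases hxF : x ∈ (Γ.restrict ⁻¹' F : Set (Field b))
                · exact Or.inl hxF
                · exact Or.inr ⟨hx, hxF⟩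
            _ ≤ _ := (measure_union_le _ _).trans (add_le_add le_rfl (hsmall n))
      _ ≤ limsup (fun n => (νs n : Measure (Field b)) (Γ.restrict ⁻¹' F)) U + ε := by
          have hmono : Monotone fun y : ℝ≥0∞ => y + ε := fun _ _ h => add_le_add h le_rfl
          have := hmono.map_limsup_of_continuousAt
            (fun n => (νs n : Measure (Field b)) (Γ.restrict ⁻¹' F)) (F := (U : Filter ℕ))
            (by fun_prop)
          exact this.symm.le
      _ ≤ (P : Measure (Field b)) (Γ.restrict ⁻¹' F) + ε := by
          gcongr
          exact ProbabilityMeasure.limsup_measure_closed_le_of_tendsto hP' hFcl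
      _ ≤ _ := by gcongr
  intro Γ A hA
  have hAm : MeasurableSet (Γ.restrict ⁻¹' A : Set (Field b)) := Finset.measurable_restrict Γ hA
  refine tendsto_of_le_liminf_of_limsup_le ?_ (upper Γ A hA)
  exact le_measure_liminf_of_limsup_measure_compl_le hAm (upper Γ Aᶜ hA.compl)

end

/-! ### Properties of local limits of averaged Gibbs measures -/

section

variable {d : ℕ} {b : Module.Basis (Fin d) ℝ (E d)} {H : Finset (E d) → EReal} {Q : Measure (E d)}

theorem Hereditary.mono (h3 : Hereditary H) {γ γ' : Finset (E d)} (h : γ ⊆ γ') (hγ : H γ = ⊤) :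
    H γ' = ⊤ := by
  classical
  rw [← Finset.union_sdiff_of_subset h]
  induction γ' \ γ using Finset.induction_on with
  | empty => simpa using hγ
  | insert x s _ ih =>
    have := h3 _ ih x
    rw [Finset.union_insert]
    convert this

theorem shift_shift (j k : Lat b) (x : Field b) : shift j (shift k x) = shift (j + k) x := by
  ext1 i
  simp [shift, add_assoc]

/-- The proportion of translations in the box at which the window `Γ` leaves the box. -/
def badRatio (Γ : Finset (Lat b)) (n : ℕ) : ℝ≥0∞ :=
  ((coordBox b n).card : ℝ≥0∞)⁻¹ * (badPoints Γ n).card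

theorem tendsto_badRatio (Γ : Finset (Lat b)) : Tendsto (badRatio Γ) atTop (𝓝 0) := by
  have h := ENNReal.tendsto_ofReal (tendsto_card_badPoints Γ)
  rw [ENNReal.ofReal_zero] at h
  refine h.congr fun n => ?_
  have : (0 : ℝ) < (coordBox b n).card := by exact_mod_cast (coordBox_nonempty (b := b) n).card_pos
  rw [ENNReal.ofReal_div_of_pos this, ENNReal.ofReal_natCast, ENNReal.ofReal_natCast, badRatio,
    ENNReal.div_eq_inv_mul]

theorem subset_translateBox {Γ : Finset (Lat b)} {n : ℕ} {k : Lat b} (hk : k ∈ coordBox b n)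
    (hbad : k ∉ badPoints Γ n) : Γ ⊆ translateBox k (coordBox b n) := by
  intro i hi
  rw [mem_translateBox]
  by_contra h
  exact hbad (Finset.mem_filter.2 ⟨hk, i, hi, h⟩)

/-- Shifts at which the window leaves the box are paid for with the trivial bound 1, so that
estimates are only needed when the shifted box contains Γ. -/
theorem sum_le_sum_add_badPoints (Γ : Finset (Lat b)) (n : ℕ) {f g : Lat b → ℝ≥0∞}
    (hf : ∀ k ∈ coordBox b n, f k ≤ 1)
    (hfg : ∀ k ∈ coordBox b n, Γ ⊆ translateBox k (coordBox b n) → f k ≤ g k) :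
    ((coordBox b n).card : ℝ≥0∞)⁻¹ * ∑ k ∈ coordBox b n, f k ≤
      badRatio Γ n + ((coordBox b n).card : ℝ≥0∞)⁻¹ * ∑ k ∈ coordBox b n, g k := by
  classical
  rw [badRatio, ← mul_add]
  gcongr
  calc ∑ k ∈ coordBox b n, f k
      ≤ ∑ k ∈ coordBox b n, ((if k ∈ badPoints Γ n then 1 else 0) + g k) := by
        refine Finset.sum_le_sum fun k hk => ?_
        split_ifs with hb
        · exact (hf k hk).trans (by simp)
        · rw [zero_add]
          exact hfg k hk (subset_translateBox hk hb)
    _ = _ := by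
        rw [Finset.sum_add_distrib, Finset.sum_boole]
        congr 3
        ext k
        simp only [Finset.mem_filter, badPoints]
        tauto

/-- A further shift by j replaces the averaging set Λ by j + Λ; the part of it lying outside Λ is
counted by the bad points of {j}. -/
theorem averagedGibbs_shift_le {n : ℕ} [IsProbabilityMeasure (freeGibbs H Q (coordBox b n))]
    (j : Lat b) {A : Set (Field b)} (hA : MeasurableSet A) :
    averagedGibbs H Q (coordBox b n) (shift j ⁻¹' A) ≤
      badRatio {j} n + averagedGibbs H Q (coordBox b n) A := by
  classical
  rw [averagedGibbs_apply (measurable_shift j hA), averagedGibbs_apply hA]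
  have hcomp : ∀ k : Lat b, shift k ⁻¹' (shift j ⁻¹' A) = shift (j + k) ⁻¹' A := by
    intro k
    ext x
    simp [shift_shift]
  refine (sum_le_sum_add_badPoints {j} n (g := fun k => if j + k ∈ coordBox b n then
      freeGibbs H Q (coordBox b n) (shift (j + k) ⁻¹' A) else 0)
    (fun k _ => prob_le_one) fun k _ hsub => ?_).trans ?_
  · rw [hcomp, if_pos (mem_translateBox.1 (hsub (Finset.mem_singleton_self j)))]
  · refine add_le_add le_rfl (mul_le_mul' le_rfl ?_)
    rw [← Finset.sum_filter]
    refine (Finset.sum_map ((coordBox b n).filter fun k => j + k ∈ coordBox b n)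
      (Equiv.addLeft j).toEmbedding
      fun k => freeGibbs H Q (coordBox b n) (shift k ⁻¹' A)).symm.le.trans ?_
    refine Finset.sum_le_sum_of_subset fun k hk => ?_
    obtain ⟨k', hk', rfl⟩ := Finset.mem_map.1 hk
    exact (Finset.mem_filter.1 hk').2

theorem measure_ext_of_cylinders {ι : Type*} {X : ι → Type*} [∀ i, MeasurableSpace (X i)]
    {μ ν : Measure (∀ i, X i)} [IsFiniteMeasure μ]
    (h : ∀ B ∈ measurableCylinders X, μ B = ν B) : μ = ν :=
  ext_of_generate_finite _ generateFrom_measurableCylinders.symm isPiSystem_measurableCylinders h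
    (h _ (univ_mem_measurableCylinders X))

variable {U : Ultrafilter ℕ} {P : Measure (Field b)}

/-- In the limit the boundary term disappears, leaving an inequality on cylinders; for probability
measures the inequality on complements is the reverse one. -/
theorem TendstoLocally.map_shift [IsProbabilityMeasure P]
    [∀ n, IsProbabilityMeasure (freeGibbs H Q (coordBox b n))] (hU : (U : Filter ℕ) ≤ atTop)
    (hP : TendstoLocally (fun n => averagedGibbs H Q (coordBox b n)) U P) (j : Lat b) :
    P.map (shift j) = P := by
  have key : ∀ (j : Lat b) (Γ : Finset (Lat b)) (A : Set (Γ → E d)), MeasurableSet A →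
      P (shift j ⁻¹' (Γ.restrict ⁻¹' A)) ≤ P (Γ.restrict ⁻¹' A) := by
    intro j Γ A hA
    have hA' : MeasurableSet (Γ.restrict ⁻¹' A : Set (Field b)) := Finset.measurable_restrict Γ hA
    have h1 : Tendsto (fun n => averagedGibbs H Q (coordBox b n)
        (shift j ⁻¹' (Γ.restrict ⁻¹' A))) U (𝓝 (P (shift j ⁻¹' (Γ.restrict ⁻¹' A)))) := by
      refine hP.measure (Γ := Γ.map (Equiv.addRight j).toEmbedding) (measurable_shift j hA') ?_
      intro x y hxy
      have : Γ.restrict (shift j x) = Γ.restrict (shift j y) := by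
        ext1 i
        exact hxy _ (by simp)
      simp only [Set.mem_preimage, this]
    have h2 := ((tendsto_badRatio {j}).mono_left hU).add (hP Γ A hA)
    rw [zero_add] at h2
    exact le_of_tendsto_of_tendsto h1 h2
      (Eventually.of_forall fun n => averagedGibbs_shift_le j hA')
  have := Measure.isProbabilityMeasure_map (μ := P) (measurable_shift j).aemeasurable
  refine measure_ext_of_cylinders fun B hB => ?_
  obtain ⟨Γ, A, hA, rfl⟩ := (mem_measurableCylinders _).1 hB
  rw [Measure.map_apply (measurable_shift j) hA.cylinder]
  refine le_antisymm (key j Γ A hA) ?_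
  have hc := key j Γ Aᶜ hA.compl
  have hA' : MeasurableSet (Γ.restrict ⁻¹' A : Set (Field b)) := Finset.measurable_restrict Γ hA
  rw [Set.preimage_compl, Set.preimage_compl, prob_compl_eq_one_sub hA',
    prob_compl_eq_one_sub (measurable_shift j hA')] at hc
  exact (ENNReal.sub_le_sub_iff_left prob_le_one ENNReal.one_ne_top).1 hc

/-- By heredity an infinite energy in Γ makes the Boltzmann factor of the larger Λ vanish. -/
theorem freeGibbs_energy_ne_top (hH : IsHamiltonian H) (h3 : Hereditary H)
    {Γ Λ : Finset (Lat b)} (h : Γ ⊆ Λ) : ∀ᵐ x ∂freeGibbs H Q Λ, H (points Γ x) ≠ ⊤ := by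
  rw [freeGibbs]
  refine Measure.ae_smul_measure ?_ _
  rw [ae_withDensity_iff (measurable_boltzmann hH Λ)]
  refine Eventually.of_forall fun x hx htop => hx ?_
  rw [boltzmann, h3.mono (points_mono h x) htop]
  simp

theorem TendstoLocally.ae_energy_ne_top (hH : IsHamiltonian H) (h3 : Hereditary H)
    (h4 : TranslationInvariant H) [IsProbabilityMeasure Q]
    [∀ n, IsProbabilityMeasure (freeGibbs H Q (coordBox b n))] (hU : (U : Filter ℕ) ≤ atTop)
    (hP : TendstoLocally (fun n => averagedGibbs H Q (coordBox b n)) U P) :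
    ∀ᵐ x ∂P, ∀ Γ : Finset (Lat b), H (points Γ x) ≠ ⊤ := by
  rw [ae_all_iff]
  intro Γ
  have hm : MeasurableSet {x : Field b | H (points Γ x) = ⊤} :=
    hH.measurable_comp_points Γ (measurableSet_singleton ⊤)
  have h1 : Tendsto (fun n => averagedGibbs H Q (coordBox b n) {x | H (points Γ x) = ⊤}) U
      (𝓝 (P {x | H (points Γ x) = ⊤})) := by
    refine hP.measure (Γ := Γ) hm fun x y hxy => ?_
    have : points Γ x = points Γ y :=
      Finset.image_congr fun i hi => by rw [hxy i hi]
    simp only [Set.mem_ofPred_eq, this]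
  have h2 : ∀ n, averagedGibbs H Q (coordBox b n) {x | H (points Γ x) = ⊤} ≤ badRatio Γ n := by
    intro n
    rw [averagedGibbs_apply hm]
    refine (sum_le_sum_add_badPoints Γ n (g := fun _ => 0) (fun k _ => prob_le_one)
      fun k _ hsub => ?_).trans (by simp)
    rw [← Measure.map_apply (measurable_shift k) hm, freeGibbs_map_shift hH h4]
    have := freeGibbs_energy_ne_top (Q := Q) hH h3 hsub
    simpa [ae_iff] using this
  have h3 := le_of_tendsto_of_tendsto h1 ((tendsto_badRatio Γ).mono_left hU)
    (Eventually.of_forall h2)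
  simpa [ae_iff] using h3

theorem ae_freeField_mem [IsProbabilityMeasure Q] {S : Set (E d)} (hS : MeasurableSet S)
    (hQS : Q Sᶜ = 0) (i : Lat b) : freeField b Q {x | x i ∈ Sᶜ} = 0 := by
  have := (measurePreserving_eval_infinitePi (fun _ : Lat b => Q) i).measure_preimage
    hS.compl.nullMeasurableSet
  rw [hQS] at this
  exact this

theorem TendstoLocally.ae_mem [IsProbabilityMeasure Q]
    (hP : TendstoLocally (fun n => averagedGibbs H Q (coordBox b n)) U P)
    {S : Set (E d)} (hS : MeasurableSet S) (hQS : Q Sᶜ = 0) : ∀ᵐ x ∂P, ∀ i, x i ∈ S := by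
  rw [ae_all_iff]
  intro i
  have hm : MeasurableSet {x : Field b | x i ∈ Sᶜ} := measurable_pi_apply i hS.compl
  have h1 : Tendsto (fun n => averagedGibbs H Q (coordBox b n) {x | x i ∈ Sᶜ}) U
      (𝓝 (P {x | x i ∈ Sᶜ})) := by
    refine hP.measure (Γ := {i}) hm fun x y hxy => ?_
    have : x i = y i := hxy i (by simp)
    simp only [Set.mem_ofPred_eq, this]
  have h2 : ∀ n, averagedGibbs H Q (coordBox b n) {x : Field b | x i ∈ Sᶜ} = 0 := fun n =>
    averagedGibbs_absolutelyContinuous (ae_freeField_mem hS hQS i)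
  simp_rw [h2] at h1
  exact tendsto_nhds_unique h1 tendsto_const_nhds

/-- An index i outside Λ' has norm greater than r + R, so its point can be within R of the origin
only if ‖x_i‖ > r. After undoing the shift by k, the sum runs over pairs (j, k) with ‖x_j‖ > r and j
- k + x_j in the R-ball. Summing over k first costs at most a lattice count, and what is left is the
tail of x_0 under the averaged measure. -/
theorem sum_freeGibbs_far_le (hH : IsHamiltonian H) (h4 : TranslationInvariant H)
    [IsProbabilityMeasure Q] {Λ Λ' : Finset (Lat b)} {r R : ℝ}
    (hΛ' : ∀ i : Lat b, ‖(i : E d)‖ ≤ r + R → i ∈ Λ') :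
    (Λ.card : ℝ≥0∞)⁻¹ * ∑ k ∈ Λ, freeGibbs H Q (translateBox k Λ)
        {x | ∃ i ∈ translateBox k Λ, i ∉ Λ' ∧ ‖(i : E d) + x i‖ ≤ R} ≤
      latCount b (R + R) * averagedGibbs H Q Λ {x | r < ‖x 0‖} := by
  classical
  set μ := freeGibbs H Q Λ
  have hm0 : MeasurableSet {x : Field b | r < ‖x 0‖} :=
    measurableSet_lt measurable_const (by fun_prop)
  have hmj : ∀ j : Lat b, MeasurableSet {x : Field b | r < ‖x j‖} := fun j =>
    measurableSet_lt measurable_const (by fun_prop)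
  have hmball : ∀ (k j : Lat b), MeasurableSet {x : Field b | ‖((j - k : Lat b) : E d) + x j‖ ≤ R} :=
    fun k j => measurableSet_le (by fun_prop) measurable_const
  have hk : ∀ k ∈ Λ, freeGibbs H Q (translateBox k Λ)
      {x | ∃ i ∈ translateBox k Λ, i ∉ Λ' ∧ ‖(i : E d) + x i‖ ≤ R} ≤
      ∑ j ∈ Λ, μ ({x | r < ‖x j‖} ∩ {x | ‖((j - k : Lat b) : E d) + x j‖ ≤ R}) := by
    intro k _
    have hm : MeasurableSet {x : Field b | ∃ i ∈ translateBox k Λ, i ∉ Λ' ∧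
        ‖(i : E d) + x i‖ ≤ R} := by
      have : {x : Field b | ∃ i ∈ translateBox k Λ, i ∉ Λ' ∧ ‖(i : E d) + x i‖ ≤ R} =
          ⋃ i ∈ (translateBox k Λ).filter (· ∉ Λ'), {x | ‖(i : E d) + x i‖ ≤ R} := by
        ext x
        simp [and_assoc]
      rw [this]
      exact Finset.measurableSet_biUnion _ fun i _ =>
        measurableSet_le (by fun_prop) measurable_const
    rw [← freeGibbs_map_shift hH h4, Measure.map_apply (measurable_shift k) hm]
    refine (measure_mono ?_).trans (measure_biUnion_finset_le Λ _)
    rintro x ⟨i, hi, hiΛ', hx⟩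
    simp only [Set.mem_iUnion]
    have hij : ((i + k - k : Lat b) : E d) = i := by rw [add_sub_cancel_right]
    refine ⟨i + k, mem_translateBox.1 hi, ?_, ?_⟩
    · have h1 : r + R < ‖(i : E d)‖ := by
        by_contra h
        exact hiΛ' (hΛ' i (not_lt.1 h))
      have h2 : ‖(i : E d)‖ ≤ ‖(i : E d) + x (i + k)‖ + ‖x (i + k)‖ := by
        simpa using norm_sub_le ((i : E d) + x (i + k)) (x (i + k))
      have h3 : ‖(i : E d) + x (i + k)‖ ≤ R := hx
      simp only [Set.mem_ofPred_eq]
      linarith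
    · simp only [Set.mem_ofPred_eq, hij]
      exact hx
  -- For fixed j and x, the values of k that bring j - k + x_j into the R-ball are at most `latCount
  -- b (R + R)` in number, whatever x_j is.
  have hj : ∀ j ∈ Λ, ∑ k ∈ Λ, μ ({x | r < ‖x j‖} ∩ {x | ‖((j - k : Lat b) : E d) + x j‖ ≤ R}) ≤
      latCount b (R + R) * μ {x | r < ‖x j‖} := by
    intro j _
    have h1 : ∀ k ∈ Λ, μ ({x | r < ‖x j‖} ∩ {x | ‖((j - k : Lat b) : E d) + x j‖ ≤ R}) =
        ∫⁻ x in {x | r < ‖x j‖}, (Metric.closedBall (0 : E d) R).indicator (fun _ => (1 : ℝ≥0∞))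
          (((j - k : Lat b) : E d) + x j) ∂μ := by
      intro k _
      rw [Set.inter_comm, ← Measure.restrict_apply (hmball k j), ← lintegral_indicator_one
        (hmball k j)]
      refine lintegral_congr fun x => ?_
      by_cases hx : ‖((j - k : Lat b) : E d) + x j‖ ≤ R <;> simp only [Set.indicator,
        Set.mem_ofPred_eq, mem_closedBall_zero_iff, hx, if_true, if_false, Pi.one_apply]
    rw [Finset.sum_congr rfl h1, ← lintegral_finsetSum]
    · calc _ ≤ ∫⁻ x in {x : Field b | r < ‖x j‖}, (latCount b (R + R) : ℝ≥0∞) ∂μ := by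
            refine lintegral_mono fun x => ?_
            refine (ENNReal.sum_le_tsum _).trans ?_
            refine le_trans ?_ (tsum_indicator_le_latCount (b := b) (x j) R)
            exact ((Equiv.subLeft j).tsum_eq fun i : Lat b =>
              (Metric.closedBall (0 : E d) R).indicator (fun _ => (1 : ℝ≥0∞))
                ((i : E d) + x j)).le
        _ = _ := by rw [setLIntegral_const]
    · intro k _
      exact (measurable_const.indicator Metric.isClosed_closedBall.measurableSet).comp
        (by fun_prop)
  calc _ ≤ (Λ.card : ℝ≥0∞)⁻¹ * ∑ k ∈ Λ, ∑ j ∈ Λ,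
        μ ({x | r < ‖x j‖} ∩ {x | ‖((j - k : Lat b) : E d) + x j‖ ≤ R}) := by
        gcongr with k hk'
        exact hk k hk'
    _ ≤ (Λ.card : ℝ≥0∞)⁻¹ * ∑ j ∈ Λ, latCount b (R + R) * μ {x | r < ‖x j‖} := by
        rw [Finset.sum_comm]
        gcongr with j hj'
        exact hj j hj'
    _ = _ := by
        rw [averagedGibbs_apply hm0, ← Finset.mul_sum, mul_left_comm]
        congr 2
        refine Finset.sum_congr rfl fun j _ => ?_
        congr 1
        ext x
        simp [shift]

end

/-! ### Local weights and the finite-volume DLR equations -/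

section

variable {d : ℕ} {b : Module.Basis (Fin d) ℝ (E d)} {Δ : Finset (Lat b)}

theorem glue_of_mem (x' : {i // i ∈ Δ} → E d) (y : {i // i ∉ Δ} → E d) {i : Lat b} (h : i ∈ Δ) :
    glue Δ x' y i = x' ⟨i, h⟩ := dif_pos h

theorem glue_of_notMem (x' : {i // i ∈ Δ} → E d) (y : {i // i ∉ Δ} → E d) {i : Lat b}
    (h : i ∉ Δ) : glue Δ x' y i = y ⟨i, h⟩ := dif_neg h

theorem restrictIn_glue (x' : {i // i ∈ Δ} → E d) (y : {i // i ∉ Δ} → E d) :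
    restrictIn Δ (glue Δ x' y) = x' := by
  ext1 i
  exact glue_of_mem x' y i.2

theorem restrictOut_glue (x' : {i // i ∈ Δ} → E d) (y : {i // i ∉ Δ} → E d) :
    restrictOut Δ (glue Δ x' y) = y := by
  ext1 i
  exact glue_of_notMem x' y i.2

theorem measurable_restrictIn : Measurable (restrictIn Δ : Field b → {i // i ∈ Δ} → E d) :=
  measurable_pi_lambda _ fun i => measurable_pi_apply (i : Lat b)

theorem measurable_restrictOut : Measurable (restrictOut Δ : Field b → {i // i ∉ Δ} → E d) :=
  measurable_pi_lambda _ fun i => measurable_pi_apply (i : Lat b)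

theorem measurable_glue :
    Measurable fun p : ({i // i ∈ Δ} → E d) × ({i // i ∉ Δ} → E d) => glue Δ p.1 p.2 := by
  refine measurable_pi_lambda _ fun i => ?_
  by_cases h : i ∈ Δ
  · simp only [glue_of_mem _ _ h]
    exact (measurable_pi_apply _).comp measurable_fst
  · simp only [glue_of_notMem _ _ h]
    exact (measurable_pi_apply _).comp measurable_snd

theorem measurable_glue_left (y : {i // i ∉ Δ} → E d) :
    Measurable fun x' : {i // i ∈ Δ} → E d => glue Δ x' y :=
  measurable_glue.comp (measurable_id.prodMk measurable_const)

theorem freeField_eq_map_glue (Q : Measure (E d)) [IsProbabilityMeasure Q] :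
    ((Measure.pi fun _ : {i // i ∈ Δ} => Q).prod
      (Measure.infinitePi fun _ : {i // i ∉ Δ} => Q)).map (fun p => glue Δ p.1 p.2) =
      freeField b Q := by
  classical
  refine Measure.eq_infinitePi _ fun s t ht => ?_
  rw [Measure.map_apply measurable_glue (MeasurableSet.pi s.countable_toSet fun i _ => ht i)]
  have hpre : (fun p : ({i // i ∈ Δ} → E d) × ({i // i ∉ Δ} → E d) => glue Δ p.1 p.2) ⁻¹'
      (Set.pi s t) = (Set.univ.pi fun i : {i // i ∈ Δ} => if (i : Lat b) ∈ s then t i else Set.univ)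
        ×ˢ (Set.pi (s.subtype (· ∉ Δ)) fun i : {i // i ∉ Δ} => t i) := by
    ext p
    simp only [Set.mem_preimage, Set.mem_pi, Set.mem_prod, Set.mem_univ, true_imp_iff,
      Finset.mem_coe, Finset.mem_subtype]
    constructor
    · intro h
      refine ⟨fun i => ?_, fun i hi => ?_⟩
      · split_ifs with hi
        · have := h i hi
          rwa [glue_of_mem _ _ i.2] at this
        · trivial
      · have := h i hi
        rwa [glue_of_notMem _ _ i.2] at this
    · rintro ⟨h1, h2⟩ i hi
      by_cases hΔ : i ∈ Δ
      · rw [glue_of_mem _ _ hΔ]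
        have := h1 ⟨i, hΔ⟩
        rwa [if_pos hi] at this
      · rw [glue_of_notMem _ _ hΔ]
        exact h2 ⟨i, hΔ⟩ hi
  rw [hpre, Measure.prod_prod, Measure.pi_pi,
    Measure.infinitePi_pi (t := fun i : {i // i ∉ Δ} => t i) _ fun i _ => ht i]
  have h1 : ∏ i : {i // i ∈ Δ}, Q (if (i : Lat b) ∈ s then t i else Set.univ) =
      ∏ i ∈ s with i ∈ Δ, Q (t i) := by
    rw [Finset.prod_coe_sort Δ fun i => Q (if i ∈ s then t i else Set.univ),
      show s.filter (· ∈ Δ) = Δ.filter (· ∈ s) by ext; simp [and_comm], Finset.prod_filter]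
    refine Finset.prod_congr rfl fun i _ => ?_
    split_ifs <;> simp
  have h2 : ∏ i ∈ s.subtype (· ∉ Δ), Q (t i) = ∏ i ∈ s with i ∉ Δ, Q (t i) := by
    rw [← Finset.subtype_map (p := (· ∉ Δ)), Finset.prod_map]
    rfl
  rw [h1, h2, Finset.prod_filter_mul_prod_filter_not]

variable {H : Finset (E d) → EReal} {Q : Measure (E d)}

open scoped Classical in
/-- The energy of the points indexed by `Δ` given the other points indexed by `Λ`. -/
def increment (H : Finset (E d) → EReal) (Δ Λ : Finset (Lat b)) (x : Field b) : EReal :=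
  energyDiff (H (points Λ x)) (H (points (Λ \ Δ) x))

/-- The Boltzmann weight of the points indexed by `Δ` given the other points indexed by `Λ`. -/
def localWeight (H : Finset (E d) → EReal) (Δ Λ : Finset (Lat b)) (x : Field b) : ℝ≥0∞ :=
  EReal.exp (-increment H Δ Λ x)

/-- The Boltzmann weight of the points indexed by `Δ` given all other points. -/
def limitWeight (H : Finset (E d) → EReal) (Δ : Finset (Lat b)) (x : Field b) : ℝ≥0∞ :=
  EReal.exp (-latticeEnergy H Δ x)

theorem measurable_increment (hH : IsHamiltonian H) (Λ : Finset (Lat b)) :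
    Measurable (increment H Δ Λ : Field b → EReal) := by
  classical
  have h1 := hH.measurable_comp_points Λ
  have h2 := hH.measurable_comp_points (Λ \ Δ)
  change Measurable fun x => increment H Δ Λ x
  simp only [increment, energyDiff]
  refine Measurable.ite ((h1 (measurableSet_singleton ⊤)).inter (h2 (measurableSet_singleton ⊤)))
    measurable_const ?_
  simp only [sub_eq_add_neg]
  exact h1.add h2.neg

theorem measurable_localWeight (hH : IsHamiltonian H) (Λ : Finset (Lat b)) :
    Measurable (localWeight H Δ Λ : Field b → ℝ≥0∞) :=
  measurable_ereal_exp.comp (measurable_increment hH Λ).neg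

theorem measurable_limitWeight (hH : IsHamiltonian H) :
    Measurable (limitWeight H Δ : Field b → ℝ≥0∞) :=
  measurable_ereal_exp.comp (Measurable.limsup fun n => measurable_increment hH (box b n)).neg

-- If the outer energy is infinite, heredity makes both sides 0, so the convention ∞ - ∞ = 0 in the
-- increment does no harm; otherwise the outer energy is real and the exponents add.
open scoped Classical in
theorem boltzmann_eq_mul_localWeight (hH : IsHamiltonian H) (h3 : Hereditary H)
    (Λ : Finset (Lat b)) (x : Field b) :
    boltzmann H Λ x = boltzmann H (Λ \ Δ) x * localWeight H Δ Λ x := by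
  simp only [boltzmann, localWeight, increment, energyDiff]
  have hbot := hH.ne_bot (points (Λ \ Δ) x)
  by_cases htop : H (points (Λ \ Δ) x) = ⊤
  · rw [h3.mono (points_mono Finset.sdiff_subset x) htop, htop]
    simp
  · rw [if_neg fun h => htop h.2]
    lift H (points (Λ \ Δ) x) to ℝ using ⟨htop, hbot⟩ with c
    rw [← EReal.exp_add]
    congr 1
    induction H (points Λ x) using EReal.rec with
    | bot => simp
    | top => simp
    | coe a =>
      norm_cast
      ring

theorem points_congr {Λ : Finset (Lat b)} {x y : Field b} (h : ∀ i ∈ Λ, x i = y i) :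
    points Λ x = points Λ y :=
  Finset.image_congr fun i hi => by rw [h i hi]

open scoped Classical in
theorem points_sdiff_glue (Λ : Finset (Lat b)) (x' : {i // i ∈ Δ} → E d) (x : Field b) :
    points (Λ \ Δ) (glue Δ x' (restrictOut Δ x)) = points (Λ \ Δ) x :=
  points_congr fun _ hi => glue_of_notMem _ _ (Finset.mem_sdiff.1 hi).2

open scoped Classical in
/-- Integration against the finite-volume Gibbs measure, window first. -/
theorem lintegral_freeGibbs [IsProbabilityMeasure Q] (hH : IsHamiltonian H) (h3 : Hereditary H)
    (Λ : Finset (Lat b)) {F : Field b → ℝ≥0∞} (hF : Measurable F) :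
    ∫⁻ x, F x ∂freeGibbs H Q Λ = (freePartition H Q Λ)⁻¹ *
      ∫⁻ y, boltzmann H (Λ \ Δ) (glue Δ 0 y) *
        ∫⁻ x', localWeight H Δ Λ (glue Δ x' y) * F (glue Δ x' y)
          ∂(Measure.pi fun _ : {i // i ∈ Δ} => Q)
        ∂(Measure.infinitePi fun _ : {i // i ∉ Δ} => Q) := by
  have hb := measurable_boltzmann hH Λ
  have hw := measurable_localWeight (Δ := Δ) hH Λ
  rw [freeGibbs, lintegral_smul_measure, smul_eq_mul,
    lintegral_withDensity_eq_lintegral_mul _ hb hF]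
  congr 1
  rw [← freeField_eq_map_glue (Δ := Δ) Q, lintegral_map (hb.mul hF) measurable_glue,
    lintegral_prod_symm (fun p => (boltzmann H Λ * F) (glue Δ p.1 p.2))
      ((hb.mul hF).comp measurable_glue).aemeasurable]
  refine lintegral_congr fun y => ?_
  have hm : Measurable fun x' : {i // i ∈ Δ} → E d =>
      localWeight H Δ Λ (glue Δ x' y) * F (glue Δ x' y) :=
    (hw.mul hF).comp (measurable_glue_left y)
  rw [← lintegral_const_mul _ hm]
  refine lintegral_congr fun x' => ?_
  simp only [Pi.mul_apply]
  rw [boltzmann_eq_mul_localWeight (Δ := Δ) hH h3, mul_assoc]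
  congr 1
  -- The outer Boltzmann factor does not see the window, so the window may be filled with 0 and the
  -- factor taken out of the inner integral.
  have := points_sdiff_glue (Δ := Δ) Λ 0 (glue Δ x' y)
  rw [restrictOut_glue] at this
  simp only [boltzmann, this]

/-- The mass of the window configurations in `A` for the weight `W` and outer configuration `y`. -/
def windowMass (Q : Measure (E d)) (W : Field b → ℝ≥0∞) (A : Set ({i // i ∈ Δ} → E d))
    (y : {i // i ∉ Δ} → E d) : ℝ≥0∞ :=
  ∫⁻ x' in A, W (glue Δ x' y) ∂(Measure.pi fun _ : {i // i ∈ Δ} => Q)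

/-- The probability of `A` for the weight `W` conditioned on `T`. -/
def windowProb (Q : Measure (E d)) (W : Field b → ℝ≥0∞) (T A : Set ({i // i ∈ Δ} → E d))
    (y : {i // i ∉ Δ} → E d) : ℝ≥0∞ :=
  (windowMass Q W T y)⁻¹ * windowMass Q W (A ∩ T) y

theorem measurable_windowMass [IsProbabilityMeasure Q] {W : Field b → ℝ≥0∞} (hW : Measurable W)
    {A : Set ({i // i ∈ Δ} → E d)} (_hA : MeasurableSet A) : Measurable (windowMass Q W A) :=
  (hW.comp measurable_glue).lintegral_prod_left'

theorem measurable_windowProb [IsProbabilityMeasure Q] {W : Field b → ℝ≥0∞} (hW : Measurable W)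
    {T A : Set ({i // i ∈ Δ} → E d)} (hT : MeasurableSet T) (hA : MeasurableSet A) :
    Measurable (windowProb Q W T A) :=
  (measurable_windowMass hW hT).inv.mul (measurable_windowMass hW (hA.inter hT))

theorem windowMass_mono {W : Field b → ℝ≥0∞} {A A' : Set ({i // i ∈ Δ} → E d)} (h : A ⊆ A')
    (y : {i // i ∉ Δ} → E d) : windowMass Q W A y ≤ windowMass Q W A' y :=
  lintegral_mono_set h

theorem windowProb_le_one (W : Field b → ℝ≥0∞) (T A : Set ({i // i ∈ Δ} → E d))
    (y : {i // i ∉ Δ} → E d) : windowProb Q W T A y ≤ 1 := by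
  rw [windowProb, mul_comm, ← div_eq_mul_inv]
  exact ENNReal.div_le_of_le_mul (by
    rw [one_mul]; exact windowMass_mono Set.inter_subset_right y)

theorem windowMass_mul_windowProb {W : Field b → ℝ≥0∞} {T A : Set ({i // i ∈ Δ} → E d)}
    {y : {i // i ∉ Δ} → E d} (h : windowMass Q W T y ≠ ∞) :
    windowMass Q W T y * windowProb Q W T A y = windowMass Q W (A ∩ T) y := by
  by_cases h0 : windowMass Q W T y = 0
  · have : windowMass Q W (A ∩ T) y = 0 :=
      le_antisymm ((windowMass_mono Set.inter_subset_right y).trans h0.le) bot_le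
    rw [h0, zero_mul, this]
  · rw [windowProb, ← mul_assoc, ENNReal.mul_inv_cancel h0 h, one_mul]

/-- One factor κ comes from the numerator and one from the normalization. -/
theorem windowProb_le_of_comparable {W W' : Field b → ℝ≥0∞} {T A : Set ({i // i ∈ Δ} → E d)}
    (hT : MeasurableSet T) (hA : MeasurableSet A) {y : {i // i ∉ Δ} → E d} {κ : ℝ≥0∞}
    (hκ0 : κ ≠ 0) (hκ : κ ≠ ∞)
    (h1 : ∀ x' ∈ T, W (glue Δ x' y) ≤ κ * W' (glue Δ x' y))
    (h2 : ∀ x' ∈ T, W' (glue Δ x' y) ≤ κ * W (glue Δ x' y)) :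
    windowProb Q W T A y ≤ κ ^ 2 * windowProb Q W' T A y := by
  have e1 : windowMass Q W (A ∩ T) y ≤ κ * windowMass Q W' (A ∩ T) y := by
    rw [windowMass, windowMass, ← lintegral_const_mul' _ _ hκ]
    exact setLIntegral_mono' (hA.inter hT) fun x' hx' => h1 x' hx'.2
  have e2 : windowMass Q W' T y ≤ κ * windowMass Q W T y := by
    rw [windowMass, windowMass, ← lintegral_const_mul' _ _ hκ]
    exact setLIntegral_mono' hT fun x' hx' => h2 x' hx'
  have e3 : (windowMass Q W T y)⁻¹ ≤ κ * (windowMass Q W' T y)⁻¹ := by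
    have := ENNReal.inv_le_inv.2 e2
    rw [ENNReal.mul_inv (Or.inl hκ0) (Or.inl hκ)] at this
    calc (windowMass Q W T y)⁻¹ = κ * (κ⁻¹ * (windowMass Q W T y)⁻¹) := by
          rw [← mul_assoc, ENNReal.mul_inv_cancel hκ0 hκ, one_mul]
      _ ≤ _ := by gcongr
  calc windowProb Q W T A y
      ≤ (κ * (windowMass Q W' T y)⁻¹) * (κ * windowMass Q W' (A ∩ T) y) := mul_le_mul' e3 e1
    _ = _ := by rw [windowProb]; ring

/-- Finite-volume DLR equation for a window conditioned to lie in T: integrating over the window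
first, the mass of T cancels its inverse. One inequality suffices, since the converse will be
recovered in the limit from the complement of A. -/
theorem freeGibbs_le_windowProb [IsProbabilityMeasure Q] (hH : IsHamiltonian H) (h1 : Stable H)
    (h3 : Hereditary H) (Λ : Finset (Lat b)) {T A : Set ({i // i ∈ Δ} → E d)}
    {B : Set ({i // i ∉ Δ} → E d)} (hT : MeasurableSet T) (hA : MeasurableSet A)
    (hB : MeasurableSet B) :
    freeGibbs H Q Λ (restrictIn Δ ⁻¹' (A ∩ T) ∩ restrictOut Δ ⁻¹' B) ≤
      ∫⁻ x in restrictIn Δ ⁻¹' T ∩ restrictOut Δ ⁻¹' B,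
        windowProb Q (localWeight H Δ Λ) T A (restrictOut Δ x) ∂freeGibbs H Q Λ := by
  classical
  have hw := measurable_localWeight (Δ := Δ) hH Λ
  have hmL : MeasurableSet (restrictIn Δ ⁻¹' (A ∩ T) ∩ restrictOut Δ ⁻¹' B) :=
    (measurable_restrictIn (hA.inter hT)).inter (measurable_restrictOut hB)
  have hmR : MeasurableSet (restrictIn Δ ⁻¹' T ∩ restrictOut Δ ⁻¹' B) :=
    (measurable_restrictIn hT).inter (measurable_restrictOut hB)
  have hpm : Measurable fun x : Field b =>
      windowProb Q (localWeight H Δ Λ) T A (restrictOut Δ x) :=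
    (measurable_windowProb (Q := Q) hw hT hA).comp (measurable_restrictOut (Δ := Δ))
  rw [← lintegral_indicator_one hmL, ← lintegral_indicator hmR,
    lintegral_freeGibbs (Δ := Δ) hH h3 Λ (measurable_one.indicator hmL),
    lintegral_freeGibbs (Δ := Δ) hH h3 Λ (hpm.indicator hmR)]
  refine mul_le_mul' le_rfl (lintegral_mono fun y => ?_)
  by_cases hy : y ∈ B
  swap
  · simp [Set.indicator, restrictOut_glue, hy]
  have hwy : Measurable fun x' : {i // i ∈ Δ} → E d => localWeight H Δ Λ (glue Δ x' y) :=
    hw.comp (measurable_glue_left y)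
  have eL : ∫⁻ x', localWeight H Δ Λ (glue Δ x' y) *
      (restrictIn Δ ⁻¹' (A ∩ T) ∩ restrictOut Δ ⁻¹' B).indicator 1 (glue Δ x' y)
        ∂(Measure.pi fun _ : {i // i ∈ Δ} => Q) = windowMass Q (localWeight H Δ Λ) (A ∩ T) y := by
    rw [windowMass, ← lintegral_indicator (hA.inter hT)]
    refine lintegral_congr fun x' => ?_
    by_cases hx : x' ∈ A ∩ T
    · rw [Set.indicator_of_mem hx, Set.indicator_of_mem, Pi.one_apply, mul_one]
      exact ⟨by simpa only [Set.mem_preimage, restrictIn_glue] using hx,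
        by simpa only [Set.mem_preimage, restrictOut_glue] using hy⟩
    · rw [Set.indicator_of_notMem hx, Set.indicator_of_notMem, mul_zero]
      intro h
      exact hx (by simpa only [Set.mem_preimage, restrictIn_glue] using h.1)
  have eR : ∫⁻ x', localWeight H Δ Λ (glue Δ x' y) *
      (restrictIn Δ ⁻¹' T ∩ restrictOut Δ ⁻¹' B).indicator
        (fun x => windowProb Q (localWeight H Δ Λ) T A (restrictOut Δ x)) (glue Δ x' y)
        ∂(Measure.pi fun _ : {i // i ∈ Δ} => Q) =
      windowMass Q (localWeight H Δ Λ) T y * windowProb Q (localWeight H Δ Λ) T A y := by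
    rw [windowMass, ← lintegral_mul_const _ hwy,
      ← lintegral_indicator hT]
    refine lintegral_congr fun x' => ?_
    by_cases hx : x' ∈ T
    · rw [Set.indicator_of_mem hx, Set.indicator_of_mem, restrictOut_glue]
      exact ⟨by simpa only [Set.mem_preimage, restrictIn_glue] using hx,
        by simpa only [Set.mem_preimage, restrictOut_glue] using hy⟩
    · rw [Set.indicator_of_notMem hx, Set.indicator_of_notMem, mul_zero]
      intro h
      exact hx (by simpa only [Set.mem_preimage, restrictIn_glue] using h.1)
  rw [eL, eR]
  by_cases hβ : boltzmann H (Λ \ Δ) (glue Δ 0 y) = 0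
  · simp [hβ]
  -- The cancellation needs a finite mass. Multiplied by the outer Boltzmann factor, which is
  -- nonzero here, the mass is bounded through stability.
  have hfin : windowMass Q (localWeight H Δ Λ) T y ≠ ∞ := by
    obtain ⟨K, hK, h1⟩ := h1
    have hle : boltzmann H (Λ \ Δ) (glue Δ 0 y) * windowMass Q (localWeight H Δ Λ) T y ≤
        ENNReal.ofReal (Real.exp (K * Λ.card)) := by
      rw [windowMass, ← lintegral_const_mul _ hwy]
      calc _ ≤ ∫⁻ _ in T, ENNReal.ofReal (Real.exp (K * Λ.card))
            ∂(Measure.pi fun _ : {i // i ∈ Δ} => Q) := by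
            refine lintegral_mono fun x' => ?_
            refine le_trans (le_of_eq ?_) (boltzmann_le hK h1 Λ (glue Δ x' y))
            rw [boltzmann_eq_mul_localWeight (Δ := Δ) hH h3 Λ (glue Δ x' y)]
            congr 1
            have := points_sdiff_glue (Δ := Δ) Λ 0 (glue Δ x' y)
            rw [restrictOut_glue] at this
            simp only [boltzmann, this]
        _ ≤ _ := by
            rw [setLIntegral_const]
            exact mul_le_of_le_one_right' prob_le_one
    intro htop
    rw [htop, ENNReal.mul_top hβ] at hle
    exact ENNReal.ofReal_ne_top (top_le_iff.1 hle)
  rw [windowMass_mul_windowProb hfin]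

end

/-! ### Quasi-local interactions -/

section

variable {d : ℕ} {b : Module.Basis (Fin d) ℝ (E d)} {Δ : Finset (Lat b)}
  {H : Finset (E d) → EReal} {Q : Measure (E d)} {S : Set (E d)}

open scoped Classical in
/-- For displacements in `S`, bounded by `M` on `Δ`, indices whose points are farther than `R` from
the origin contribute at most `η` to the energy of `Δ`. -/
def IsRange (H : Finset (E d) → EReal) (S : Set (E d)) (Δ : Finset (Lat b)) (M η R : ℝ) : Prop :=
  ∀ x : Field b, (∀ i, x i ∈ S) → (∀ i ∈ Δ, ‖x i‖ ≤ M) →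
    ∀ Λ' Λ : Finset (Lat b), Δ ⊆ Λ' → Λ' ⊆ Λ → H (points (Λ \ Δ) x) ≠ ⊤ →
      (∀ i ∈ Λ, i ∉ Λ' → R < ‖(i : E d) + x i‖) →
        increment H Δ Λ x ≤ increment H Δ Λ' x + (η : EReal) ∧
          increment H Δ Λ' x ≤ increment H Δ Λ x + (η : EReal)

/-- The energy of a window depends little on indices whose points are far away, for displacements
in `S`. -/
def QuasiLocal (b : Module.Basis (Fin d) ℝ (E d)) (H : Finset (E d) → EReal) (S : Set (E d)) :
    Prop :=
  ∀ (Δ : Finset (Lat b)) (M η : ℝ), 0 < η → ∃ R : ℝ, IsRange H S Δ M η R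

theorem exp_neg_le_mul_exp_neg {u v : EReal} {η : ℝ} (h : u ≤ v + (η : EReal)) :
    EReal.exp (-v) ≤ ENNReal.ofReal (Real.exp η) * EReal.exp (-u) := by
  have hκ0 : ENNReal.ofReal (Real.exp η) ≠ 0 := by simp [Real.exp_pos]
  have h' := ENNReal.inv_le_inv.2 (EReal.exp_monotone h)
  rw [EReal.exp_add, EReal.exp_coe,
    ENNReal.mul_inv (Or.inr ENNReal.ofReal_ne_top) (Or.inr hκ0)] at h'
  rw [EReal.exp_neg, EReal.exp_neg]
  calc (EReal.exp v)⁻¹ = ENNReal.ofReal (Real.exp η) *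
        ((EReal.exp v)⁻¹ * (ENNReal.ofReal (Real.exp η))⁻¹) := by
        rw [mul_comm, mul_assoc, ENNReal.inv_mul_cancel hκ0 ENNReal.ofReal_ne_top, mul_one]
    _ ≤ _ := by gcongr

/-- Window configurations with displacements in `S` bounded by `M`. -/
def window (Δ : Finset (Lat b)) (S : Set (E d)) (M : ℝ) : Set ({i // i ∈ Δ} → E d) :=
  {x' | ∀ i, x' i ∈ S ∧ ‖x' i‖ ≤ M}

theorem measurableSet_window (hS : MeasurableSet S) (M : ℝ) : MeasurableSet (window Δ S M) := by
  have : window Δ S M = ⋂ i, {x' | x' i ∈ S} ∩ {x' | ‖x' i‖ ≤ M} := by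
    ext x'
    simp [window, forall_and]
  rw [this]
  exact MeasurableSet.iInter fun i => (measurable_pi_apply i hS).inter
    (measurableSet_le (by fun_prop) measurable_const)

/-- Unless some index of Λ \ Λ' has its point within R of the origin, the weights in Λ and in Λ'
agree up to a factor exp(η), and so do the window probabilities up to its square. -/
theorem freeGibbs_le_add_windowProb [IsProbabilityMeasure Q] (hH : IsHamiltonian H)
    (h1 : Stable H) (h3 : Hereditary H) (hS : MeasurableSet S) (hQS : Q Sᶜ = 0) {M η R : ℝ}
    (hR : IsRange H S Δ M η R)
    {Λ Λ' : Finset (Lat b)} (hΔ : Δ ⊆ Λ') (hΛ : Λ' ⊆ Λ)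
    {A : Set ({i // i ∈ Δ} → E d)} {B : Set ({i // i ∉ Δ} → E d)} (hA : MeasurableSet A)
    (hB : MeasurableSet B) :
    freeGibbs H Q Λ (restrictIn Δ ⁻¹' (A ∩ window Δ S M) ∩ restrictOut Δ ⁻¹' B) ≤
      freeGibbs H Q Λ {x | ∃ i ∈ Λ, i ∉ Λ' ∧ ‖(i : E d) + x i‖ ≤ R} +
      ENNReal.ofReal (Real.exp η) ^ 2 *
        ∫⁻ x in restrictIn Δ ⁻¹' (window Δ S M) ∩ restrictOut Δ ⁻¹' B,
          windowProb Q (localWeight H Δ Λ') (window Δ S M) A (restrictOut Δ x)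
            ∂freeGibbs H Q Λ := by
  classical
  set T := window Δ S M
  have hT : MeasurableSet T := measurableSet_window hS M
  set κ := ENNReal.ofReal (Real.exp η)
  have hκ0 : κ ≠ 0 := by simp [κ, Real.exp_pos]
  have hκ : κ ≠ ∞ := ENNReal.ofReal_ne_top
  -- The good event must concern the outer configuration alone in order to be absorbed into B. This
  -- is possible because Δ ⊆ Λ', so the indices of Λ \ Λ' are all outside Δ.
  set G : Set ({i // i ∉ Δ} → E d) := {y | (∀ i, y i ∈ S) ∧
    (∀ i : {i // i ∉ Δ}, (i : Lat b) ∈ Λ → (i : Lat b) ∉ Λ' → R < ‖((i : Lat b) : E d) + y i‖) ∧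
    H (points (Λ \ Δ) (glue Δ 0 y)) ≠ ⊤}
  have hG : MeasurableSet G := by
    have hglue : Measurable fun y : {i // i ∉ Δ} → E d => glue Δ 0 y :=
      measurable_glue.comp (measurable_const.prodMk measurable_id)
    have h3 : MeasurableSet {y : {i // i ∉ Δ} → E d | H (points (Λ \ Δ) (glue Δ 0 y)) ≠ ⊤} :=
      (((hH.measurable_comp_points (Λ \ Δ)).comp hglue) (measurableSet_singleton ⊤)).compl
    have h1 : MeasurableSet {y : {i // i ∉ Δ} → E d | ∀ i, y i ∈ S} := by
      rw [Set.ofPred_forall]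
      exact MeasurableSet.iInter fun i => measurable_pi_apply i hS
    have h2 : MeasurableSet {y : {i // i ∉ Δ} → E d | ∀ i : {i // i ∉ Δ}, (i : Lat b) ∈ Λ →
        (i : Lat b) ∉ Λ' → R < ‖((i : Lat b) : E d) + y i‖} := by
      simp only [Set.ofPred_forall]
      exact MeasurableSet.iInter fun i => MeasurableSet.iInter fun _ => MeasurableSet.iInter
        fun _ => measurableSet_lt measurable_const (by fun_prop)
    exact h1.inter (h2.inter h3)
  have hae1 : ∀ᵐ x ∂freeGibbs H Q Λ, ∀ i, x i ∈ S := by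
    rw [ae_all_iff]
    intro i
    refine Measure.ae_smul_measure ((withDensity_absolutelyContinuous _ _).ae_le ?_) _
    exact ae_freeField_mem hS hQS i
  have hae2 := freeGibbs_energy_ne_top (Q := Q) hH h3 (Finset.sdiff_subset (s := Λ) (t := Δ))
  calc freeGibbs H Q Λ (restrictIn Δ ⁻¹' (A ∩ T) ∩ restrictOut Δ ⁻¹' B)
      ≤ freeGibbs H Q Λ ({x | ∃ i ∈ Λ, i ∉ Λ' ∧ ‖(i : E d) + x i‖ ≤ R} ∪
          (restrictIn Δ ⁻¹' (A ∩ T) ∩ restrictOut Δ ⁻¹' (B ∩ G))) := by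
        refine measure_mono_ae ?_
        filter_upwards [hae1, hae2] with x hx1 hx2 hx
        by_cases hfar : ∃ i ∈ Λ, i ∉ Λ' ∧ ‖(i : E d) + x i‖ ≤ R
        · exact Or.inl hfar
        · refine Or.inr ⟨hx.1, hx.2, fun i => hx1 i, fun i hi hi' => ?_, ?_⟩
          · by_contra hle
            exact hfar ⟨i, hi, hi', not_lt.1 hle⟩
          · rwa [points_sdiff_glue]
    _ ≤ _ := (measure_union_le _ _).trans (add_le_add le_rfl ?_)
  calc freeGibbs H Q Λ (restrictIn Δ ⁻¹' (A ∩ T) ∩ restrictOut Δ ⁻¹' (B ∩ G))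
      ≤ ∫⁻ x in restrictIn Δ ⁻¹' T ∩ restrictOut Δ ⁻¹' (B ∩ G),
        windowProb Q (localWeight H Δ Λ) T A (restrictOut Δ x) ∂freeGibbs H Q Λ :=
        freeGibbs_le_windowProb hH h1 h3 Λ hT hA (hB.inter hG)
    _ ≤ ∫⁻ x in restrictIn Δ ⁻¹' T ∩ restrictOut Δ ⁻¹' (B ∩ G),
        κ ^ 2 * windowProb Q (localWeight H Δ Λ') T A (restrictOut Δ x) ∂freeGibbs H Q Λ := by
        refine setLIntegral_mono' ((measurable_restrictIn hT).inter
          (measurable_restrictOut (hB.inter hG))) fun x hx => ?_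
        obtain ⟨hxS, hxfar, hxE⟩ := hx.2.2
        have hcmp : ∀ x' ∈ T,
            increment H Δ Λ (glue Δ x' (restrictOut Δ x)) ≤
              increment H Δ Λ' (glue Δ x' (restrictOut Δ x)) + (η : EReal) ∧
            increment H Δ Λ' (glue Δ x' (restrictOut Δ x)) ≤
              increment H Δ Λ (glue Δ x' (restrictOut Δ x)) + (η : EReal) := by
          intro x' hx'
          refine hR _ (fun i => ?_) (fun i hi => ?_) Λ' Λ hΔ hΛ ?_ fun i hi hi' => ?_
          · by_cases hi : i ∈ Δ
            · rw [glue_of_mem _ _ hi]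
              exact (hx' ⟨i, hi⟩).1
            · rw [glue_of_notMem _ _ hi]
              exact hxS ⟨i, hi⟩
          · rw [glue_of_mem _ _ hi]
            exact (hx' ⟨i, hi⟩).2
          · rw [points_sdiff_glue] at hxE ⊢
            exact hxE
          · have hiΔ : i ∉ Δ := fun h => hi' (hΔ h)
            rw [glue_of_notMem _ _ hiΔ]
            exact hxfar ⟨i, hiΔ⟩ hi hi'
        exact windowProb_le_of_comparable hT hA hκ0 hκ
          (fun x' hx' => exp_neg_le_mul_exp_neg (hcmp x' hx').2)
          (fun x' hx' => exp_neg_le_mul_exp_neg (hcmp x' hx').1)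
    _ ≤ ∫⁻ x in restrictIn Δ ⁻¹' T ∩ restrictOut Δ ⁻¹' B,
        κ ^ 2 * windowProb Q (localWeight H Δ Λ') T A (restrictOut Δ x) ∂freeGibbs H Q Λ :=
        lintegral_mono_set fun x hx => ⟨hx.1, hx.2.1⟩
    _ = _ := lintegral_const_mul' _ _ (ENNReal.pow_ne_top hκ)

theorem lintegral_averagedGibbs [IsProbabilityMeasure Q] (hH : IsHamiltonian H)
    (h4 : TranslationInvariant H) (Λ : Finset (Lat b)) (f : Field b → ℝ≥0∞) :
    ∫⁻ x, f x ∂averagedGibbs H Q Λ =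
      (Λ.card : ℝ≥0∞)⁻¹ * ∑ k ∈ Λ, ∫⁻ x, f x ∂freeGibbs H Q (translateBox k Λ) := by
  rw [averagedGibbs, lintegral_smul_measure, smul_eq_mul, lintegral_finsetSum_measure]
  simp_rw [freeGibbs_map_shift hH h4]

theorem averagedGibbs_le_add_windowProb [IsProbabilityMeasure Q] (hH : IsHamiltonian H)
    (h1 : Stable H) (h3 : Hereditary H) (h4 : TranslationInvariant H) (hS : MeasurableSet S)
    (hQS : Q Sᶜ = 0) {M η r R : ℝ} (hR : IsRange H S Δ M η R) {n : ℕ}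
    [IsProbabilityMeasure (freeGibbs H Q (coordBox b n))] {Λ' : Finset (Lat b)} (hΔ : Δ ⊆ Λ')
    (hΛ' : ∀ i : Lat b, ‖(i : E d)‖ ≤ r + R → i ∈ Λ')
    {A : Set ({i // i ∈ Δ} → E d)} {B : Set ({i // i ∉ Δ} → E d)} (hA : MeasurableSet A)
    (hB : MeasurableSet B) :
    averagedGibbs H Q (coordBox b n)
        (restrictIn Δ ⁻¹' (A ∩ window Δ S M) ∩ restrictOut Δ ⁻¹' B) ≤
      badRatio Λ' n +
        latCount b (R + R) * averagedGibbs H Q (coordBox b n) {x | r < ‖x 0‖} +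
      ENNReal.ofReal (Real.exp η) ^ 2 *
        ∫⁻ x in restrictIn Δ ⁻¹' (window Δ S M) ∩ restrictOut Δ ⁻¹' B,
          windowProb Q (localWeight H Δ Λ') (window Δ S M) A (restrictOut Δ x)
            ∂averagedGibbs H Q (coordBox b n) := by
  set T := window Δ S M
  have hT : MeasurableSet T := measurableSet_window hS M
  have hmL : MeasurableSet (restrictIn Δ ⁻¹' (A ∩ T) ∩ restrictOut Δ ⁻¹' B) :=
    (measurable_restrictIn (hA.inter hT)).inter (measurable_restrictOut hB)
  have hmR : MeasurableSet (restrictIn Δ ⁻¹' T ∩ restrictOut Δ ⁻¹' B) :=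
    (measurable_restrictIn hT).inter (measurable_restrictOut hB)
  rw [averagedGibbs_apply hmL, ← lintegral_indicator hmR, lintegral_averagedGibbs hH h4,
    add_assoc]
  refine (sum_le_sum_add_badPoints Λ' n (g := fun k => freeGibbs H Q (translateBox k (coordBox b n))
        {x | ∃ i ∈ translateBox k (coordBox b n), i ∉ Λ' ∧ ‖(i : E d) + x i‖ ≤ R} +
      ENNReal.ofReal (Real.exp η) ^ 2 *
        ∫⁻ x, (restrictIn Δ ⁻¹' T ∩ restrictOut Δ ⁻¹' B).indicator
          (fun x => windowProb Q (localWeight H Δ Λ') T A (restrictOut Δ x)) x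
            ∂freeGibbs H Q (translateBox k (coordBox b n)))
    (fun k _ => prob_le_one) fun k _ hsub => ?_).trans
    (add_le_add le_rfl (le_trans (le_of_eq ?_)
      (add_le_add (sum_freeGibbs_far_le (Λ := coordBox b n) hH h4 hΛ') le_rfl)))
  · rw [← Measure.map_apply (measurable_shift k) hmL, freeGibbs_map_shift hH h4]
    refine (freeGibbs_le_add_windowProb hH h1 h3 hS hQS hR hΔ hsub hA hB).trans ?_
    rw [lintegral_indicator hmR]
  · rw [Finset.sum_add_distrib, mul_add, ← Finset.mul_sum]
    congr 1
    ring

theorem dependsOn_windowProb_localWeight {Λ' : Finset (Lat b)} {T A : Set ({i // i ∈ Δ} → E d)} :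
    DependsOn (fun x : Field b => windowProb Q (localWeight H Δ Λ') T A (restrictOut Δ x))
      (Λ' : Set (Lat b)) := by
  classical
  intro x y hxy
  have hw : ∀ x', localWeight H Δ Λ' (glue Δ x' (restrictOut Δ x)) =
      localWeight H Δ Λ' (glue Δ x' (restrictOut Δ y)) := by
    intro x'
    have hi : ∀ i ∈ Λ', glue Δ x' (restrictOut Δ x) i = glue Δ x' (restrictOut Δ y) i := by
      intro i hi
      by_cases h : i ∈ Δ
      · rw [glue_of_mem _ _ h, glue_of_mem _ _ h]
      · rw [glue_of_notMem _ _ h, glue_of_notMem _ _ h]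
        exact hxy i hi
    rw [localWeight, localWeight, increment, increment, points_congr hi,
      points_congr fun i h => hi i (Finset.mem_sdiff.1 h).1]
  simp only [windowProb, windowMass, hw]

/-- The order of the choices is what matters: R comes with η, then r from the tail of x_0 uniformly
in n, then Λ₀. With Λ' fixed, both sides involve finitely many displacements, so n → ∞ is allowed
and removes the boundary term. The set Λ₀ depends on neither A nor B. -/
theorem TendstoLocally.le_add_windowProb [IsProbabilityMeasure Q] (hH : IsHamiltonian H)
    (h1 : Stable H) (h2 : NonDegenerate b H) (h3 : Hereditary H) (h4 : TranslationInvariant H)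
    (hS : MeasurableSet S) (hQS : Q Sᶜ = 0)
    {U : Ultrafilter ℕ} {P : Measure (Field b)} [IsProbabilityMeasure P]
    [∀ n, IsProbabilityMeasure (freeGibbs H Q (coordBox b n))] (hU : (U : Filter ℕ) ≤ atTop)
    (hP : TendstoLocally (fun n => averagedGibbs H Q (coordBox b n)) U P)
    {M η R : ℝ} (hR : IsRange H S Δ M η R) {ε : ℝ} (hε : 0 < ε) :
    ∃ Λ₀ : Finset (Lat b), ∀ Λ', Λ₀ ⊆ Λ' → ∀ A : Set ({i // i ∈ Δ} → E d), MeasurableSet A →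
      ∀ B ∈ measurableCylinders fun _ : {i // i ∉ Δ} => E d,
        P (restrictIn Δ ⁻¹' (A ∩ window Δ S M) ∩ restrictOut Δ ⁻¹' B) ≤
          ENNReal.ofReal ε + ENNReal.ofReal (Real.exp η) ^ 2 *
            ∫⁻ x in restrictIn Δ ⁻¹' (window Δ S M) ∩ restrictOut Δ ⁻¹' B,
              windowProb Q (localWeight H Δ Λ') (window Δ S M) A (restrictOut Δ x) ∂P := by
  classical
  have hav : ∀ n, IsProbabilityMeasure (averagedGibbs H Q (coordBox b n)) := fun n =>
    isProbabilityMeasure_averagedGibbs (coordBox_nonempty n)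
  -- Uniform absolute continuity at the site 0 bounds the tails of x_0 for all n at once; c exceeds
  -- the lattice count by 1 to be positive.
  obtain ⟨r, hr⟩ : ∃ r : ℝ, ∀ n,
      latCount b (R + R) * averagedGibbs H Q (coordBox b n) {x | r < ‖x 0‖} ≤
        ENNReal.ofReal ε := by
    set c : ℝ := latCount b (R + R) + 1
    have hc : 0 < c := by positivity
    obtain ⟨δ, hδ, hac⟩ := averagedGibbs_uniform_absolutelyContinuous (Q := Q) h1 h2 h4 {0}
      (div_pos hε hc)
    set A : ℕ → Set (({0} : Finset (Lat b)) → E d) := fun m => {y | (m : ℝ) < ‖y ⟨0, by simp⟩‖}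
    have hAm : ∀ m, MeasurableSet (A m) := fun m =>
      measurableSet_lt measurable_const (by fun_prop)
    have hprob : IsProbabilityMeasure ((freeField b Q).map (Finset.restrict {0})) :=
      Measure.isProbabilityMeasure_map (Finset.measurable_restrict _).aemeasurable
    have hlim : Tendsto (fun m => ((freeField b Q).map (Finset.restrict {0})).real (A m)) atTop
        (𝓝 0) := by
      have hanti : Antitone A := fun m m' hmm y hy =>
        lt_of_le_of_lt (Nat.cast_le.2 hmm : (m : ℝ) ≤ m') hy
      have hempty : ⋂ m, A m = ∅ := by
        ext y
        simp only [Set.mem_iInter, Set.mem_empty_iff_false, iff_false, not_forall]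
        obtain ⟨m, hm⟩ := exists_nat_ge ‖y ⟨0, by simp⟩‖
        exact ⟨m, not_lt.2 hm⟩
      have := tendsto_measure_iInter_atTop (μ := (freeField b Q).map (Finset.restrict {0}))
        (fun m => (hAm m).nullMeasurableSet) hanti ⟨0, measure_ne_top _ _⟩
      rw [hempty, measure_empty] at this
      simpa [measureReal_def, Function.comp_def] using
        (ENNReal.tendsto_toReal ENNReal.zero_ne_top).comp this
    obtain ⟨m, hm⟩ := (hlim.eventually (ge_mem_nhds hδ)).exists
    refine ⟨m, fun n => ?_⟩
    have h := hac (A m) (hAm m) hm (coordBox b n) (coordBox_nonempty n)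
    have h' : averagedGibbs H Q (coordBox b n) {x | (m : ℝ) < ‖x 0‖} ≤
        ENNReal.ofReal (ε / c) := by
      rw [← ENNReal.ofReal_toReal (measure_ne_top (averagedGibbs H Q (coordBox b n)) _)]
      exact ENNReal.ofReal_le_ofReal h
    calc _ ≤ ENNReal.ofReal c * ENNReal.ofReal (ε / c) := by
          refine mul_le_mul' ?_ h'
          rw [← ENNReal.ofReal_natCast]
          exact ENNReal.ofReal_le_ofReal (by simp [c])
      _ = _ := by
          rw [← ENNReal.ofReal_mul hc.le, mul_div_cancel₀ _ hc.ne']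
  refine ⟨Δ ∪ (finite_lat_norm_le (b := b) (r + R)).toFinset, fun Λ' hΛ₀ A hA B hB => ?_⟩
  set T := window Δ S M
  have hT : MeasurableSet T := measurableSet_window hS M
  obtain ⟨I, C, hC, rfl⟩ := (mem_measurableCylinders _).1 hB
  have hBm : MeasurableSet (cylinder I C : Set ({i // i ∉ Δ} → E d)) :=
    MeasurableSet.cylinder I hC
  have hmL : MeasurableSet (restrictIn Δ ⁻¹' (A ∩ T) ∩ restrictOut Δ ⁻¹' cylinder I C) :=
    (measurable_restrictIn (hA.inter hT)).inter (measurable_restrictOut hBm)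
  have hmR : MeasurableSet (restrictIn Δ ⁻¹' T ∩ restrictOut Δ ⁻¹' cylinder I C) :=
    (measurable_restrictIn hT).inter (measurable_restrictOut hBm)
  set J : Finset (Lat b) := I.map (Function.Embedding.subtype _)
  have hdep : ∀ (A : Set ({i // i ∈ Δ} → E d)) (x y : Field b),
      (∀ i ∈ ((Λ' ∪ J : Finset (Lat b)) : Set (Lat b)), x i = y i) →
        (x ∈ restrictIn Δ ⁻¹' A ∩ restrictOut Δ ⁻¹' cylinder I C ↔
          y ∈ restrictIn Δ ⁻¹' A ∩ restrictOut Δ ⁻¹' cylinder I C) := by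
    intro A x y hxy
    have e1 : restrictIn Δ x = restrictIn Δ y := by
      ext1 i
      exact hxy i (by simp [hΛ₀ (Finset.mem_union_left _ i.2)])
    have e2 : I.restrict (restrictOut Δ x) = I.restrict (restrictOut Δ y) := by
      ext1 i
      refine hxy i.1.1 ?_
      simp only [Finset.coe_union, Set.mem_union, Finset.mem_coe]
      exact Or.inr (Finset.mem_map.2 ⟨i.1, i.2, rfl⟩)
    simp only [Set.mem_inter_iff, Set.mem_preimage, mem_cylinder, e1, e2]
  have hlimL := hP.measure (Γ := Λ' ∪ J) hmL fun x y hxy => propext (hdep _ x y hxy)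
  have hwm : Measurable fun x : Field b =>
      windowProb Q (localWeight H Δ Λ') T A (restrictOut Δ x) :=
    (measurable_windowProb (measurable_localWeight hH Λ') hT hA).comp measurable_restrictOut
  have hlimR := hP.lintegral (hwm.indicator hmR) (fun x => ?_) (Γ := Λ' ∪ J) ?_
  rotate_left
  · exact Set.indicator_le' (fun x _ => windowProb_le_one _ _ _ _) (fun _ _ => bot_le) x
  · intro x y hxy
    have e := dependsOn_windowProb_localWeight (Δ := Δ) (H := H) (Q := Q) (Λ' := Λ') (T := T)
      (A := A) fun i hi => hxy i (by simp only [Finset.coe_union]; exact Or.inl hi)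
    by_cases hx : x ∈ restrictIn Δ ⁻¹' T ∩ restrictOut Δ ⁻¹' cylinder I C
    · rw [Set.indicator_of_mem hx, Set.indicator_of_mem ((hdep T x y hxy).1 hx)]
      exact e
    · rw [Set.indicator_of_notMem hx,
        Set.indicator_of_notMem fun h => hx ((hdep T x y hxy).2 h)]
  rw [← lintegral_indicator hmR]
  have hlim := (((tendsto_badRatio Λ').mono_left hU).add_const (ENNReal.ofReal ε)).add
    (ENNReal.Tendsto.const_mul hlimR
      (Or.inr (ENNReal.pow_ne_top (ENNReal.ofReal_ne_top (r := Real.exp η)) (n := 2))))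
  rw [zero_add] at hlim
  refine le_of_tendsto_of_tendsto hlimL hlim (Eventually.of_forall fun n => ?_)
  refine (averagedGibbs_le_add_windowProb (n := n) hH h1 h3 h4 hS hQS hR
    (fun i hi => hΛ₀ (Finset.mem_union_left _ hi))
    (fun i hi => hΛ₀ (Finset.mem_union_right _ (by simpa using hi))) hA hBm).trans ?_
  beta_reduce
  rw [lintegral_indicator hmR]
  exact add_le_add (add_le_add le_rfl (hr n)) le_rfl

end

/-! ### Convergence of the local energies -/

section

variable {d : ℕ} {b : Module.Basis (Fin d) ℝ (E d)} {Δ : Finset (Lat b)}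
  {H : Finset (E d) → EReal} {Q : Measure (E d)} {S : Set (E d)}

theorem mem_box {n : ℕ} {i : Lat b} : i ∈ box b n ↔ ∀ k, |(i : E d) k| ≤ n := by
  simp [box, cube]

theorem box_mono {m n : ℕ} (h : m ≤ n) : box b m ⊆ box b n := fun _ hi =>
  mem_box.2 fun k => (mem_box.1 hi k).trans (Nat.cast_le.2 h)

theorem eventually_subset_box (Γ : Finset (Lat b)) : ∀ᶠ n in atTop, Γ ⊆ box b n := by
  have : ∀ i ∈ Γ, ∀ᶠ n in atTop, i ∈ box b n := by
    intro i _
    have : ∀ k, ∀ᶠ n : ℕ in atTop, |(i : E d) k| ≤ n := fun k =>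
      tendsto_natCast_atTop_atTop.eventually (eventually_ge_atTop _)
    filter_upwards [eventually_all.2 this] with n hn
    exact mem_box.2 hn
  exact (eventually_all_finset Γ).2 this

theorem IsRange.increment_box {M η R : ℝ} (hR : IsRange H S Δ M η R) {x : Field b}
    (hS : ∀ i, x i ∈ S) (hM : ∀ i ∈ Δ, ‖x i‖ ≤ M)
    (hx : ∀ n, H (points (box b n \ Δ) x) ≠ ⊤) {m : ℕ} (hm : Δ ⊆ box b m)
    (hfar : ∀ i, i ∉ box b m → R < ‖(i : E d) + x i‖) {n : ℕ} (hn : m ≤ n) :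
    energyIncrement H Δ x n ≤ energyIncrement H Δ x m + (η : EReal) ∧
      energyIncrement H Δ x m ≤ energyIncrement H Δ x n + (η : EReal) := by
  classical
  exact hR x hS hM _ _ hm (box_mono hn) (by convert hx n) fun i _ hi => hfar i hi

theorem limsup_le_add_of_eventually {u : ℕ → EReal} {a : EReal} {η : ℝ}
    (h1 : ∀ᶠ n in atTop, u n ≤ a + (η : EReal)) : limsup u atTop ≤ a + (η : EReal) :=
  limsup_le_of_le (h := h1)

theorem le_liminf_add_of_eventually {u : ℕ → EReal} {a : EReal} {η : ℝ}
    (h1 : ∀ᶠ n in atTop, a ≤ u n + (η : EReal)) : a ≤ liminf u atTop + (η : EReal) := by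
  rw [← EReal.sub_le_iff_le_add (by simp) (by simp)]
  refine le_liminf_of_le (h := h1.mono fun n hn => ?_)
  rwa [EReal.sub_le_iff_le_add (by simp) (by simp)]

theorem IsRange.latticeEnergy_le {M η R : ℝ} (hR : IsRange H S Δ M η R) {x : Field b}
    (hS : ∀ i, x i ∈ S) (hM : ∀ i ∈ Δ, ‖x i‖ ≤ M)
    (hx : ∀ n, H (points (box b n \ Δ) x) ≠ ⊤) {m : ℕ} (hm : Δ ⊆ box b m)
    (hfar : ∀ i, i ∉ box b m → R < ‖(i : E d) + x i‖) :
    latticeEnergy H Δ x ≤ energyIncrement H Δ x m + (η : EReal) ∧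
      energyIncrement H Δ x m ≤ liminf (energyIncrement H Δ x) atTop + (η : EReal) := by
  have h := fun n (hn : m ≤ n) => hR.increment_box hS hM hx hm hfar hn
  exact ⟨limsup_le_add_of_eventually ((eventually_ge_atTop m).mono fun n hn => (h n hn).1),
    le_liminf_add_of_eventually ((eventually_ge_atTop m).mono fun n hn => (h n hn).2)⟩

theorem ereal_le_of_forall_pos_le_add {a c : EReal}
    (h : ∀ η : ℝ, 0 < η → a ≤ c + (η : EReal)) : a ≤ c := by
  induction c using EReal.rec with
  | bot => simpa using h 1 one_pos
  | top => exact le_top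
  | coe c =>
    refine EReal.le_of_forall_lt_iff_le.1 fun z hz => ?_
    have := h (z - c) (sub_pos.2 (EReal.coe_lt_coe_iff.1 hz))
    rwa [← EReal.coe_add, add_sub_cancel] at this

/-- The indices whose points lie in a given ball belong to some box. -/
def IsTight (Δ : Finset (Lat b)) (y : {i // i ∉ Δ} → E d) : Prop :=
  ∀ R : ℕ, ∃ m : ℕ, ∀ i : {i // i ∉ Δ}, (i : Lat b) ∉ box b m →
    (R : ℝ) < ‖((i : Lat b) : E d) + y i‖

theorem measurableSet_isTight : MeasurableSet {y : {i // i ∉ Δ} → E d | IsTight Δ y} := by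
  simp only [IsTight, Set.ofPred_forall, Set.ofPred_exists]
  exact MeasurableSet.iInter fun R => MeasurableSet.iUnion fun m => MeasurableSet.iInter fun i =>
    MeasurableSet.iInter fun _ => measurableSet_lt measurable_const (by fun_prop)

theorem IsSparse.isTight {x : Field b} (hx : IsSparse x) : IsTight Δ (restrictOut Δ x) := by
  intro R
  obtain ⟨m, hm⟩ := (eventually_subset_box (hx R).toFinset).exists
  refine ⟨m, fun i hi => ?_⟩
  by_contra hle
  exact hi (hm (by simpa [restrictOut] using hle))

theorem IsTight.eventually_far {y : {i // i ∉ Δ} → E d} (hy : IsTight Δ y) (R : ℝ) :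
    ∀ᶠ m in atTop, Δ ⊆ box b m ∧ ∀ x' : {i // i ∈ Δ} → E d,
      ∀ i, i ∉ box b m → R < ‖(i : E d) + glue Δ x' y i‖ := by
  obtain ⟨N, hN⟩ := exists_nat_ge R
  obtain ⟨m₀, hm₀⟩ := hy N
  filter_upwards [eventually_subset_box Δ, eventually_ge_atTop m₀] with m hm hmm
  refine ⟨hm, fun x' i hi => ?_⟩
  have hiΔ : i ∉ Δ := fun h => hi (hm h)
  rw [glue_of_notMem _ _ hiΔ]
  exact hN.trans_lt (hm₀ ⟨i, hiΔ⟩ fun h => hi (box_mono hmm h))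

/-- Under quasi-locality the local energy exists as a limit. -/
theorem QuasiLocal.exists_tendsto (hq : QuasiLocal b H S) (h3 : Hereditary H)
    {y : {i // i ∉ Δ} → E d} (hyS : ∀ i, y i ∈ S) (hy : IsTight Δ y) {x' : {i // i ∈ Δ} → E d}
    (hx' : ∀ i, x' i ∈ S) :
    ∃ h : EReal, Tendsto (energyIncrement H Δ (glue Δ x' y)) atTop (𝓝 h) := by
  classical
  set x := glue Δ x' y with hxdef
  by_cases htop : ∃ n, H (points (box b n \ Δ) x) = ⊤
  · obtain ⟨n, hn⟩ := htop
    -- Once the outer energy is infinite it stays so in larger boxes, and the convention ∞ - ∞ = 0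
    -- makes the increments eventually 0.
    refine ⟨0, tendsto_const_nhds.congr' ?_⟩
    filter_upwards [eventually_ge_atTop n] with m hm
    have e1 : H (points (box b m \ Δ) x) = ⊤ :=
      h3.mono (points_mono (Finset.sdiff_subset_sdiff (box_mono hm) le_rfl) x) hn
    have e2 : H (points (box b m) x) = ⊤ := h3.mono (points_mono Finset.sdiff_subset x) e1
    rw [energyIncrement, energyDiff, if_pos ⟨e2, by convert e1⟩]
  · push Not at htop
    refine ⟨latticeEnergy H Δ x, tendsto_of_le_liminf_of_limsup_le ?_ le_rfl⟩
    have hxS : ∀ i, x i ∈ S := by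
      intro i
      by_cases hi : i ∈ Δ
      · rw [hxdef, glue_of_mem _ _ hi]; exact hx' _
      · rw [hxdef, glue_of_notMem _ _ hi]; exact hyS _
    obtain ⟨M, hM⟩ : ∃ M : ℝ, ∀ i ∈ Δ, ‖x i‖ ≤ M :=
      ⟨∑ i ∈ Δ, ‖x i‖, fun i hi =>
        Finset.single_le_sum (f := fun i => ‖x i‖) (fun _ _ => norm_nonneg _) hi⟩
    refine ereal_le_of_forall_pos_le_add fun η hη => ?_
    obtain ⟨R, hR⟩ := hq Δ M (η / 2) (half_pos hη)
    obtain ⟨m, hm, hfar⟩ := (hy.eventually_far R).exists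
    obtain ⟨h1, h2⟩ := hR.latticeEnergy_le hxS hM htop hm (hfar x')
    refine h1.trans ((add_le_add h2 le_rfl).trans ?_)
    rw [add_assoc, ← EReal.coe_add, add_halves]

/-- For a sparse field, a large enough box contains every index whose point lies within R of the
origin; the weight of that box and the limit weight are then comparable on the whole truncated
window. -/
theorem IsRange.windowProb_le {M η R : ℝ} (hR : IsRange H S Δ M η R) (hS : MeasurableSet S)
    {x : Field b} (hxS : ∀ i, x i ∈ S) (hx : IsSparse x)
    (hE : ∀ Γ : Finset (Lat b), H (points Γ x) ≠ ⊤) {A : Set ({i // i ∈ Δ} → E d)}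
    (hA : MeasurableSet A) :
    ∀ᶠ m in atTop,
      windowProb Q (localWeight H Δ (box b m)) (window Δ S M) A (restrictOut Δ x) ≤
        ENNReal.ofReal (Real.exp η) ^ 2 *
          windowProb Q (limitWeight H Δ) (window Δ S M) A (restrictOut Δ x) := by
  classical
  filter_upwards [(hx.isTight (Δ := Δ)).eventually_far R] with m hm
  have key : ∀ x' ∈ window Δ S M,
      latticeEnergy H Δ (glue Δ x' (restrictOut Δ x)) ≤
        increment H Δ (box b m) (glue Δ x' (restrictOut Δ x)) + (η : EReal) ∧
      increment H Δ (box b m) (glue Δ x' (restrictOut Δ x)) ≤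
        latticeEnergy H Δ (glue Δ x' (restrictOut Δ x)) + (η : EReal) := by
    intro x' hx'
    have := hR.latticeEnergy_le (x := glue Δ x' (restrictOut Δ x)) (fun i => ?_) (fun i hi => ?_)
      (fun n => ?_) hm.1 (hm.2 x')
    · exact ⟨this.1, this.2.trans (add_le_add liminf_le_limsup le_rfl)⟩
    · by_cases hi : i ∈ Δ
      · rw [glue_of_mem _ _ hi]
        exact (hx' ⟨i, hi⟩).1
      · rw [glue_of_notMem _ _ hi]
        exact hxS i
    · rw [glue_of_mem _ _ hi]
      exact (hx' ⟨i, hi⟩).2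
    · rw [points_sdiff_glue]
      exact hE _
  exact windowProb_le_of_comparable (measurableSet_window hS M) hA (by simp [Real.exp_pos])
    ENNReal.ofReal_ne_top (fun x' hx' => exp_neg_le_mul_exp_neg (key x' hx').1)
    fun x' hx' => exp_neg_le_mul_exp_neg (key x' hx').2

end

/-! ### The DLR equations for local limits -/

section

variable {d : ℕ} {b : Module.Basis (Fin d) ℝ (E d)} {Δ : Finset (Lat b)}
  {H : Finset (E d) → EReal} {Q : Measure (E d)} {S : Set (E d)}

/-- Replacing the box by Λ' cost exp(η)², and replacing Λ' by the whole lattice costs the same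
again; ε and then η are sent to 0. -/
theorem TendstoLocally.le_windowProb [IsProbabilityMeasure Q] (hH : IsHamiltonian H)
    (h1 : Stable H) (h2 : NonDegenerate b H) (h3 : Hereditary H) (h4 : TranslationInvariant H)
    (hS : MeasurableSet S) (hQS : Q Sᶜ = 0) (hq : QuasiLocal b H S)
    {U : Ultrafilter ℕ} {P : Measure (Field b)} [IsProbabilityMeasure P]
    [∀ n, IsProbabilityMeasure (freeGibbs H Q (coordBox b n))] (hU : (U : Filter ℕ) ≤ atTop)
    (hP : TendstoLocally (fun n => averagedGibbs H Q (coordBox b n)) U P) (M : ℝ)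
    {A : Set ({i // i ∈ Δ} → E d)} (hA : MeasurableSet A) {B : Set ({i // i ∉ Δ} → E d)}
    (hB : B ∈ measurableCylinders fun _ : {i // i ∉ Δ} => E d) :
    P (restrictIn Δ ⁻¹' (A ∩ window Δ S M) ∩ restrictOut Δ ⁻¹' B) ≤
      ∫⁻ x in restrictIn Δ ⁻¹' (window Δ S M) ∩ restrictOut Δ ⁻¹' B,
        windowProb Q (limitWeight H Δ) (window Δ S M) A (restrictOut Δ x) ∂P := by
  set T := window Δ S M
  have hT : MeasurableSet T := measurableSet_window hS M
  set D : Set (Field b) := restrictIn Δ ⁻¹' T ∩ restrictOut Δ ⁻¹' B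
  set I := ∫⁻ x in D, windowProb Q (limitWeight H Δ) T A (restrictOut Δ x) ∂P
  have hsparse := ae_isSparse (hP.map_shift hU)
  have hmemS := hP.ae_mem hS hQS
  have hE := hP.ae_energy_ne_top hH h3 h4 hU
  have hη : ∀ η : ℝ, 0 < η → P (restrictIn Δ ⁻¹' (A ∩ T) ∩ restrictOut Δ ⁻¹' B) ≤
      ENNReal.ofReal (Real.exp η) ^ 4 * I := by
    intro η hη
    set κ := ENNReal.ofReal (Real.exp η)
    have hκ : κ ^ 2 ≠ ∞ := ENNReal.pow_ne_top ENNReal.ofReal_ne_top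
    obtain ⟨R, hR⟩ := hq Δ M η hη
    set F : ℕ → Field b → ℝ≥0∞ := fun m x =>
      windowProb Q (localWeight H Δ (box b m)) T A (restrictOut Δ x)
    -- Reverse Fatou lemma, with the constant 1 as dominating function.
    have hlimsup : limsup (fun m => ∫⁻ x in D, F m x ∂P) atTop ≤ κ ^ 2 * I := by
      refine (limsup_lintegral_le (fun _ => 1) (fun m => ?_)
        (fun m => Eventually.of_forall fun x => windowProb_le_one _ _ _ _) (by simp)).trans ?_
      · exact (measurable_windowProb (measurable_localWeight hH _) hT hA).comp
          measurable_restrictOut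
      · rw [← lintegral_const_mul' _ _ hκ]
        refine lintegral_mono_ae (ae_restrict_of_ae ?_)
        filter_upwards [hsparse, hmemS, hE] with x hx hxS hxE
        exact limsup_le_of_le (h := hR.windowProb_le hS hxS hx hxE hA)
    refine ENNReal.le_of_forall_pos_le_add fun ε hε _ => ?_
    obtain ⟨Λ₀, hΛ₀⟩ := hP.le_add_windowProb hH h1 h2 h3 h4 hS hQS hU hR
      (NNReal.coe_pos.2 hε)
    have hev : ∀ᶠ m in atTop, P (restrictIn Δ ⁻¹' (A ∩ T) ∩ restrictOut Δ ⁻¹' B) ≤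
        ε + κ ^ 2 * ∫⁻ x in D, F m x ∂P := by
      filter_upwards [eventually_subset_box Λ₀] with m hm
      simpa using hΛ₀ _ hm A hA B hB
    -- The bound in `hev` holds for all large m, so it suffices that the integral is below a for one
    -- of them; a then decreases to κ² I.
    have hinf : ∀ a, κ ^ 2 * I < a → P (restrictIn Δ ⁻¹' (A ∩ T) ∩ restrictOut Δ ⁻¹' B) ≤
        ε + κ ^ 2 * a := by
      intro a ha
      obtain ⟨m, hm1, hm2⟩ :=
        (hev.and (eventually_lt_of_limsup_lt (hlimsup.trans_lt ha))).exists
      exact hm1.trans (by gcongr)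
    have hlim : Tendsto (fun a : ℝ≥0∞ => (ε : ℝ≥0∞) + κ ^ 2 * a) (𝓝[>] (κ ^ 2 * I))
        (𝓝 (ε + κ ^ 2 * (κ ^ 2 * I))) :=
      ((ENNReal.Tendsto.const_mul tendsto_id (Or.inr hκ)).const_add _).mono_left
        nhdsWithin_le_nhds
    have hIle : I ≤ 1 := by
      calc I ≤ ∫⁻ _ in D, 1 ∂P := lintegral_mono fun x => windowProb_le_one _ _ _ _
        _ ≤ 1 := by simpa using prob_le_one
    have hne : (𝓝[>] (κ ^ 2 * I)).NeBot := by
      refine nhdsGT_neBot_of_exists_gt ⟨∞, ?_⟩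
      exact (ENNReal.mul_ne_top hκ (ne_top_of_le_ne_top ENNReal.one_ne_top hIle)).lt_top
    refine (ge_of_tendsto hlim (eventually_nhdsWithin_of_forall hinf)).trans (le_of_eq ?_)
    ring
  have hlim : Tendsto (fun η : ℝ => ENNReal.ofReal (Real.exp η) ^ 4 * I) (𝓝[>] 0) (𝓝 I) := by
    have h : Tendsto (fun η : ℝ => ENNReal.ofReal (Real.exp η ^ 4)) (𝓝 0)
        (𝓝 (ENNReal.ofReal (Real.exp 0 ^ 4))) :=
      (ENNReal.continuous_ofReal.comp (Real.continuous_exp.pow 4)).tendsto 0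
    have := (ENNReal.Tendsto.mul_const (b := I) h (Or.inl (by simp))).mono_left
      (nhdsWithin_le_nhds (s := Set.Ioi 0))
    simpa [ENNReal.ofReal_pow (Real.exp_nonneg _)] using this
  exact ge_of_tendsto hlim (eventually_nhdsWithin_of_forall hη)

theorem windowProb_add_compl_le_one (W : Field b → ℝ≥0∞) (T : Set ({i // i ∈ Δ} → E d))
    {A : Set ({i // i ∈ Δ} → E d)} (hA : MeasurableSet A) (y : {i // i ∉ Δ} → E d) :
    windowProb Q W T A y + windowProb Q W T Aᶜ y ≤ 1 := by
  have : windowMass Q W (A ∩ T) y + windowMass Q W (Aᶜ ∩ T) y = windowMass Q W T y := by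
    simp only [windowMass]
    rw [← lintegral_inter_add_sdiff (μ := Measure.pi fun _ : {i // i ∈ Δ} => Q) _ T hA,
      Set.inter_comm A T, Set.sdiff_eq, Set.inter_comm Aᶜ T]
  rw [windowProb, windowProb, ← mul_add, this, mul_comm]
  exact ENNReal.mul_inv_le_one _

/-- The left sides for A and its complement add up to the mass of the conditioning event and the
right sides to at most that, so neither inequality can be strict. Cylinders B generate the
σ-algebra, which gives all measurable B. -/
theorem TendstoLocally.eq_windowProb [IsProbabilityMeasure Q] (hH : IsHamiltonian H)
    (h1 : Stable H) (h2 : NonDegenerate b H) (h3 : Hereditary H) (h4 : TranslationInvariant H)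
    (hS : MeasurableSet S) (hQS : Q Sᶜ = 0) (hq : QuasiLocal b H S)
    {U : Ultrafilter ℕ} {P : Measure (Field b)} [IsProbabilityMeasure P]
    [∀ n, IsProbabilityMeasure (freeGibbs H Q (coordBox b n))] (hU : (U : Filter ℕ) ≤ atTop)
    (hP : TendstoLocally (fun n => averagedGibbs H Q (coordBox b n)) U P) (M : ℝ)
    {A : Set ({i // i ∈ Δ} → E d)} (hA : MeasurableSet A) {B : Set ({i // i ∉ Δ} → E d)}
    (hB : MeasurableSet B) :
    P (restrictIn Δ ⁻¹' (A ∩ window Δ S M) ∩ restrictOut Δ ⁻¹' B) =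
      ∫⁻ x in restrictIn Δ ⁻¹' (window Δ S M) ∩ restrictOut Δ ⁻¹' B,
        windowProb Q (limitWeight H Δ) (window Δ S M) A (restrictOut Δ x) ∂P := by
  set T := window Δ S M
  have hT : MeasurableSet T := measurableSet_window hS M
  have hmw : ∀ A, MeasurableSet A → Measurable fun x : Field b =>
      windowProb Q (limitWeight H Δ) T A (restrictOut Δ x) := fun A hA =>
    (measurable_windowProb (measurable_limitWeight hH) hT hA).comp measurable_restrictOut
  have hcyl : ∀ B ∈ measurableCylinders fun _ : {i // i ∉ Δ} => E d,
      P (restrictIn Δ ⁻¹' (A ∩ T) ∩ restrictOut Δ ⁻¹' B) =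
      ∫⁻ x in restrictIn Δ ⁻¹' T ∩ restrictOut Δ ⁻¹' B,
        windowProb Q (limitWeight H Δ) T A (restrictOut Δ x) ∂P := by
    intro B hB
    have hBm : MeasurableSet B := MeasurableSet.of_mem_measurableCylinders hB
    have e1 := hP.le_windowProb hH h1 h2 h3 h4 hS hQS hq hU M hA hB
    have e2 := hP.le_windowProb hH h1 h2 h3 h4 hS hQS hq hU M hA.compl hB
    refine le_antisymm e1 ?_
    have hsum : P (restrictIn Δ ⁻¹' (A ∩ T) ∩ restrictOut Δ ⁻¹' B) +
        P (restrictIn Δ ⁻¹' (Aᶜ ∩ T) ∩ restrictOut Δ ⁻¹' B) =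
        P (restrictIn Δ ⁻¹' T ∩ restrictOut Δ ⁻¹' B) := by
      rw [← measure_inter_add_sdiff (restrictIn Δ ⁻¹' T ∩ restrictOut Δ ⁻¹' B)
        (measurable_restrictIn hA : MeasurableSet (restrictIn Δ ⁻¹' A : Set (Field b)))]
      congr 2 <;> ext x <;> simp <;> tauto
    have hle : (∫⁻ x in restrictIn Δ ⁻¹' T ∩ restrictOut Δ ⁻¹' B,
          windowProb Q (limitWeight H Δ) T A (restrictOut Δ x) ∂P) +
        P (restrictIn Δ ⁻¹' (Aᶜ ∩ T) ∩ restrictOut Δ ⁻¹' B) ≤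
        P (restrictIn Δ ⁻¹' (A ∩ T) ∩ restrictOut Δ ⁻¹' B) +
        P (restrictIn Δ ⁻¹' (Aᶜ ∩ T) ∩ restrictOut Δ ⁻¹' B) := by
      rw [hsum]
      refine (add_le_add le_rfl e2).trans ?_
      rw [← lintegral_add_left (hmw A hA)]
      refine (lintegral_mono fun x => windowProb_add_compl_le_one _ T hA _).trans (le_of_eq ?_)
      simp
    exact (ENNReal.add_le_add_iff_right (measure_ne_top _ _)).1 hle
  set μ₁ : Measure ({i // i ∉ Δ} → E d) := (P.restrict (restrictIn Δ ⁻¹' (A ∩ T))).map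
    (restrictOut Δ)
  set μ₂ : Measure ({i // i ∉ Δ} → E d) := ((P.restrict (restrictIn Δ ⁻¹' T)).withDensity
    fun x => windowProb Q (limitWeight H Δ) T A (restrictOut Δ x)).map (restrictOut Δ)
  have a1 : ∀ B, MeasurableSet B → μ₁ B = P (restrictIn Δ ⁻¹' (A ∩ T) ∩ restrictOut Δ ⁻¹' B) := by
    intro B hB
    rw [Measure.map_apply measurable_restrictOut hB,
      Measure.restrict_apply (measurable_restrictOut hB), Set.inter_comm]
  have a2 : ∀ B, MeasurableSet B → μ₂ B = ∫⁻ x in restrictIn Δ ⁻¹' T ∩ restrictOut Δ ⁻¹' B,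
      windowProb Q (limitWeight H Δ) T A (restrictOut Δ x) ∂P := by
    intro B hB
    rw [Measure.map_apply measurable_restrictOut hB,
      withDensity_apply _ (measurable_restrictOut hB),
      Measure.restrict_restrict (measurable_restrictOut hB), Set.inter_comm]
  have : μ₁ = μ₂ := measure_ext_of_cylinders fun B hB => by
    have hBm : MeasurableSet B := MeasurableSet.of_mem_measurableCylinders hB
    rw [a1 B hBm, a2 B hBm, hcyl B hB]
  rw [← a1 B hB, ← a2 B hB, this]

theorem ae_pi_mem [IsProbabilityMeasure Q] (hQS : Q Sᶜ = 0) :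
    ∀ᵐ x' ∂(Measure.pi fun _ : {i // i ∈ Δ} => Q), ∀ i, x' i ∈ S := by
  rw [ae_all_iff]
  intro i
  exact (measurePreserving_eval (fun _ : {i // i ∈ Δ} => Q) i).quasiMeasurePreserving.ae
    (p := (· ∈ S)) (by rwa [ae_iff])

theorem window_mono {M N : ℝ} (h : M ≤ N) : window Δ S M ⊆ window Δ S N :=
  fun _ hx i => ⟨(hx i).1, (hx i).2.trans h⟩

theorem mem_iUnion_window {x' : {i // i ∈ Δ} → E d} (hx' : ∀ i, x' i ∈ S) :
    ∃ M : ℕ, x' ∈ window Δ S M := by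
  obtain ⟨M, hM⟩ := exists_nat_ge (∑ i, ‖x' i‖)
  exact ⟨M, fun i => ⟨hx' i, (Finset.single_le_sum (f := fun i => ‖x' i‖)
    (fun _ _ => norm_nonneg _) (Finset.mem_univ i)).trans hM⟩⟩

theorem tendsto_windowMass [IsProbabilityMeasure Q] (hS : MeasurableSet S) (hQS : Q Sᶜ = 0)
    (W : Field b → ℝ≥0∞) {A : Set ({i // i ∈ Δ} → E d)} (hA : MeasurableSet A)
    (y : {i // i ∉ Δ} → E d) :
    Tendsto (fun M : ℕ => windowMass Q W (A ∩ window Δ S M) y) atTop (𝓝 (windowMass Q W A y)) := by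
  set ν := (Measure.pi fun _ : {i // i ∈ Δ} => Q).withDensity fun x' => W (glue Δ x' y)
  have hν : ∀ A, MeasurableSet A → windowMass Q W A y = ν A := fun A hA =>
    (withDensity_apply _ hA).symm
  have hmono : Monotone fun M : ℕ => A ∩ window Δ S M := fun M N h =>
    Set.inter_subset_inter_right _ (window_mono (Nat.cast_le.2 h))
  have h := tendsto_measure_iUnion_atTop (μ := ν) hmono
  have hU : ν (⋃ M : ℕ, A ∩ window Δ S M) = ν A := by
    refine measure_congr ?_
    have hac : ν ≪ Measure.pi fun _ : {i // i ∈ Δ} => Q := withDensity_absolutelyContinuous _ _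
    refine hac.ae_le ?_
    filter_upwards [ae_pi_mem (Δ := Δ) hQS] with x' hx'
    refine propext ⟨fun hx => ?_, fun hx => ?_⟩
    · obtain ⟨M, hM⟩ := Set.mem_iUnion.1 hx
      exact hM.1
    · obtain ⟨M, hM⟩ := mem_iUnion_window hx'
      exact Set.mem_iUnion.2 ⟨M, hx, hM⟩
  rw [hU, ← hν A hA] at h
  exact h.congr fun M => (hν _ (hA.inter (measurableSet_window hS _))).symm

theorem tendsto_windowProb [IsProbabilityMeasure Q] (hS : MeasurableSet S) (hQS : Q Sᶜ = 0)
    (W : Field b → ℝ≥0∞) {A : Set ({i // i ∈ Δ} → E d)} (hA : MeasurableSet A)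
    {y : {i // i ∉ Δ} → E d} (hy : windowMass Q W Set.univ y ≠ ∞) :
    Tendsto (fun M : ℕ => windowProb Q W (window Δ S M) A y) atTop
      (𝓝 (windowProb Q W Set.univ A y)) := by
  by_cases h0 : windowMass Q W Set.univ y = 0
  · have hz : ∀ A, windowMass Q W A y = 0 := fun A =>
      le_antisymm ((windowMass_mono (Set.subset_univ A) y).trans h0.le) bot_le
    simp only [windowProb, hz, mul_zero]
    exact tendsto_const_nhds
  · have e1 := tendsto_windowMass hS hQS W MeasurableSet.univ y
    simp only [Set.univ_inter] at e1
    have e2 := tendsto_windowMass hS hQS W hA y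
    simp only [windowProb, Set.inter_univ]
    refine ENNReal.Tendsto.mul e1.inv (Or.inl (by simpa using hy)) e2 (Or.inr (by simpa using h0))

end

/-! ### Existence of Gibbs measures for quasi-local interactions -/

section

variable {d : ℕ} {b : Module.Basis (Fin d) ℝ (E d)} {Δ : Finset (Lat b)}
  {H : Finset (E d) → EReal} {Q : Measure (E d)} {S : Set (E d)}

/-- The conditional distributions of `P` in the windows `window Δ S M` are given by the local
energy. -/
def HasWindowProb (H : Finset (E d) → EReal) (Q : Measure (E d)) (S : Set (E d))
    (Δ : Finset (Lat b)) (P : Measure (Field b)) : Prop :=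
  ∀ (M : ℕ) (A : Set ({i // i ∈ Δ} → E d)) (B : Set ({i // i ∉ Δ} → E d)), MeasurableSet A →
    MeasurableSet B → P (restrictIn Δ ⁻¹' (A ∩ window Δ S M) ∩ restrictOut Δ ⁻¹' B) =
      ∫⁻ x in restrictIn Δ ⁻¹' (window Δ S M) ∩ restrictOut Δ ⁻¹' B,
        windowProb Q (limitWeight H Δ) (window Δ S M) A (restrictOut Δ x) ∂P

theorem specification_apply (y : {i // i ∉ Δ} → E d) {A : Set ({i // i ∈ Δ} → E d)}
    (hA : MeasurableSet A) :
    specification H Q Δ y A = windowProb Q (limitWeight H Δ) Set.univ A y := by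
  rw [specification, Measure.smul_apply, smul_eq_mul, withDensity_apply _ hA, windowProb,
    windowMass, windowMass, setLIntegral_univ, Set.inter_univ]
  rfl

variable {P : Measure (Field b)} [IsProbabilityMeasure P] [IsProbabilityMeasure Q]

/-- Removal of the truncation: continuity from below on the left, dominated convergence on the
right. The limit g is left open because it serves twice, with g = 0 where the partition function is
infinite and with the full window probability where it is finite. -/
theorem HasWindowProb.tendsto (hP : HasWindowProb H Q S Δ P) (hH : IsHamiltonian H)
    (hS : MeasurableSet S) (hPS : ∀ᵐ x ∂P, ∀ i, x i ∈ S) {A : Set ({i // i ∈ Δ} → E d)}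
    {B : Set ({i // i ∉ Δ} → E d)} (hA : MeasurableSet A) (hB : MeasurableSet B)
    {g : ({i // i ∉ Δ} → E d) → ℝ≥0∞}
    (hg : ∀ᵐ x ∂P, restrictOut Δ x ∈ B →
      Tendsto (fun M : ℕ => windowProb Q (limitWeight H Δ) (window Δ S M) A (restrictOut Δ x))
        atTop (𝓝 (g (restrictOut Δ x)))) :
    P (restrictIn Δ ⁻¹' A ∩ restrictOut Δ ⁻¹' B) =
      ∫⁻ x in restrictOut Δ ⁻¹' B, g (restrictOut Δ x) ∂P := by
  have hT := fun M : ℕ => measurableSet_window (Δ := Δ) hS M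
  have hmB : MeasurableSet (restrictOut Δ ⁻¹' B : Set (Field b)) := measurable_restrictOut hB
  have hL : Tendsto (fun M : ℕ => P (restrictIn Δ ⁻¹' (A ∩ window Δ S M) ∩ restrictOut Δ ⁻¹' B))
      atTop (𝓝 (P (restrictIn Δ ⁻¹' A ∩ restrictOut Δ ⁻¹' B))) := by
    have hmono : Monotone fun M : ℕ =>
        (restrictIn Δ ⁻¹' (A ∩ window Δ S M) ∩ restrictOut Δ ⁻¹' B : Set (Field b)) :=
      fun M N h x hx => ⟨⟨hx.1.1, window_mono (Nat.cast_le.2 h) hx.1.2⟩, hx.2⟩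
    have h := tendsto_measure_iUnion_atTop (μ := P) hmono
    have hU : P (⋃ M : ℕ, restrictIn Δ ⁻¹' (A ∩ window Δ S M) ∩ restrictOut Δ ⁻¹' B) =
        P (restrictIn Δ ⁻¹' A ∩ restrictOut Δ ⁻¹' B) := ?_
    · rw [hU] at h
      exact h
    refine measure_congr ?_
    filter_upwards [hPS] with x hx
    refine propext ⟨fun hxA => ?_, fun hxA => ?_⟩
    · obtain ⟨M, hM⟩ := Set.mem_iUnion.1 hxA
      exact ⟨hM.1.1, hM.2⟩
    · obtain ⟨M, hM⟩ := mem_iUnion_window (x' := restrictIn Δ x) (S := S) fun i => hx i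
      exact Set.mem_iUnion.2 ⟨M, ⟨hxA.1, hM⟩, hxA.2⟩
  have hR : Tendsto (fun M : ℕ => ∫⁻ x in restrictOut Δ ⁻¹' B,
      (restrictIn Δ ⁻¹' (window Δ S M)).indicator (fun x =>
        windowProb Q (limitWeight H Δ) (window Δ S M) A (restrictOut Δ x)) x ∂P)
      atTop (𝓝 (∫⁻ x in restrictOut Δ ⁻¹' B, g (restrictOut Δ x) ∂P)) := by
    refine tendsto_lintegral_of_dominated_convergence (fun _ => 1) (fun M => ?_)
      (fun M => Eventually.of_forall fun x => ?_) (by simp) ?_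
    · exact ((measurable_windowProb (measurable_limitWeight hH) (hT M) hA).comp
        measurable_restrictOut).indicator (measurable_restrictIn (hT M))
    · exact Set.indicator_le' (fun x _ => windowProb_le_one _ _ _ _) (fun _ _ => bot_le) x
    · rw [ae_restrict_iff' hmB]
      filter_upwards [hg, hPS] with x hx hxS hxB
      refine (hx hxB).congr' ?_
      obtain ⟨M₀, hM₀⟩ := mem_iUnion_window (x' := restrictIn Δ x) (S := S) fun i => hxS i
      filter_upwards [eventually_ge_atTop M₀] with M hM
      have : x ∈ restrictIn Δ ⁻¹' (window Δ S M) := window_mono (Nat.cast_le.2 hM) hM₀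
      rw [Set.indicator_of_mem this]
  refine tendsto_nhds_unique hL (hR.congr fun M => ?_)
  rw [hP M A B hA hB, lintegral_indicator (measurable_restrictIn (hT M)),
    Measure.restrict_restrict (measurable_restrictIn (hT M))]

/-- Where the partition function is infinite, the conditional probability of a fixed window tends to
0 as the truncation grows. So P gives mass 0 to that window together with an infinite partition
function, and the windows exhaust the space. -/
theorem HasWindowProb.ae_windowMass_ne_top (hP : HasWindowProb H Q S Δ P) (hH : IsHamiltonian H)
    (hS : MeasurableSet S) (hQS : Q Sᶜ = 0) (hPS : ∀ᵐ x ∂P, ∀ i, x i ∈ S) :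
    ∀ᵐ x ∂P, windowMass Q (limitWeight H Δ) Set.univ (restrictOut Δ x) ≠ ∞ := by
  set B : Set ({i // i ∉ Δ} → E d) := {y | windowMass Q (limitWeight H Δ) Set.univ y = ∞}
  have hB : MeasurableSet B :=
    measurable_windowMass (measurable_limitWeight hH) MeasurableSet.univ
      (measurableSet_singleton ∞)
  have h0 : ∀ M₀ : ℕ, P (restrictIn Δ ⁻¹' (window Δ S M₀) ∩ restrictOut Δ ⁻¹' B) = 0 := by
    intro M₀
    rw [hP.tendsto hH hS hPS (measurableSet_window hS M₀) hB (g := 0), Pi.zero_def]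
    · simp
    · refine Eventually.of_forall fun x hx => ?_
      set y := restrictOut Δ x
      have hev : ∀ᶠ M : ℕ in atTop, (windowMass Q (limitWeight H Δ) (window Δ S M) y)⁻¹ *
          windowMass Q (limitWeight H Δ) (window Δ S M₀) y =
          windowProb Q (limitWeight H Δ) (window Δ S M) (window Δ S M₀) y := by
        filter_upwards [eventually_ge_atTop M₀] with M hM
        rw [windowProb, Set.inter_eq_left.2 (window_mono (Nat.cast_le.2 hM))]
      refine Tendsto.congr' hev ?_
      -- If the fixed window already has infinite mass, the quotient is 0 · ∞ = 0; otherwise a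
      -- finite numerator is divided by a mass tending to ∞.
      by_cases hfin : windowMass Q (limitWeight H Δ) (window Δ S M₀) y = ∞
      · refine tendsto_const_nhds.congr' ?_
        filter_upwards [eventually_ge_atTop M₀] with M hM
        have : windowMass Q (limitWeight H Δ) (window Δ S M) y = ∞ :=
          top_le_iff.1 (hfin.ge.trans (windowMass_mono (window_mono (Nat.cast_le.2 hM)) y))
        rw [this, ENNReal.inv_top, zero_mul, Pi.zero_apply]
      · have e1 := tendsto_windowMass hS hQS (limitWeight H Δ) MeasurableSet.univ y
        simp only [Set.univ_inter] at e1
        rw [show windowMass Q (limitWeight H Δ) Set.univ y = ∞ from hx] at e1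
        have := ENNReal.Tendsto.mul_const e1.inv (Or.inr hfin)
        simpa using this
  have hall := measure_iUnion_null h0
  rw [measure_eq_zero_iff_ae_notMem] at hall
  filter_upwards [hall, hPS] with x hx hxS htop
  obtain ⟨M, hM⟩ := mem_iUnion_window (x' := restrictIn Δ x) (S := S) fun i => hxS i
  exact hx (Set.mem_iUnion.2 ⟨M, hM, htop⟩)

/-- The specification as a kernel. -/
def specificationKernel (hH : IsHamiltonian H) (Q : Measure (E d)) [IsProbabilityMeasure Q]
    (Δ : Finset (Lat b)) : Kernel ({i // i ∉ Δ} → E d) ({i // i ∈ Δ} → E d) where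
  toFun := specification H Q Δ
  measurable' := by
    refine Measure.measurable_of_measurable_coe _ fun A hA => ?_
    simp_rw [specification_apply _ hA]
    exact measurable_windowProb (measurable_limitWeight hH) MeasurableSet.univ hA

theorem isFiniteKernel_specificationKernel (hH : IsHamiltonian H) :
    IsFiniteKernel (specificationKernel hH Q Δ) :=
  ⟨1, ENNReal.one_lt_top, fun y => by
    change specification H Q Δ y Set.univ ≤ 1
    rw [specification_apply _ MeasurableSet.univ]
    exact windowProb_le_one _ _ _ _⟩

/-- Finiteness of the partition function makes the truncated probabilities converge. Its positivity
needs no separate argument: where it is 0 the specification is the zero measure, which the identity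
with the joint law excludes almost surely. -/
theorem HasWindowProb.condDistrib_eq (hP : HasWindowProb H Q S Δ P) (hH : IsHamiltonian H)
    (hS : MeasurableSet S) (hQS : Q Sᶜ = 0) (hPS : ∀ᵐ x ∂P, ∀ i, x i ∈ S) :
    ∀ᵐ y ∂(P.map (restrictOut Δ)),
      condDistrib (restrictIn Δ) (restrictOut Δ) P y = specification H Q Δ y := by
  have := isFiniteKernel_specificationKernel (Q := Q) (Δ := Δ) hH
  refine condDistrib_ae_eq_of_measure_eq_compProd (κ := specificationKernel hH Q Δ)
    (restrictOut Δ) measurable_restrictIn.aemeasurable ?_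
  have hm : Measurable fun x : Field b => (restrictOut Δ x, restrictIn Δ x) :=
    measurable_restrictOut.prodMk measurable_restrictIn
  have := Measure.isProbabilityMeasure_map (μ := P) hm.aemeasurable
  have := Measure.isProbabilityMeasure_map (μ := P) (measurable_restrictOut (Δ := Δ)).aemeasurable
  refine Measure.ext_prod fun {B A} hB hA => ?_
  rw [Measure.map_apply hm (hB.prod hA), Measure.compProd_apply_prod hB hA,
    setLIntegral_map hB (Kernel.measurable_coe _ hA) measurable_restrictOut]
  change P (restrictOut Δ ⁻¹' B ∩ restrictIn Δ ⁻¹' A) =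
    ∫⁻ x in restrictOut Δ ⁻¹' B, specification H Q Δ (restrictOut Δ x) A ∂P
  simp_rw [specification_apply _ hA]
  rw [Set.inter_comm]
  refine hP.tendsto hH hS hPS hA hB ?_
  filter_upwards [hP.ae_windowMass_ne_top hH hS hQS hPS] with x hx _
  exact tendsto_windowProb hS hQS _ hA hx

/-- Existence of Gibbs measures for quasi-local interactions. -/
theorem QuasiLocal.exists_isGibbsMeasure (hq : QuasiLocal b H S) (hH : IsHamiltonian H)
    (h1 : Stable H) (h2 : NonDegenerate b H) (h3 : Hereditary H) (h4 : TranslationInvariant H)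
    (hS : MeasurableSet S) (hQS : Q Sᶜ = 0) : (gibbsMeasures b H Q).Nonempty := by
  obtain ⟨K, _, hK⟩ := exists_freeGibbs_le (Q := Q) h1 h2 h4
  have hfree : ∀ n, IsProbabilityMeasure (freeGibbs H Q (coordBox b n)) := fun n =>
    isProbabilityMeasure_freeGibbs (hK _).1 (hK _).2.1
  have hav : ∀ n, IsProbabilityMeasure (averagedGibbs H Q (coordBox b n)) := fun n =>
    isProbabilityMeasure_averagedGibbs (coordBox_nonempty n)
  have hU : ((hyperfilter ℕ : Ultrafilter ℕ) : Filter ℕ) ≤ atTop := by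
    rw [← Nat.cofinite_eq_atTop]
    exact hyperfilter_le_cofinite
  obtain ⟨P, hPprob, hP⟩ := exists_tendstoLocally (b := b) (ρ := freeField b Q)
    (μs := fun n => averagedGibbs H Q (coordBox b n)) (fun Δ ε hε => by
      obtain ⟨δ, hδ, h⟩ := averagedGibbs_uniform_absolutelyContinuous (Q := Q) h1 h2 h4 Δ hε
      exact ⟨δ, hδ, fun A hA hle n => h A hA hle _ (coordBox_nonempty n)⟩) (hyperfilter ℕ)
  have hPS := hP.ae_mem hS hQS
  have hinv := hP.map_shift hU
  refine ⟨⟨P, hPprob⟩, hinv, fun Δ => ?_, fun Δ => ?_⟩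
  · have hmS : MeasurableSet {y : {i // i ∉ Δ} → E d | ∀ i, y i ∈ S} := by
      rw [Set.ofPred_forall]
      exact MeasurableSet.iInter fun i => measurable_pi_apply i hS
    have hae : ∀ᵐ y ∂(P.map (restrictOut Δ)), (∀ i, y i ∈ S) ∧ IsTight Δ y := by
      rw [ae_map_iff (p := fun y => (∀ i, y i ∈ S) ∧ IsTight Δ y)
        measurable_restrictOut.aemeasurable (hmS.inter measurableSet_isTight)]
      filter_upwards [hPS, ae_isSparse hinv] with x hxS hx
      exact ⟨fun i => hxS i, hx.isTight⟩
    refine hae.mono fun y hy => ?_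
    filter_upwards [ae_pi_mem (Δ := Δ) hQS] with x' hx'
    exact hq.exists_tendsto h3 hy.1 hy.2 hx'
  · refine HasWindowProb.condDistrib_eq (P := P) (S := S) (fun M A B hA hB => ?_) hH hS hQS hPS
    exact hP.eq_windowProb hH h1 h2 h3 h4 hS hQS hq hU M hA hB

end

/-! ### Finite range interactions are quasi-local -/

section

variable {d : ℕ} {b : Module.Basis (Fin d) ℝ (E d)} {Δ : Finset (Lat b)}
  {H : Finset (E d) → EReal}

theorem eventually_mem_cube (v : E d) : ∀ᶠ n in atTop, v ∈ cube d n :=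
  eventually_all.2 fun k => tendsto_natCast_atTop_atTop.eventually (eventually_ge_atTop |v k|)

theorem eventually_window_eq (γ : Finset (E d)) (hγ : IsLocallyFinite (γ : Set (E d))) :
    ∀ᶠ n in atTop, hγ.window n = γ := by
  filter_upwards [(eventually_all_finset γ).2 fun v _ => eventually_mem_cube v] with n hn
  ext v
  simp only [IsLocallyFinite.window, Set.Finite.mem_toFinset, Set.mem_inter_iff, Finset.mem_coe]
  exact ⟨fun h => h.1, fun h => ⟨h, hn v h⟩⟩

theorem IsLocalEnergy.eq_of_finset {W : Set (E d)} {γ : Finset (E d)}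
    {hγ : IsLocallyFinite (γ : Set (E d))} {h : EReal} (hh : IsLocalEnergy H W hγ h) :
    h = energyDiff (H γ) (H (outside γ W)) := by
  refine tendsto_nhds_unique hh (tendsto_const_nhds.congr' ?_)
  filter_upwards [eventually_window_eq γ hγ] with n hn
  rw [hn]

theorem IsLocalEnergy.unique {W : Set (E d)} {γ γ' : Set (E d)} (e : γ = γ')
    {hγ : IsLocallyFinite γ} {hγ' : IsLocallyFinite γ'} {h h' : EReal}
    (hh : IsLocalEnergy H W hγ h) (hh' : IsLocalEnergy H W hγ' h') : h = h' := by
  subst e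
  exact tendsto_nhds_unique hh hh'

open scoped Classical in
/-- The points of the window that are not points of the outer configuration. -/
def newPoints (Δ Λ : Finset (Lat b)) (x : Field b) : Finset (E d) :=
  points Δ x \ points (Λ \ Δ) x

open scoped Classical in
theorem points_eq_union {Λ : Finset (Lat b)} (h : Δ ⊆ Λ) (x : Field b) :
    points Λ x = points (Λ \ Δ) x ∪ newPoints Δ Λ x := by
  rw [newPoints, Finset.union_sdiff_self_eq_union, points, points, points, ← Finset.image_union,
    Finset.sdiff_union_of_subset h]

-- H sees sets of points, so a window point may coincide with an outer one. Deleting all of `points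
-- Δ x` could then delete outer points, whereas deleting the new points leaves exactly the outer
-- configuration.
open scoped Classical in
theorem outside_newPoints {Λ : Finset (Lat b)} (h : Δ ⊆ Λ) (x : Field b) :
    outside (points Λ x) (newPoints Δ Λ x) = points (Λ \ Δ) x := by
  ext v
  simp only [outside, points_eq_union h x, newPoints, Finset.mem_filter, Finset.mem_union,
    Finset.mem_sdiff, Finset.mem_coe]
  tauto

/-- An upper bound for the norms of the points of a window. -/
def windowRadius (Δ : Finset (Lat b)) (M : ℝ) : ℝ := ∑ i ∈ Δ, ‖(i : E d)‖ + M

theorem norm_le_windowRadius {M : ℝ} {x : Field b} (hM : ∀ i ∈ Δ, ‖x i‖ ≤ M) {v : E d}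
    (hv : v ∈ points Δ x) : ‖v‖ ≤ windowRadius Δ M := by
  classical
  obtain ⟨i, hi, rfl⟩ := Finset.mem_image.1 hv
  exact (norm_add_le _ _).trans (add_le_add (Finset.single_le_sum
    (f := fun i : Lat b => ‖(i : E d)‖) (fun _ _ => norm_nonneg _) hi) (hM i hi))

/-- The points of Λ \ Λ' are too far from the origin to coincide with a window point. -/
theorem newPoints_eq {M R : ℝ} {x : Field b} (hM : ∀ i ∈ Δ, ‖x i‖ ≤ M) {Λ' Λ : Finset (Lat b)}
    (hΛ : Λ' ⊆ Λ) (hR : windowRadius Δ M ≤ R)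
    (hfar : ∀ i ∈ Λ, i ∉ Λ' → R < ‖(i : E d) + x i‖) :
    newPoints Δ Λ' x = newPoints Δ Λ x := by
  classical
  ext v
  simp only [newPoints, Finset.mem_sdiff, and_congr_right_iff]
  intro hv
  refine not_congr ⟨fun h => points_mono (Finset.sdiff_subset_sdiff hΛ le_rfl) x h, fun h => ?_⟩
  obtain ⟨i, hi, rfl⟩ := Finset.mem_image.1 h
  obtain ⟨hi, hiΔ⟩ := Finset.mem_sdiff.1 hi
  by_cases hi' : i ∈ Λ'
  · exact Finset.mem_image_of_mem _ (Finset.mem_sdiff.2 ⟨hi', hiΔ⟩)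
  · exact absurd (hfar i hi hi') (not_lt.2 ((norm_le_windowRadius hM hv).trans hR))

theorem isLocallyFinite_coe (γ : Finset (E d)) : IsLocallyFinite (γ : Set (E d)) :=
  fun _ _ => γ.finite_toSet.subset Set.inter_subset_left

/-- For W the finite set of new points, both increments are local energies on W. Points farther than
`windowRadius Δ M + r` from the origin are outside W ⊕ B(0, r), so finite range expresses both
through the same configuration: the increments are equal. -/
theorem FiniteRange.quasiLocal (h5 : FiniteRange H) (h3 : Hereditary H) :
    QuasiLocal b H Set.univ := by
  classical
  obtain ⟨r, hr, h5⟩ := h5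
  intro Δ M η hη
  refine ⟨windowRadius Δ M + r, fun x _ hM Λ' Λ hΔ hΛ hE hfar => ?_⟩
  have hnew : newPoints Δ Λ' x = newPoints Δ Λ x :=
    newPoints_eq hM hΛ (by linarith) hfar
  set W := (newPoints Δ Λ x : Set (E d)) with hW
  have hWb : Bornology.IsBounded W := (newPoints Δ Λ x).finite_toSet.isBounded
  have key : ∀ Γ : Finset (Lat b), Δ ⊆ Γ → Γ ⊆ Λ → newPoints Δ Γ x = newPoints Δ Λ x →
      IsLocalEnergy H W ((isLocallyFinite_coe (points Γ x)).inter (W + Metric.ball (0 : E d) r))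
        (increment H Δ Γ x) := by
    intro Γ hΔΓ hΓ hn
    have hout : outside (points Γ x) W = points (Γ \ Δ) x := by
      rw [hW, ← hn]
      exact outside_newPoints hΔΓ x
    -- The finite-energy condition holds because each window outside W is a subset of `points (Λ \
    -- Δ) x`, whose energy is finite; heredity passes this on.
    obtain ⟨h, hh1, hh2⟩ := h5 W hWb _ (isLocallyFinite_coe (points Γ x)) fun n => by
      intro htop
      refine hE (h3.mono (γ := outside ((isLocallyFinite_coe (points Γ x)).window n) W) ?_ htop)
      refine Finset.Subset.trans ?_ (points_mono (Finset.sdiff_subset_sdiff hΓ le_rfl) x)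
      rw [← hout]
      intro v hv
      simp only [outside, Finset.mem_filter, IsLocallyFinite.window, Set.Finite.mem_toFinset,
        Set.mem_inter_iff, Finset.mem_coe] at hv ⊢
      exact ⟨hv.1.1, hv.2⟩
    have e := hh1.eq_of_finset
    rw [hout] at e
    rw [increment, ← e]
    exact hh2
  have heq : increment H Δ Λ x = increment H Δ Λ' x := by
    refine IsLocalEnergy.unique ?_ (key Λ (hΔ.trans hΛ) subset_rfl rfl) (key Λ' hΔ hΛ hnew)
    ext v
    simp only [Set.mem_inter_iff, Finset.mem_coe, and_congr_left_iff]
    intro hv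
    refine ⟨fun h => ?_, fun h => points_mono hΛ x h⟩
    obtain ⟨i, hi, rfl⟩ := Finset.mem_image.1 h
    by_cases hi' : i ∈ Λ'
    · exact Finset.mem_image_of_mem _ hi'
    · obtain ⟨w, hw, u, hu, hwu⟩ := Set.mem_add.1 hv
      have hw' := norm_le_windowRadius hM (Finset.mem_sdiff.1 (Finset.mem_coe.1 hw)).1
      have hu' : ‖u‖ < r := by simpa using hu
      have := hfar i hi hi'
      rw [← hwu] at this
      linarith [norm_add_le w u]
  rw [heq]
  exact ⟨le_add_of_nonneg_right (by exact_mod_cast hη.le),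
    le_add_of_nonneg_right (by exact_mod_cast hη.le)⟩

end

/-! ### Lattice sums of radial functions -/

section

/-- Polar coordinates for radial functions. -/
theorem lintegral_fun_norm_addHaar {F : Type*} [NormedAddCommGroup F] [NormedSpace ℝ F]
    [MeasurableSpace F] [BorelSpace F] [FiniteDimensional ℝ F] [Nontrivial F] (μ : Measure F)
    [μ.IsAddHaarMeasure] {f : ℝ → ℝ≥0∞} (hf : Measurable f) :
    ∫⁻ u, f ‖u‖ ∂μ = μ.toSphere Set.univ *
      ∫⁻ r in Set.Ioi 0, ENNReal.ofReal (r ^ (Module.finrank ℝ F - 1)) * f r := by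
  have h1 := lintegral_subtype_comap (μ := μ) (measurableSet_singleton (0 : F)).compl
    fun u => f ‖u‖
  rw [restrict_compl_singleton] at h1
  have h2 := μ.measurePreserving_homeomorphUnitSphereProd.lintegral_comp
    (f := fun p : Metric.sphere (0 : F) 1 × Set.Ioi (0 : ℝ) => f p.2)
    (hf.comp (measurable_subtype_coe.comp measurable_snd))
  simp only [homeomorphUnitSphereProd_apply_snd_coe] at h2
  have hp : Measurable fun r : Set.Ioi (0 : ℝ) =>
      ENNReal.ofReal ((r : ℝ) ^ (Module.finrank ℝ F - 1)) := by fun_prop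
  have hfs : Measurable fun r : Set.Ioi (0 : ℝ) => f r := hf.comp measurable_subtype_coe
  have h3 := lintegral_subtype_comap (μ := volume) (measurableSet_Ioi (a := (0 : ℝ)))
    fun r => ENNReal.ofReal (r ^ (Module.finrank ℝ F - 1)) * f r
  rw [← h1, h2, lintegral_prod_symm' (fun p : Metric.sphere (0 : F) 1 × Set.Ioi (0 : ℝ) => f p.2)
    (hf.comp (measurable_subtype_coe.comp measurable_snd))]
  simp only [lintegral_const]
  rw [lintegral_mul_const _ hfs, mul_comm, ← h3,
    Measure.volumeIoiPow,
    lintegral_withDensity_eq_lintegral_mul _ hp hfs]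
  rfl

variable {d : ℕ} {b : Module.Basis (Fin d) ℝ (E d)}

/-- Comparison of a lattice sum with an integral. -/
theorem tsum_lat_le_lintegral (b : Module.Basis (Fin d) ℝ (E d)) {ψ : ℝ → ℝ≥0∞}
    (hψ : Antitone ψ) :
    volume (ZSpan.fundamentalDomain b) * ∑' i : Lat b, ψ ‖(i : E d)‖ ≤
      ∫⁻ u : E d, ψ (‖u‖ - ∑ k, ‖b k‖) := by
  have hD := ZSpan.isAddFundamentalDomain b (volume : Measure (E d))
  have : VAddInvariantMeasure (Lat b) (E d) volume :=
    inferInstanceAs (VAddInvariantMeasure (Lat b).toAddSubgroup (E d) volume)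
  rw [hD.lintegral_eq_tsum'', ← ENNReal.tsum_mul_left]
  refine ENNReal.tsum_le_tsum fun i => ?_
  rw [mul_comm, ← setLIntegral_const]
  -- A point u of the fundamental cell has norm at most the sum of the ‖b k‖, so ψ at ‖i‖ is below
  -- the shifted integrand on the whole cell at i.
  refine setLIntegral_mono' (ZSpan.fundamentalDomain_measurableSet b) fun u hu => hψ ?_
  have hu' : ‖u‖ ≤ ∑ k, ‖b k‖ := by
    rw [← ZSpan.fract_eq_self.2 hu]
    exact ZSpan.norm_fract_le b u
  have : ‖i +ᵥ u‖ ≤ ‖(i : E d)‖ + ‖u‖ := norm_add_le _ _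
  linarith

theorem setLIntegral_Ioi_shift_lt_top {ψ : ℝ → ℝ≥0∞} (hψ : Antitone ψ) (hfin : ∀ r, ψ r ≠ ∞)
    {n : ℕ} {ρ : ℝ} (hρ : ∫⁻ r in Set.Ioi ρ, ENNReal.ofReal (r ^ n) * ψ r < ∞) {C : ℝ}
    (hC : 0 ≤ C) :
    ∫⁻ r in Set.Ioi 0, ENNReal.ofReal (r ^ n) * ψ (r - C) < ∞ := by
  -- Up to K the integrand is bounded. Beyond K, substituting s = r - C gives s > C, so (s + C)^n ≤
  -- (2s)^n, and s > ρ, where integrability is known.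
  set K := max ρ C + C
  have hK : 0 ≤ K := add_nonneg (le_max_of_le_right hC) hC
  have hsplit : Set.Ioi (0 : ℝ) = Set.Ioc 0 K ∪ Set.Ioi K := (Set.Ioc_union_Ioi_eq_Ioi hK).symm
  rw [hsplit]
  refine (lintegral_union_le _ _ _).trans_lt (ENNReal.add_lt_top.2 ⟨?_, ?_⟩)
  · calc ∫⁻ r in Set.Ioc 0 K, ENNReal.ofReal (r ^ n) * ψ (r - C)
        ≤ ∫⁻ _ in Set.Ioc 0 K, ENNReal.ofReal (K ^ n) * ψ (0 - C) := by
          refine setLIntegral_mono' measurableSet_Ioc fun r hr => ?_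
          gcongr
          · exact hr.1.le
          · exact hr.2
          · exact hψ (by linarith [hr.1])
      _ < ∞ := by
          rw [setLIntegral_const]
          refine ENNReal.mul_lt_top (ENNReal.mul_lt_top ENNReal.ofReal_lt_top (hfin _).lt_top) ?_
          simp
  · have hmp : MeasurePreserving (fun s : ℝ => s + C) volume volume :=
      measurePreserving_add_right volume C
    have hpre : (fun s : ℝ => s + C) ⁻¹' (Set.Ioi K) = Set.Ioi (max ρ C) := by
      ext s
      simp [K]
    have hcv := hmp.setLIntegral_comp_preimage_emb (measurableEmbedding_addRight C)
      (fun r => ENNReal.ofReal (r ^ n) * ψ (r - C)) (Set.Ioi K)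
    rw [← hcv, hpre]
    calc ∫⁻ s in Set.Ioi (max ρ C), ENNReal.ofReal ((s + C) ^ n) * ψ (s + C - C)
        ≤ ∫⁻ s in Set.Ioi (max ρ C), ENNReal.ofReal (2 ^ n) * (ENNReal.ofReal (s ^ n) * ψ s) := by
          refine setLIntegral_mono' measurableSet_Ioi fun s hs => ?_
          have hs' : C < s := (le_max_right ρ C).trans_lt hs
          rw [add_sub_cancel_right, ← mul_assoc, ← ENNReal.ofReal_mul (by positivity), ← mul_pow]
          gcongr
          · linarith
          · linarith
      _ = ENNReal.ofReal (2 ^ n) * ∫⁻ s in Set.Ioi (max ρ C), ENNReal.ofReal (s ^ n) * ψ s :=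
          lintegral_const_mul' _ _ ENNReal.ofReal_ne_top
      _ ≤ ENNReal.ofReal (2 ^ n) * ∫⁻ s in Set.Ioi ρ, ENNReal.ofReal (s ^ n) * ψ s := by
          gcongr
          exact le_max_left _ _
      _ < ∞ := ENNReal.mul_lt_top ENNReal.ofReal_lt_top hρ

theorem tsum_lat_ne_top (hd : 0 < d) (b : Module.Basis (Fin d) ℝ (E d)) {ψ : ℝ → ℝ≥0∞}
    (hψ : Antitone ψ) (hfin : ∀ r, ψ r ≠ ∞) {ρ : ℝ}
    (hρ : ∫⁻ r in Set.Ioi ρ, ENNReal.ofReal (r ^ (d - 1)) * ψ r < ∞) (C : ℝ) :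
    ∑' i : Lat b, ψ (‖(i : E d)‖ - C) ≠ ∞ := by
  have : Nonempty (Fin d) := ⟨⟨0, hd⟩⟩
  have hψ' : Antitone fun r => ψ (r - C) := fun r s h => hψ (by linarith)
  have h1 := tsum_lat_le_lintegral b hψ'
  set L := ∑ k, ‖b k‖
  have h2 : ∫⁻ u : E d, ψ (‖u‖ - L - C) < ∞ := by
    refine lt_of_le_of_lt (b := ∫⁻ u : E d, ψ (‖u‖ - |L + C|))
      (lintegral_mono fun u => hψ (by linarith [le_abs_self (L + C)])) ?_
    have hm : Measurable fun r => ψ (r - |L + C|) :=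
      hψ.measurable.comp (measurable_id.sub_const _)
    rw [lintegral_fun_norm_addHaar (volume : Measure (E d)) hm]
    simp only [finrank_euclideanSpace, Fintype.card_fin]
    exact ENNReal.mul_lt_top (measure_lt_top _ _)
      (setLIntegral_Ioi_shift_lt_top hψ hfin hρ (abs_nonneg _))
  intro htop
  rw [htop, ENNReal.mul_top (ZSpan.measure_fundamentalDomain_ne_zero b)] at h1
  exact (h1.trans_lt h2).ne rfl

end

/-! ### Summable pair interactions are quasi-local -/

section

theorem ereal_abs_le_of_nonneg {u v : EReal} (hu : 0 ≤ u) (h : u ≤ v) : u.abs ≤ v.abs := by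
  induction v using EReal.rec with
  | bot => exact absurd (hu.trans h) (by simp)
  | top => simp
  | coe v =>
    lift u to ℝ using ⟨(h.trans_lt (EReal.coe_lt_top v)).ne, (EReal.bot_lt_zero.trans_le hu).ne'⟩
    rw [EReal.abs_def, EReal.abs_def]
    have hu' : 0 ≤ u := by exact_mod_cast hu
    have h' : u ≤ v := by exact_mod_cast h
    exact ENNReal.ofReal_le_ofReal (abs_le_abs_of_nonneg hu' h')

theorem ereal_abs_le_of_nonpos {u v : EReal} (hv : v ≤ 0) (h : u ≤ v) : v.abs ≤ u.abs := by
  rw [← EReal.abs_neg v, ← EReal.abs_neg u]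
  exact ereal_abs_le_of_nonneg (EReal.neg_nonneg.2 hv) (EReal.neg_le_neg_iff.2 h)

theorem ereal_sum_le_of_abs_le {ι : Type*} (s : Finset ι) {f : ι → EReal} {c : ι → ℝ≥0∞}
    (hf : ∀ k ∈ s, (f k).abs ≤ c k) {η : ℝ} (hη : 0 ≤ η) (hc : ∑ k ∈ s, c k ≤ ENNReal.ofReal η) :
    ∑ k ∈ s, f k ≤ η ∧ 0 ≤ ∑ k ∈ s, f k + (η : EReal) := by
  have hfin : ∀ k ∈ s, (f k).abs ≠ ∞ := fun k hk => ne_top_of_le_ne_top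
    (ne_top_of_le_ne_top ENNReal.ofReal_ne_top hc)
    ((hf k hk).trans (Finset.single_le_sum (fun _ _ => zero_le) hk))
  have hcoe : ∀ k ∈ s, f k = ((f k).toReal : EReal) := fun k hk =>
    (EReal.coe_toReal (fun h => hfin k hk (by simp [h])) fun h => hfin k hk (by simp [h])).symm
  have hsum : ∑ k ∈ s, f k = ((∑ k ∈ s, (f k).toReal : ℝ) : EReal) := by
    rw [Finset.sum_congr rfl hcoe]
    exact (map_sum (⟨⟨Real.toEReal, EReal.coe_zero⟩, EReal.coe_add⟩ : ℝ →+ EReal) _ s).symm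
  have habs : ∑ k ∈ s, |(f k).toReal| ≤ η := by
    rw [← ENNReal.ofReal_le_ofReal_iff hη, ENNReal.ofReal_sum_of_nonneg fun _ _ => abs_nonneg _]
    refine (Finset.sum_le_sum fun k hk => ?_).trans hc
    rw [← EReal.abs_def, ← hcoe k hk]
    exact hf k hk
  have h := abs_le.1 ((Finset.abs_sum_le_sum_abs _ _).trans habs)
  rw [hsum]
  exact ⟨by exact_mod_cast h.2, by exact_mod_cast neg_le_iff_add_nonneg.1 h.1⟩

theorem lintegral_Ioi_pow_mul_eq_top {f : ℝ → ℝ≥0∞} {c : ℝ≥0∞} (hc : c ≠ 0) {s : ℝ}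
    (h : ∀ r, s < r → c ≤ f r) (n : ℕ) (ε : ℝ) :
    ∫⁻ r in Set.Ioi ε, ENNReal.ofReal (r ^ n) * f r = ∞ := by
  set t := max (max s ε) 1
  refine top_le_iff.1 ?_
  calc ∞ = ∫⁻ _ in Set.Ioi t, c := by
        rw [setLIntegral_const, Real.volume_Ioi, ENNReal.mul_top hc]
    _ ≤ ∫⁻ r in Set.Ioi t, ENNReal.ofReal (r ^ n) * f r := by
        refine setLIntegral_mono' measurableSet_Ioi fun r hr => ?_
        have hr1 : 1 < r := (le_max_right _ _).trans_lt hr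
        have hrs : s < r := ((le_max_left _ _).trans (le_max_left _ _)).trans_lt hr
        calc c = 1 * c := (one_mul c).symm
          _ ≤ _ := by
            gcongr
            · rw [← ENNReal.ofReal_one]
              exact ENNReal.ofReal_le_ofReal (one_le_pow₀ hr1.le)
            · exact h r hrs
    _ ≤ _ := lintegral_mono_set (Set.Ioi_subset_Ioi ((le_max_right _ _).trans (le_max_left _ _)))

/-- An integrable potential that is monotone at infinity has a finite antitone integrable
majorant. -/
theorem exists_antitone_majorant {φ : ℝ → EReal} {r₀ : ℝ}
    (hφ : MonotoneOn φ (Set.Ioi r₀) ∨ AntitoneOn φ (Set.Ioi r₀)) {n : ℕ} {ε : ℝ}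
    (hint : ∫⁻ r in Set.Ioi ε, ENNReal.ofReal (r ^ n) * (φ r).abs < ∞) :
    ∃ (ψ : ℝ → ℝ≥0∞) (ρ : ℝ), Antitone ψ ∧ (∀ r, ψ r ≠ ∞) ∧ (∀ r, ρ < r → (φ r).abs ≤ ψ r) ∧
      ∫⁻ r in Set.Ioi ρ, ENNReal.ofReal (r ^ n) * ψ r < ∞ := by
  have hanti : AntitoneOn (fun r => (φ r).abs) (Set.Ioi r₀) := by
    rcases hφ with hφ | hφ
    -- An increasing potential that is positive somewhere stays above that value, and its integral
    -- diverges. So it is nonpositive at infinity and its absolute value decreases; the decreasing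
    -- case is symmetric.
    · have hneg : ∀ s ∈ Set.Ioi r₀, φ s ≤ 0 := by
        intro s hs
        by_contra! hpos
        refine hint.ne (lintegral_Ioi_pow_mul_eq_top (c := (φ s).abs) (s := s) ?_ ?_ n ε)
        · exact fun h => hpos.ne' (EReal.abs_eq_zero_iff.1 h)
        · exact fun r hr => ereal_abs_le_of_nonneg hpos.le (hφ hs (lt_trans hs hr) hr.le)
      exact fun r hr s hs hrs => ereal_abs_le_of_nonpos (hneg s hs) (hφ hr hs hrs)
    · have hpos : ∀ s ∈ Set.Ioi r₀, 0 ≤ φ s := by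
        intro s hs
        by_contra! hneg
        refine hint.ne (lintegral_Ioi_pow_mul_eq_top (c := (φ s).abs) (s := s) ?_ ?_ n ε)
        · exact fun h => hneg.ne (EReal.abs_eq_zero_iff.1 h)
        · exact fun r hr => ereal_abs_le_of_nonpos hneg.le (hφ hs (lt_trans hs hr) hr.le)
      exact fun r hr s hs hrs => ereal_abs_le_of_nonneg (hpos s hs) (hφ hr hs hrs)
  obtain ⟨s, hs, hsfin⟩ : ∃ s, max r₀ ε < s ∧ (φ s).abs ≠ ∞ := by
    by_contra! h
    exact hint.ne (lintegral_Ioi_pow_mul_eq_top (c := ∞) (by simp) (fun r hr => (h r hr).ge) n ε)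
  have hs0 : r₀ < s := (le_max_left _ _).trans_lt hs
  have hmem : ∀ r, max r s ∈ Set.Ioi r₀ := fun r => hs0.trans_le (le_max_right _ _)
  -- Freezing |φ| to the left of a point s where it is finite makes it antitone and finite on the
  -- whole line.
  refine ⟨fun r => (φ (max r s)).abs, s, fun r t h => ?_, fun r => ?_, fun r hr => ?_, ?_⟩
  · exact hanti (hmem r) (hmem t) (max_le_max h le_rfl)
  · exact ne_top_of_le_ne_top hsfin (hanti hs0 (hmem r) (le_max_right _ _))
  · simp only [max_eq_left hr.le, le_refl]
  · refine lt_of_le_of_lt ?_ hint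
    refine le_trans (le_of_eq ?_)
      (lintegral_mono_set (Set.Ioi_subset_Ioi ((le_max_right r₀ ε).trans hs.le)))
    refine setLIntegral_congr_fun measurableSet_Ioi fun r hr => ?_
    simp only [max_eq_left (le_of_lt (Set.mem_Ioi.1 hr))]

variable {d : ℕ} {b : Module.Basis (Fin d) ℝ (E d)} {Δ : Finset (Lat b)}
  {H : Finset (E d) → EReal} {φ : ℝ → EReal}

open scoped Classical in
/-- The energy of a finite configuration with pair potential `φ`. -/
def pairEnergy (φ : ℝ → EReal) (γ : Finset (E d)) : EReal :=
  ∑ p ∈ γ.sym2.filter (fun p => ¬ p.IsDiag), pairValue φ p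

open scoped Classical in
theorem pairEnergy_insert {γ : Finset (E d)} {w : E d} (hw : w ∉ γ) :
    pairEnergy φ (insert w γ) = pairEnergy φ γ + ∑ a ∈ γ, φ (dist w a) := by
  have hset : (insert w γ).sym2.filter (fun p => ¬ p.IsDiag) =
      γ.sym2.filter (fun p => ¬ p.IsDiag) ∪ γ.image fun a => s(w, a) := by
    ext p
    induction p using Sym2.ind with
    | _ u v =>
      simp only [Finset.mem_filter, Finset.mk_mem_sym2_iff, Finset.mem_insert, Sym2.mk_isDiag_iff,
        Finset.mem_union, Finset.mem_image, Sym2.eq_iff]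
      constructor
      · rintro ⟨⟨rfl | hu, rfl | hv⟩, hne⟩
        · exact absurd rfl hne
        · exact Or.inr ⟨v, hv, Or.inl ⟨rfl, rfl⟩⟩
        · exact Or.inr ⟨u, hu, Or.inr ⟨rfl, rfl⟩⟩
        · exact Or.inl ⟨⟨hu, hv⟩, hne⟩
      · rintro (⟨⟨hu, hv⟩, hne⟩ | ⟨a, ha, ⟨rfl, rfl⟩ | ⟨rfl, rfl⟩⟩)
        · exact ⟨⟨Or.inr hu, Or.inr hv⟩, hne⟩
        · exact ⟨⟨Or.inl rfl, Or.inr ha⟩, fun h => hw (h ▸ ha)⟩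
        · exact ⟨⟨Or.inr ha, Or.inl rfl⟩, fun h => hw (h ▸ ha)⟩
  have hdisj : Disjoint (γ.sym2.filter fun p => ¬ p.IsDiag) (γ.image fun a => s(w, a)) := by
    rw [Finset.disjoint_left]
    rintro p hp hp'
    obtain ⟨a, _, rfl⟩ := Finset.mem_image.1 hp'
    exact hw (Finset.mk_mem_sym2_iff.1 (Finset.mem_filter.1 hp).1).1
  rw [pairEnergy, hset, Finset.sum_union hdisj, Finset.sum_image]
  · rfl
  · intro a _ a' _ h
    rcases Sym2.eq_iff.1 h with h | h
    · exact h.2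
    · exact h.2.trans h.1

open scoped Classical in
theorem pairEnergy_union {A W : Finset (E d)} (h : Disjoint A W) :
    pairEnergy φ (A ∪ W) =
      pairEnergy φ A + (pairEnergy φ W + ∑ w ∈ W, ∑ a ∈ A, φ (dist w a)) := by
  induction W using Finset.induction_on with
  | empty => simp [pairEnergy]
  | insert w W hw ih =>
    rw [Finset.disjoint_insert_right] at h
    rw [Finset.union_insert, pairEnergy_insert (by simp [h.1, hw]), ih h.2, pairEnergy_insert hw,
      Finset.sum_insert hw, Finset.sum_union h.2]
    abel

open scoped Classical in
theorem increment_pairEnergy (hφ : ∀ γ : Finset (E d), pairEnergy φ γ ≠ ⊥)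
    {Λ : Finset (Lat b)} (hΔ : Δ ⊆ Λ)
    {x : Field b} (hE : pairEnergy φ (points (Λ \ Δ) x) ≠ ⊤) :
    increment (pairEnergy φ) Δ Λ x = pairEnergy φ (newPoints Δ Λ x) +
      ∑ w ∈ newPoints Δ Λ x, ∑ a ∈ points (Λ \ Δ) x, φ (dist w a) := by
  rw [increment, energyDiff, if_neg fun h => hE h.2, points_eq_union hΔ,
    pairEnergy_union (W := newPoints Δ Λ x) Finset.disjoint_sdiff]
  lift pairEnergy φ (points (Λ \ Δ) x) to ℝ using ⟨hE, hφ _⟩ with c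
  exact EReal.add_sub_cancel_left

theorem exists_forall_sum_le {ι : Type*} {f : ι → ℝ≥0∞} (hf : ∑' i, f i ≠ ∞) {δ : ℝ≥0∞}
    (hδ : δ ≠ 0) : ∃ s₀ : Finset ι, ∀ s : Finset ι, Disjoint s s₀ → ∑ i ∈ s, f i ≤ δ := by
  classical
  have h := ENNReal.tendsto_tsum_compl_atTop_zero hf
  obtain ⟨s₀, hs₀⟩ := (h.eventually (ge_mem_nhds (pos_iff_ne_zero.2 hδ))).exists
  refine ⟨s₀, fun s hs => le_trans ?_ hs₀⟩
  have hsub : ∀ i ∈ s, i ∉ s₀ := fun i hi => Finset.disjoint_left.1 hs hi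
  calc ∑ i ∈ s, f i = ∑ i ∈ s.subtype (· ∉ s₀), f i := by
        rw [Finset.sum_subtype_of_mem _ hsub]
    _ ≤ _ := ENNReal.sum_le_tsum _

/-- The two increments differ by the interaction between the new points and the far points. With
displacements bounded by N, the point of a far index i is at distance at least ‖i‖ - C from each new
point, so this interaction is dominated by the tail of a convergent lattice sum. -/
theorem SummablePairPotential.quasiLocal (hd : 0 < d) (hH : IsHamiltonian H)
    (h5 : SummablePairPotential H) (h3 : Hereditary H) {S : Set (E d)}
    (hS : Bornology.IsBounded S) : QuasiLocal b H S := by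
  classical
  obtain ⟨φ, -, ⟨r₀, hmono⟩, hHφ, ε, -, hint⟩ := h5
  obtain rfl : H = pairEnergy φ := by
    ext1 γ
    rw [hHφ, pairEnergy]
  obtain ⟨ψ, ρ, hψ, hψfin, hψφ, hψint⟩ := exists_antitone_majorant hmono hint
  obtain ⟨N, hN⟩ := isBounded_iff_forall_norm_le.1 hS
  intro Δ M η hη
  set C := N + windowRadius Δ M with hC
  have hsum := tsum_lat_ne_top hd b hψ hψfin hψint C
  have hη' : ENNReal.ofReal η / ((Δ.card : ℝ≥0∞) + 1) ≠ 0 := by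
    simp [ENNReal.div_eq_zero_iff, hη]
  obtain ⟨s₀, hs₀⟩ := exists_forall_sum_le hsum hη'
  -- The first term makes the new points of Λ and Λ' the same, the second puts far points at
  -- distance greater than ρ, where ψ dominates |φ|, and the third keeps far indices out of s₀.
  set R := max (windowRadius Δ M) (max (windowRadius Δ M + |ρ|) (∑ i ∈ s₀, ‖(i : E d)‖ + N))
  refine ⟨R, fun x hxS hM Λ' Λ hΔ hΛ hE hfar => ?_⟩
  have hR1 : windowRadius Δ M ≤ R := le_max_left _ _
  have hR2 : windowRadius Δ M + |ρ| ≤ R := (le_max_left _ _).trans (le_max_right _ _)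
  have hR3 : ∑ i ∈ s₀, ‖(i : E d)‖ + N ≤ R := (le_max_right _ _).trans (le_max_right _ _)
  have hnew : newPoints Δ Λ' x = newPoints Δ Λ x := newPoints_eq hM hΛ hR1 hfar
  have hsub : points (Λ' \ Δ) x ⊆ points (Λ \ Δ) x :=
    points_mono (Finset.sdiff_subset_sdiff hΛ le_rfl) x
  have hE' : pairEnergy φ (points (Λ' \ Δ) x) ≠ ⊤ := fun h => hE (h3.mono hsub h)
  rw [increment_pairEnergy hH.ne_bot (hΔ.trans hΛ) hE, increment_pairEnergy hH.ne_bot hΔ hE', hnew]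
  set W := newPoints Δ Λ x
  set F := points (Λ \ Δ) x \ points (Λ' \ Δ) x with hF
  have hsplit : ∑ w ∈ W, ∑ a ∈ points (Λ \ Δ) x, φ (dist w a) =
      ∑ w ∈ W, ∑ a ∈ points (Λ' \ Δ) x, φ (dist w a) + ∑ w ∈ W, ∑ a ∈ F, φ (dist w a) := by
    rw [← Finset.sum_add_distrib]
    refine Finset.sum_congr rfl fun w _ => ?_
    rw [add_comm, hF, Finset.sum_sdiff hsub]
  have hFsub : F ⊆ points (Λ \ Λ') x := by
    intro v hv
    obtain ⟨hv1, hv2⟩ := Finset.mem_sdiff.1 hv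
    obtain ⟨i, hi, rfl⟩ := Finset.mem_image.1 hv1
    obtain ⟨hi, hiΔ⟩ := Finset.mem_sdiff.1 hi
    refine Finset.mem_image_of_mem _ (Finset.mem_sdiff.2 ⟨hi, fun hi' => hv2 ?_⟩)
    exact Finset.mem_image_of_mem _ (Finset.mem_sdiff.2 ⟨hi', hiΔ⟩)
  have hW : ∀ w ∈ W, ‖w‖ ≤ windowRadius Δ M := fun w hw =>
    norm_le_windowRadius hM (Finset.mem_sdiff.1 hw).1
  have hinner : ∀ w ∈ W, ∑ a ∈ F, (φ (dist w a)).abs ≤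
      ENNReal.ofReal η / ((Δ.card : ℝ≥0∞) + 1) := by
    intro w hw
    calc ∑ a ∈ F, (φ (dist w a)).abs ≤ ∑ a ∈ points (Λ \ Λ') x, (φ (dist w a)).abs :=
          Finset.sum_le_sum_of_subset hFsub
      _ ≤ ∑ i ∈ Λ \ Λ', (φ (dist w ((i : E d) + x i))).abs :=
          Finset.sum_image_le_of_nonneg fun _ _ => zero_le
      _ ≤ ∑ i ∈ Λ \ Λ', ψ (‖(i : E d)‖ - C) := by
          refine Finset.sum_le_sum fun i hi => ?_
          obtain ⟨hi, hi'⟩ := Finset.mem_sdiff.1 hi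
          have hfi := hfar i hi hi'
          have hwi := hW w hw
          have hxi := hN (x i) (hxS i)
          have hdist : ‖(i : E d) + x i‖ - ‖w‖ ≤ dist w ((i : E d) + x i) := by
            rw [dist_comm, dist_eq_norm]
            exact norm_sub_norm_le _ _
          have hni : ‖(i : E d)‖ ≤ ‖(i : E d) + x i‖ + ‖x i‖ := by
            simpa using norm_sub_le ((i : E d) + x i) (x i)
          refine (hψφ _ ?_).trans (hψ ?_)
          · linarith [le_abs_self ρ]
          · linarith
      _ ≤ _ := by
          refine hs₀ _ (Finset.disjoint_left.2 fun i hi hi₀ => ?_)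
          obtain ⟨hi, hi'⟩ := Finset.mem_sdiff.1 hi
          have h1 := hfar i hi hi'
          have h2 := norm_add_le (i : E d) (x i)
          have h3 := hN (x i) (hxS i)
          have h4 := Finset.single_le_sum (f := fun i : Lat b => ‖(i : E d)‖)
            (fun _ _ => norm_nonneg _) hi₀
          linarith
  have hWcard : (W.card : ℝ≥0∞) ≤ Δ.card := by
    exact_mod_cast (Finset.card_le_card Finset.sdiff_subset).trans Finset.card_image_le
  have htot : ∑ p ∈ W ×ˢ F, (φ (dist p.1 p.2)).abs ≤ ENNReal.ofReal η := by
    rw [Finset.sum_product]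
    refine (Finset.sum_le_card_nsmul _ _ _ hinner).trans ?_
    rw [nsmul_eq_mul]
    calc (W.card : ℝ≥0∞) * (ENNReal.ofReal η / (Δ.card + 1))
        ≤ (Δ.card + 1) * (ENNReal.ofReal η / (Δ.card + 1)) := by
          gcongr
          exact hWcard.trans le_self_add
      _ ≤ _ := ENNReal.mul_div_le
  obtain ⟨hle, hge⟩ := ereal_sum_le_of_abs_le (W ×ˢ F) (f := fun p => φ (dist p.1 p.2))
    (fun _ _ => le_rfl) hη.le htot
  rw [Finset.sum_product] at hle hge
  rw [hsplit, ← add_assoc]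
  refine ⟨add_le_add le_rfl hle, ?_⟩
  rw [add_assoc]
  exact le_add_of_nonneg_right hge

end

/-! ### Gibbs perturbed lattices -/

section

variable {d : ℕ} {b : Module.Basis (Fin d) ℝ (E d)} {H : Finset (E d) → EReal} {Q : Measure (E d)}

/-- Quasi-locality holds for all displacements in the finite range case, and for displacements in
the support of Q, a closed set of full mass, in the pair potential case. -/
theorem gibbsMeasures_nonempty (hd : 0 < d) [IsProbabilityMeasure Q] (hH : IsHamiltonian H)
    (h1 : Stable H) (h2 : NonDegenerate b H) (h3 : Hereditary H) (h4 : TranslationInvariant H)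
    (h5 : FiniteRange H ∨ (SummablePairPotential H ∧ HasBoundedSupport Q)) :
    (gibbsMeasures b H Q).Nonempty := by
  rcases h5 with h5 | ⟨h5, hQ⟩
  · exact (h5.quasiLocal h3).exists_isGibbsMeasure hH h1 h2 h3 h4 MeasurableSet.univ (by simp)
  · exact (h5.quasiLocal hd hH h3 hQ).exists_isGibbsMeasure hH h1 h2 h3 h4
      Measure.isClosed_support.measurableSet Measure.measure_compl_support

theorem gibbsPerturbedLattices_nonempty (h : (gibbsMeasures b H Q).Nonempty) :
    (gibbsPerturbedLattices b H Q).Nonempty := by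
  obtain ⟨P, hP⟩ := h
  exact ⟨_, P, hP, isStationaryPointProcess_perturbedLattice hP.invariant measurable_fst
    measurable_snd Measure.map_id, rfl⟩

theorem IsGibbsPerturbation.map_prodMk {S : Type*} [MeasurableSpace S] {μ : Measure S}
    {X : S → Field b} {U : S → E d} (h : IsGibbsPerturbation b H Q μ X U) :
    μ.map (fun s => (X s, U s)) = (μ.map X).prod (uniformD b) := by
  obtain ⟨P, -, hPX⟩ := h.gibbs
  -- The image of μ under X is a probability measure, so μ itself has mass 1.
  have : IsFiniteMeasure μ := by
    refine ⟨?_⟩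
    have hu : μ.map X Set.univ = 1 := by rw [hPX]; exact measure_univ
    rw [Measure.map_apply h.measurable_X MeasurableSet.univ, Set.preimage_univ] at hu
    rw [hu]
    exact ENNReal.one_lt_top
  rw [(indepFun_iff_map_prod_eq_prod_map_map h.measurable_X.aemeasurable
    h.measurable_U.aemeasurable).1 h.indep, h.uniform]

end

end GibbsLattice

end

theorem theorem1 {d : ℕ} (hd : 0 < d)
    (b : Module.Basis (Fin d) ℝ (GibbsLattice.E d))
    (H : Finset (GibbsLattice.E d) → EReal) (hH : GibbsLattice.IsHamiltonian H)
    (Q : Measure (GibbsLattice.E d)) [IsProbabilityMeasure Q]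
    (h1 : GibbsLattice.Stable H) (h2 : GibbsLattice.NonDegenerate b H)
    (h3 : GibbsLattice.Hereditary H) (h4 : GibbsLattice.TranslationInvariant H)
    (h5 : (GibbsLattice.FiniteRange H ∧ GibbsLattice.HasExpMoment Q 1) ∨
      (GibbsLattice.SummablePairPotential H ∧ GibbsLattice.HasBoundedSupport Q)) :
    (GibbsLattice.gibbsMeasures b H Q).Nonempty ∧
    (GibbsLattice.gibbsPerturbedLattices b H Q).Nonempty ∧
    ∀ (S : Type*) [MeasurableSpace S] (μ : Measure S)
      (X : S → GibbsLattice.Field b) (U : S → GibbsLattice.E d),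
      GibbsLattice.IsGibbsPerturbation b H Q μ X U →
        GibbsLattice.IsStationaryPointProcess μ
          (fun s => GibbsLattice.perturbedLattice (X s) (U s)) ∧
        GibbsLattice.IsCondLaw μ (fun s => GibbsLattice.perturbedLattice (X s) (U s)) U
          (GibbsLattice.lawGiven μ X) ∧
        ∀ u : GibbsLattice.E d, ∀ k ∈ GibbsLattice.Lat b,
          (GibbsLattice.lawGiven μ X u).map (fun γ => γ.translate k) =
            GibbsLattice.lawGiven μ X u := by
  have hne := GibbsLattice.gibbsMeasures_nonempty (b := b) hd hH h1 h2 h3 h4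
    (h5.imp_left And.left)
  refine ⟨hne, GibbsLattice.gibbsPerturbedLattices_nonempty hne, fun S _ μ X U h => ?_⟩
  obtain ⟨P, hP, hPX⟩ := h.gibbs
  have hXU := h.map_prodMk
  rw [hPX] at hXU
  exact ⟨GibbsLattice.isStationaryPointProcess_perturbedLattice hP.invariant h.measurable_X
      h.measurable_U hXU,
    GibbsLattice.isCondLaw_lawGiven h.measurable_X h.measurable_U hPX hXU,
    fun u k hk => GibbsLattice.lawGiven_map_translate h.measurable_X hPX hP.invariant u hk⟩
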